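/- All rings are commutative. A difference ring $(R,\sigma)$ is a ring $R$ with a ring automorphism $\sigma$; its constants are $\mathrm{const}(R,\sigma)=\{c\in R\mid\sigma(c)=c\}$. It is computable if its elements are coded by natural numbers, with decidable equality, such that the ring operations and $\sigma$ are (Turing) computable on codes. Suppose that $K=\mathrm{const}(R,\sigma)$ is a field. For $a=(a_0,\dots,a_m)\in R^{m+1}$ and $f=(f_1,\dots,f_d)\in R^d$ let $$V(a,f,R)=\{(c_1,\dots,c_d,g)\in K^d\times R\mid a_0\,g+a_1\,\sigma(g)+\dots+a_m\,\sigma^m(g)=c_1f_1+\dots+c_df_d\},$$ a $K$-subspace of $K^d\times R$. One can solve parameterized linear difference equations (PLDEs) in $(R,\sigma)$ if there is an algorithm that, given any $m$, $d$, $a\in R^{m+1}\setminus\{0\}$ and $f\in R^d$, returns a finite $K$-basis of $V(a,f,R)$; in particular all these spaces are finite-dimensional. A $\Pi\Sigma$-ring extension $(R,\sigma)$ of a difference ring $(B,\sigma)$ is obtained by a tower $B=B_0\le B_1\le\dots\le B_l=R$ with $\mathrm{const}(R,\sigma)=\mathrm{const}(B,\sigma)$ such that, for each $i$, either $B_i=B_{i-1}[t_i]$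 is a polynomial ring with $\sigma(t_i)-t_i\in B_{i-1}$, or $B_i=B_{i-1}[t_i,t_i^{-1}]$ is a Laurent polynomial ring with $\sigma(t_i)/t_i\in B_{i-1}^*$. If only the first case occurs, it is called a $\Sigma$-extension. **Proposition.** Let $(A,\sigma)$ be a computable difference ring of characteristic $0$ that is a $\Pi\Sigma$-ring extension of a difference field $(F,\sigma)$ (for instance $A=F$); so $A$ is an integral domain and $K=\mathrm{const}(A,\sigma)=\mathrm{const}(F,\sigma)$ is a field. Assume that the nonnegative integer roots of a given nonzero polynomial in $K[X]$ can be computed. If one can solve PLDEs in $(A,\sigma)$, then one can solve PLDEs in any $\Sigma$-extension $(A\langle t_1\rangle\dots\langle t_e\rangle,\sigma)$ of $(A,\sigma)$, where the elements of $A\langle t_1\rangle\dots\langle t_e\rangle=A[t_1,\dots,t_e]$ are given as finite sums of terms $c\,t_1^{m_1}\cdots t_e^{m_e}$ with $c\in A$ and $m_i\in\mathbb N$. -/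

import Mathlib

/-!
# Parameterized linear difference equations (PLDEs) over difference rings

A difference ring is a commutative ring `R` with an automorphism `σ : R ≃+* R`.
Algorithms are computable functions (`Computable`) on codes of ring elements.
-/

namespace DiffRing

section Constants

variable {R : Type*} [CommRing R]

/-- The ring of constants `{c | σ c = c}` of the difference ring `(R, σ)`. -/
def constants (σ : R ≃+* R) : Subring R :=
  (σ : R →+* R).eqLocus (RingHom.id R)

theorem mem_constants (σ : R ≃+* R) (c : R) : c ∈ constants σ ↔ σ c = c := Iff.rfl

/-- The solution space `V(a, f, R)`: all `((c₁, …, c_d), g) ∈ K^d × R`, with `K` the constants, such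
that `a₀ g + a₁ σ(g) + ⋯ + a_m σ^m(g) = c₁ f₁ + ⋯ + c_d f_d`. Here `n = m + 1`. -/
def solutionSpace (σ : R ≃+* R) {n d : ℕ} (a : Fin n → R) (f : Fin d → R) :
    Submodule (constants σ) ((Fin d → constants σ) × R) where
  carrier := {p | ∑ i, a i * (⇑σ)^[(i : ℕ)] p.2 = ∑ j, (p.1 j : R) * f j}
  add_mem' := by
    intro p q hp hq
    simp only [Set.mem_ofPred_eq] at hp hq ⊢
    simp only [Prod.snd_add, Prod.fst_add, iterate_map_add, mul_add, Finset.sum_add_distrib,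
      Pi.add_apply, Subring.coe_add, add_mul, hp, hq]
  zero_mem' := by
    simp [iterate_map_zero]
  smul_mem' := by
    intro c p hp
    simp only [Set.mem_ofPred_eq] at hp ⊢
    have hc : ∀ k : ℕ, (⇑σ)^[k] (c : R) = c := fun k =>
      Function.iterate_fixed ((mem_constants σ _).1 c.2) k
    simp only [Prod.smul_snd, Prod.smul_fst, Pi.smul_apply, Subring.smul_def, smul_eq_mul,
      iterate_map_mul, hc, Subring.coe_mul, mul_assoc, ← Finset.mul_sum, mul_left_comm _ (c : R), hp]

end Constants

section Algorithms

variable {R : Type*} [CommRing R]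

/-- The difference ring `(R, σ)` is computable: its elements are coded by natural numbers (the
`Primcodable` instance; in particular equality is decidable on codes), and the ring operations and
`σ` are computable functions. -/
structure IsComputable [Primcodable R] (σ : R ≃+* R) : Prop where
  add : Computable₂ (fun x y : R => x + y)
  neg : Computable (fun x : R => -x)
  mul : Computable₂ (fun x y : R => x * y)
  aut : Computable (fun x : R => σ x)

/-- The list `L` of codes represents a basis, over the field of constants, of the solution space
`V(a, f, R)`: the `i`-th entry of `L` consists of codes of the entries of the `i`-th basis vector
`((c₁, …, c_d), g)`. The map `ν` sends a code to the ring element that it represents. -/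
def IsSolutionBasis (σ : R ≃+* R) {C : Type*} (ν : C → R) {n d : ℕ} (a : Fin n → R) (f : Fin d → R)
    (L : List (List C × C)) : Prop :=
  ∃ b : Module.Basis (Fin L.length) (constants σ) (solutionSpace σ a f),
    ∀ i : Fin L.length,
      (L.get i).1.map ν = List.ofFn (fun j => (((b i : (Fin d → constants σ) × R).1 j : R))) ∧
      ν (L.get i).2 = (b i : (Fin d → constants σ) × R).2

/-- One can solve PLDEs in `(R, σ)`, where the elements of `R` are given by codes via `ν : C → R`:
there is an algorithm that takes (codes of) any tuples `a = (a₀, …, a_m)`, not all `a_i` zero,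
and `f = (f₁, …, f_d)`, and returns a finite basis of `V(a, f, R)`. -/
def PLDESolvable (σ : R ≃+* R) {C : Type*} [Primcodable C] (ν : C → R) : Prop :=
  ∃ S : List C × List C → List (List C × C), Computable S ∧
    ∀ a f : List C, (∃ x ∈ a, ν x ≠ 0) →
      IsSolutionBasis σ ν (fun i : Fin a.length => ν (a.get i))
        (fun j : Fin f.length => ν (f.get j)) (S (a, f))

/-- One can compute the nonnegative integer roots of nonzero univariate polynomials
`l₀ + l₁ X + ⋯ + l_k X^k` whose coefficients are constants of `(R, σ)`. -/
def NatRootsComputable [Primcodable R] (σ : R ≃+* R) : Prop :=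
  ∃ N : List R → List ℕ, Computable N ∧
    ∀ l : List R, (∀ x ∈ l, x ∈ constants σ) → (∃ x ∈ l, x ≠ 0) →
      ∀ n : ℕ, n ∈ N l ↔ ∑ i : Fin l.length, l.get i * (n : R) ^ (i : ℕ) = 0

end Algorithms

section Extensions

/-- `PiSigmaTower σ B B'`: inside the difference ring `(R, σ)`, the subring `B'` arises from `B`
by adjoining, one after the other, `Σ`-monomials (`B'[t]` is a polynomial ring over `B'`, and
`σ(t) - t ∈ B'`) and `Π`-monomials (`B'[t, t⁻¹]` is a Laurent polynomial ring over `B'`, and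
`σ(t) / t` is a unit of `B'`). -/
inductive PiSigmaTower {R : Type*} [CommRing R] (σ : R ≃+* R) (B : Subring R) : Subring R → Prop
  | base : PiSigmaTower σ B B
  | sigma {B' : Subring R} (t : R) (tower : PiSigmaTower σ B B') (transc : Transcendental B' t)
      (shift : σ t - t ∈ B') :
      PiSigmaTower σ B (Subring.closure (insert t (B' : Set R)))
  | pi {B' : Subring R} (t : Rˣ) (tower : PiSigmaTower σ B B') (transc : Transcendental B' (t : R))
      (shift : ∃ u : B'ˣ, σ (t : R) = ((u : B') : R) * t) :
      PiSigmaTower σ B (Subring.closure (insert (t : R) (insert ((t⁻¹ : Rˣ) : R) (B' : Set R))))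

/-- `(R, σ)` is a `ΠΣ`-ring extension of its difference subfield `(F, σ)` (possibly `F = R`). -/
structure IsPiSigmaRingExtension {R : Type*} [CommRing R] (σ : R ≃+* R) (F : Subring R) : Prop where
  isField : IsField F
  map_eq : F.map (σ : R →+* R) = F
  tower : PiSigmaTower σ F ⊤
  const : constants σ ≤ F

/-- `(E, τ)` is a `Σ`-extension `A⟨t₁⟩…⟨t_e⟩` of `(A, σ)`: the ring `E` is the iterated polynomial
ring `A[t₁]…[t_e]`, `τ` extends `σ`, `τ(t_i) - t_i ∈ A[t₁]…[t_{i-1}]` for all `i`, and both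
difference rings have the same constants. -/
structure IsSigmaExtension {A E : Type*} [CommRing A] [CommRing E] [Algebra A E]
    (σ : A ≃+* A) (τ : E ≃+* E) {e : ℕ} (t : Fin e → E) : Prop where
  algebraicIndependent : AlgebraicIndependent A t
  adjoin_eq_top : Algebra.adjoin A (Set.range t) = ⊤
  extends_aut : ∀ x : A, τ (algebraMap A E x) = algebraMap A E (σ x)
  shift : ∀ i : Fin e, τ (t i) - t i ∈ Algebra.adjoin A (t '' {j | j < i})
  const : ∀ x ∈ constants τ, ∃ c ∈ constants σ, algebraMap A E c = x

/-- An element of `A[t₁]…[t_e]` is coded by a list of terms `c t₁^{m₁} ⋯ t_e^{m_e}`, each given by its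
coefficient `c ∈ A` and its exponents `m`. This is the sum of the terms in the list. -/
def evalTerms {A E : Type*} [CommRing A] [CommRing E] [Algebra A E] {e : ℕ} (t : Fin e → E)
    (l : List (A × (Fin e → ℕ))) : E :=
  (l.map fun p => algebraMap A E p.1 * ∏ i, t i ^ p.2 i).sum

end Extensions

end DiffRing

/-! The generators are adjoined one at a time, so everything reduces to the step from (R, σ) to R[X]
with σ(X) = X + β, where R[X] has no new constants (`Ready.polynomial`). Carried along the tower are
computability, a PLDE solver, a bound for natural roots, and the purely algebraic property `Good`.

Let L = Σ a_s σ^s be an operator over R[X] with M coefficients, of maximal degree p, and let α be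
the operator over R formed by the coefficients of X^p. If deg g ≤ n, the coefficient of X^(n+p) in
L(g) is α applied to the coefficient of X^n in g (`coeff_diffOp_top`). Once the degrees of the
solutions are bounded, their coefficients are found from the top downwards, each by one PLDE over R
for α, and what remains at the end are linear relations over the constants (`BddInv.step`,
`Solver.polynomial_of_bound`). Linear algebra over the constants is itself done by the solver, with
equations of order zero (`exists_relations`).

The heart of the proof is the degree bound. Call n defective if some g of degree n makes the M
coefficients of L(g) in degrees n+p, …, n+p-M+1 vanish. A solution whose degree is large compared
with the right-hand sides has defective degree. Only finitely many n are defective, by reduction of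
order (`finite_defective_degrees`): if g₀ is defective and g = g₀y, then L(g) - L(g₀)y is an
operator with M-1 coefficients applied to σ(y) - y, and passing from y to σ(y) - y lowers a nonzero
degree by at most one. This last fact rests on characteristic 0 and on the unsolvability of σ(h) - h
= β in the field of fractions of R (`le_natDegree_wronskian`).

To make finiteness effective, the top M coefficient equations are solved for an undetermined degree
n (`LevelInv.step`). The binomial coefficients involving n are treated as free parameters of PLDEs
over R, and their consistency becomes a linear system over the constants whose entries are
polynomials in n. If the generic kernel had a vector with a nonzero coordinate at a generator of the
leading coefficient, specialization would make almost every n defective. Hence for each such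
coordinate z_u there is a certificate P(n)z_u = 0 with P ≠ 0. It is found by search, and the natural
roots of P bound the degrees (`LevelInv.exists_cert`, `exists_degree_bound`).

Finally, σ(h) - h = β has no solution in R, since X - h would be a new constant. `Good` says that
solutions in the field of fractions of uσ(h) - h = b, with u a unit and b in the ring, already lie
in the ring, which excludes fractional solutions too. `Good` holds for fields and passes to the two
kinds of extension (`Good.polynomial`, `Good.laurent`): a reduced denominator divides its own image
up to a power of X, which forces it to be trivial. -/

namespace DiffRing

/-! ### Closure properties of computable functions and decidable predicates -/

section Computability

variable {X Y Z : Type*} [Primcodable X] [Primcodable Y] [Primcodable Z]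

theorem computable_tabulate {n : X → ℕ} {F : X → ℕ → Y} (hn : Computable n) (hF : Computable₂ F) :
    Computable fun x => (List.range (n x)).map (F x) := by
  have h : Computable fun x => (Nat.rec (motive := fun _ => List Y) [] (fun i l => l ++ [F x i]) (n x)) := by
    refine Computable.nat_rec (h := fun x p => p.2 ++ [F x p.1]) hn (Computable.const _) ?_
    exact Computable.list_concat.comp (Computable.snd.comp Computable.snd)
      (hF.comp Computable.fst (Computable.fst.comp Computable.snd))
  refine h.of_eq fun x => ?_
  induction n x with
  | zero => rfl
  | succ k ih => simp only [ih, List.range_succ, List.map_append, List.map_cons, List.map_nil]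

theorem computable_iterate {n : X → ℕ} {g : X → Y} {h : X → ℕ × Y → Y} (hn : Computable n)
    (hg : Computable g) (hh : Computable₂ h) :
    Computable fun x => Nat.rec (motive := fun _ => Y) (g x) (fun i y => h x (i, y)) (n x) :=
  Computable.nat_rec hn hg hh

/-- Recursion with an invariant. -/
theorem exists_computable_rec {Inv : X → ℕ → Y → Prop} {N : X → ℕ} (hN : Computable N)
    (init : ∃ F : X → Y, Computable F ∧ ∀ x, Inv x 0 (F x))
    (step : ∃ G : X × ℕ × Y → Y, Computable G ∧
      ∀ x n y, n < N x → Inv x n y → Inv x (n + 1) (G (x, n, y))) :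
    ∃ F : X → Y, Computable F ∧ ∀ x, Inv x (N x) (F x) := by
  obtain ⟨F, hF, hF'⟩ := init
  obtain ⟨G, hG, hG'⟩ := step
  refine ⟨_, computable_iterate (h := fun x p => G (x, p)) hN hF hG, fun x => ?_⟩
  have key : ∀ k ≤ N x, Inv x k
      (Nat.rec (motive := fun _ => Y) (F x) (fun i y => G (x, (i, y))) k) := by
    intro k
    induction k with
    | zero => intro _; exact hF' x
    | succ k ih => intro hk; exact hG' x k _ hk (ih (Nat.le_of_succ_le hk))
  exact key _ le_rfl

theorem ComputablePred.of_bool {b : X → Bool} (hb : Computable b) : ComputablePred fun x => b x = true :=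
  _root_.ComputablePred.computable_iff.2 ⟨b, hb, rfl⟩

theorem ComputablePred.exists_bool {p : X → Prop} (hp : ComputablePred p) :
    ∃ b : X → Bool, Computable b ∧ ∀ x, b x = true ↔ p x := by
  obtain ⟨b, hb, rfl⟩ := _root_.ComputablePred.computable_iff.1 hp
  exact ⟨b, hb, fun _ => Iff.rfl⟩

theorem ComputablePred.comp' {p : Y → Prop} (hp : ComputablePred p) {f : X → Y} (hf : Computable f) :
    ComputablePred fun x => p (f x) := by
  obtain ⟨b, hb, h⟩ := ComputablePred.exists_bool hp
  exact (ComputablePred.of_bool (hb.comp hf)).of_eq fun x => h _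

theorem ComputablePred.and' {p q : X → Prop} (hp : ComputablePred p) (hq : ComputablePred q) :
    ComputablePred fun x => p x ∧ q x := by
  obtain ⟨b, hb, h⟩ := ComputablePred.exists_bool hp
  obtain ⟨c, hc, h'⟩ := ComputablePred.exists_bool hq
  refine (ComputablePred.of_bool (b := fun x => cond (b x) (c x) false)
    (Computable.cond hb hc (Computable.const _))).of_eq fun x => ?_
  rw [← h, ← h']
  cases b x <;> simp

theorem ComputablePred.or' {p q : X → Prop} (hp : ComputablePred p) (hq : ComputablePred q) :
    ComputablePred fun x => p x ∨ q x :=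
  (ComputablePred.and' hp.not hq.not).not.of_eq fun x => by tauto

theorem ComputablePred.imp' {p q : X → Prop} (hp : ComputablePred p) (hq : ComputablePred q) :
    ComputablePred fun x => p x → q x :=
  (ComputablePred.and' hp hq.not).not.of_eq fun x => by tauto

theorem ComputablePred.forall_lt' {n : X → ℕ} (hn : Computable n) {p : X → ℕ → Prop}
    (hp : ComputablePred fun a : X × ℕ => p a.1 a.2) : ComputablePred fun x => ∀ i < n x, p x i := by
  obtain ⟨b, hb, h⟩ := ComputablePred.exists_bool hp
  refine (ComputablePred.of_bool (computable_iterate (g := fun _ : X => true)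
    (h := fun x p => cond (b (x, p.1)) p.2 false) hn (Computable.const _) (Computable.cond
      (hb.comp (Computable.fst.pair (Computable.fst.comp Computable.snd)))
      (Computable.snd.comp Computable.snd) (Computable.const _)))).of_eq fun x => ?_
  induction n x with
  | zero => simp
  | succ k ih =>
    rw [Nat.forall_lt_succ_right, ← ih]
    simp only
    rw [← h (x, k)]
    cases b (x, k) <;> simp

theorem ComputablePred.exists_lt' {n : X → ℕ} (hn : Computable n) {p : X → ℕ → Prop}
    (hp : ComputablePred fun a : X × ℕ => p a.1 a.2) : ComputablePred fun x => ∃ i < n x, p x i :=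
  (ComputablePred.forall_lt' hn (p := fun x i => ¬ p x i) hp.not).not.of_eq fun x => by
    push Not; rfl

theorem computablePred_nat_eq {f g : X → ℕ} (hf : Computable f) (hg : Computable g) :
    ComputablePred fun x => f x = g x :=
  ComputablePred.comp' (p := fun a : ℕ × ℕ => a.1 = a.2)
    ⟨fun _ => inferInstance, (Primrec.eq (α := ℕ)).decide.to_comp⟩ (hf.pair hg)

theorem computablePred_nat_le {f g : X → ℕ} (hf : Computable f) (hg : Computable g) :
    ComputablePred fun x => f x ≤ g x :=
  ComputablePred.comp' (p := fun a : ℕ × ℕ => a.1 ≤ a.2)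
    ⟨fun _ => inferInstance, Primrec.nat_le.decide.to_comp⟩ (hf.pair hg)

theorem computablePred_nat_lt {f g : X → ℕ} (hf : Computable f) (hg : Computable g) :
    ComputablePred fun x => f x < g x :=
  computablePred_nat_le (Computable.succ.comp hf) hg

theorem computable_ite {p : X → Prop} [DecidablePred p] (hp : ComputablePred p) {f g : X → Y}
    (hf : Computable f) (hg : Computable g) : Computable fun x => if p x then f x else g x := by
  obtain ⟨b, hb, h⟩ := ComputablePred.exists_bool hp
  refine (Computable.cond hb hf hg).of_eq fun x => ?_
  by_cases hx : p x
  · rw [if_pos hx, (h x).2 hx]; rfl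
  · rw [if_neg hx, Bool.eq_false_iff.2 fun h' => hx ((h x).1 h')]; rfl

/-- Unbounded search. -/
theorem exists_computable_search {D : X → Y → Prop} {pre : X → Prop}
    (hD : ComputablePred fun p : X × Y => D p.1 p.2) (hpre : ComputablePred pre) [Inhabited Y]
    (h : ∀ x, pre x → ∃ y, D x y) :
    ∃ F : X → Y, Computable F ∧ ∀ x, pre x → D x (F x) := by
  -- Outside the precondition every candidate is accepted. This makes the search total, so it
  -- defines a genuine computable function.
  obtain ⟨b, hb, hb'⟩ := ComputablePred.exists_bool
    (ComputablePred.or' hD (ComputablePred.comp' hpre.not Computable.fst))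
  let f : X → ℕ → Option Y := fun x n =>
    (Encodable.decode (α := Y) n).bind fun y => cond (b (x, y)) (some y) none
  have hf : Computable₂ f := by
    refine Computable.option_bind (Computable.decode.comp Computable.snd) ?_
    refine Computable.cond (hb.comp ((Computable.fst.comp Computable.fst).pair Computable.snd))
      (Computable.option_some.comp Computable.snd) (Computable.const _)
  have hdom : ∀ x, (Nat.rfindOpt (f x)).Dom := by
    intro x
    rw [Nat.rfindOpt_dom]
    obtain ⟨y, hy⟩ : ∃ y, D x y ∨ ¬ pre x := by
      by_cases hx : pre x
      · obtain ⟨y, hy⟩ := h x hx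
        exact ⟨y, Or.inl hy⟩
      · exact ⟨default, Or.inr hx⟩
    refine ⟨Encodable.encode y, y, ?_⟩
    simp [f, (hb' (x, y)).2 hy]
  refine ⟨fun x => (Nat.rfindOpt (f x)).get (hdom x), ?_, fun x hx => ?_⟩
  · exact (Partrec.rfindOpt hf).of_eq_tot fun x => Part.get_mem _
  · obtain ⟨n, hn⟩ := Nat.rfindOpt_spec (Part.get_mem (hdom x))
    show D x ((Nat.rfindOpt (f x)).get (hdom x))
    generalize (Nat.rfindOpt (f x)).get (hdom x) = y at hn ⊢
    simp only [f, Option.mem_def, Option.bind_eq_some_iff] at hn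
    obtain ⟨z, -, hz⟩ := hn
    cases hbz : b (x, z) with
    | false => simp [hbz] at hz
    | true =>
      simp only [hbz, cond_true, Option.some.injEq] at hz
      subst hz
      exact ((hb' _).1 hbz).resolve_right (not_not.2 hx)

theorem computable_add {f g : X → ℕ} (hf : Computable f) (hg : Computable g) :
    Computable fun x => f x + g x := Primrec.nat_add.to_comp.comp hf hg

theorem computable_sub {f g : X → ℕ} (hf : Computable f) (hg : Computable g) :
    Computable fun x => f x - g x := Primrec.nat_sub.to_comp.comp hf hg

theorem computable_mul {f g : X → ℕ} (hf : Computable f) (hg : Computable g) :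
    Computable fun x => f x * g x := Primrec.nat_mul.to_comp.comp hf hg

theorem computable_div {f g : X → ℕ} (hf : Computable f) (hg : Computable g) :
    Computable fun x => f x / g x := Primrec.nat_div.to_comp.comp hf hg

theorem computable_mod {f g : X → ℕ} (hf : Computable f) (hg : Computable g) :
    Computable fun x => f x % g x := Primrec.nat_mod.to_comp.comp hf hg

theorem computable_list_getD (d : Y) {f : X → List Y} {g : X → ℕ} (hf : Computable f) (hg : Computable g) :
    Computable fun x => (f x).getD (g x) d := (Primrec.list_getD d).to_comp.comp hf hg

theorem list_map_eq_tabulate {α β : Type*} (l : List α) (f : α → β) (d : α) :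
    l.map f = (List.range l.length).map fun i => f (l.getD i d) := by
  apply List.ext_getElem <;> simp
  intro i h
  rw [List.getElem?_eq_getElem h]; rfl

theorem computable_list_map {f : X → List Y} {g : X → Y → Z} (hf : Computable f) (hg : Computable₂ g) :
    Computable fun x => (f x).map (g x) := by
  -- The tabulation reads entries with a default value, which exists only if `Y` is nonempty;
  -- otherwise all lists are empty.
  by_cases hY : Nonempty Y
  · obtain ⟨d⟩ := hY
    refine (computable_tabulate (F := fun x i => g x ((f x).getD i d)) (Computable.list_length.comp hf)
      (hg.comp Computable.fst (computable_list_getD d (hf.comp Computable.fst) Computable.snd))).of_eq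
        fun x => ?_
    rw [list_map_eq_tabulate _ _ d]
  · have : ∀ x, f x = [] := fun x => List.eq_nil_iff_forall_not_mem.2 fun y => (hY ⟨y⟩).elim
    exact (Computable.const []).of_eq fun x => by simp [this]

theorem computable_list_sum {f : X → List ℕ} (hf : Computable f) : Computable fun x => (f x).sum := by
  refine (computable_iterate (g := fun _ => 0) (h := fun x p => p.2 + (f x).getD p.1 0)
    (Computable.list_length.comp hf) (Computable.const _) (computable_add
      (Computable.snd.comp Computable.snd) (computable_list_getD 0 (hf.comp Computable.fst)
        (Computable.fst.comp Computable.snd)))).of_eq fun x => ?_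
  have key : ∀ k, Nat.rec (motive := fun _ => ℕ) 0 (fun i y => y + (f x).getD i 0) k = ((f x).take k).sum := by
    intro k
    induction k with
    | zero => simp
    | succ k ih =>
      rw [List.take_add_one, List.sum_append, ← ih]
      simp only [List.getD]
      cases (f x)[k]? <;> simp
  exact (key _).trans (by simp)

theorem computable_list_flatten {f : X → List (List Y)} (hf : Computable f) :
    Computable fun x => (f x).flatten := by
  refine (computable_iterate (g := fun _ => []) (h := fun x p => p.2 ++ (f x).getD p.1 [])
    (Computable.list_length.comp hf) (Computable.const _) (Computable.list_append.comp
      (Computable.snd.comp Computable.snd) (computable_list_getD [] (hf.comp Computable.fst)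
        (Computable.fst.comp Computable.snd)))).of_eq fun x => ?_
  have key : ∀ k, Nat.rec (motive := fun _ => List Y) [] (fun i y => y ++ (f x).getD i []) k =
      ((f x).take k).flatten := by
    intro k
    induction k with
    | zero => simp
    | succ k ih =>
      rw [List.take_add_one, List.flatten_append, ← ih]
      simp only [List.getD]
      cases (f x)[k]? <;> simp
  exact (key _).trans (by simp)

end Computability

/-! ### Computable functions with values in a coded set -/

section Represented

variable {X : Type*} [Primcodable X] {C : Type*} [Primcodable C] {R : Type*}
  {C' : Type*} [Primcodable C'] {R' : Type*}

/-- The function `φ` is computable, where the elements of `R` are given by codes via `ν`. -/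
def RC (ν : C → R) (φ : X → R) : Prop := ∃ F : X → C, Computable F ∧ ∀ x, ν (F x) = φ x

variable {ν : C → R} {ν' : C' → R'}

theorem RC.of_eq {φ ψ : X → R} (h : RC ν φ) (H : ∀ x, φ x = ψ x) : RC ν ψ := by
  obtain rfl : φ = ψ := funext H
  exact h

theorem RC.code {F : X → C} (hF : Computable F) : RC ν fun x => ν (F x) := ⟨F, hF, fun _ => rfl⟩

theorem RC.precomp {φ : X → R} (h : RC ν φ) {Y : Type*} [Primcodable Y] {f : Y → X} (hf : Computable f) :
    RC ν fun y => φ (f y) := by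
  obtain ⟨F, hF, H⟩ := h
  exact ⟨_, hF.comp hf, fun y => H _⟩

theorem RC.ite {p : X → Prop} [DecidablePred p] (hp : ComputablePred p) {φ ψ : X → R} (h : RC ν φ)
    (h' : RC ν ψ) : RC ν fun x => if p x then φ x else ψ x := by
  obtain ⟨F, hF, H⟩ := h
  obtain ⟨G, hG, H'⟩ := h'
  refine ⟨_, computable_ite hp hF hG, fun x => ?_⟩
  split_ifs <;> simp [*]

theorem RC.prod {φ : X → R} {ψ : X → R'} (h : RC ν φ) (h' : RC ν' ψ) :
    RC (Prod.map ν ν') fun x => (φ x, ψ x) := by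
  obtain ⟨F, hF, H⟩ := h
  obtain ⟨G, hG, H'⟩ := h'
  exact ⟨_, hF.pair hG, fun x => by simp [H, H']⟩

theorem RC.fst {φ : X → R × R'} (h : RC (Prod.map ν ν') φ) : RC ν fun x => (φ x).1 := by
  obtain ⟨F, hF, H⟩ := h
  exact ⟨_, Computable.fst.comp hF, fun x => by simp [← H]⟩

theorem RC.snd {φ : X → R × R'} (h : RC (Prod.map ν ν') φ) : RC ν' fun x => (φ x).2 := by
  obtain ⟨F, hF, H⟩ := h
  exact ⟨_, Computable.snd.comp hF, fun x => by simp [← H]⟩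

theorem RC.tabulate {n : X → ℕ} (hn : Computable n) {φ : X → ℕ → R} (h : RC ν fun p : X × ℕ => φ p.1 p.2) :
    RC (List.map ν) fun x => (List.range (n x)).map (φ x) := by
  obtain ⟨F, hF, H⟩ := h
  refine ⟨_, computable_tabulate hn (F := fun x i => F (x, i)) hF, fun x => ?_⟩
  simp [List.map_map, Function.comp_def, H]

theorem RC.length {φ : X → List R} (h : RC (List.map ν) φ) : Computable fun x => (φ x).length := by
  obtain ⟨F, hF, H⟩ := h
  exact (Computable.list_length.comp hF).of_eq fun x => by simp [← H]

theorem RC.getD {φ : X → List R} (h : RC (List.map ν) φ) {n : X → ℕ} (hn : Computable n) {d : R}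
    (hd : ∃ c, ν c = d) : RC ν fun x => (φ x).getD (n x) d := by
  obtain ⟨F, hF, H⟩ := h
  obtain ⟨c, rfl⟩ := hd
  exact ⟨_, computable_list_getD c hF hn, fun x => by simp [← H, List.getD, Option.getD_map]⟩

theorem RC.append {φ ψ : X → List R} (h : RC (List.map ν) φ) (h' : RC (List.map ν) ψ) :
    RC (List.map ν) fun x => φ x ++ ψ x := by
  obtain ⟨F, hF, H⟩ := h
  obtain ⟨G, hG, H'⟩ := h'
  exact ⟨_, Computable.list_append.comp hF hG, fun x => by simp [H, H']⟩

theorem RC.list_map {φ : X → List R} (h : RC (List.map ν) φ) {ψ : X → R → R'}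
    (hψ : RC ν' fun p : X × C => ψ p.1 (ν p.2)) : RC (List.map ν') fun x => (φ x).map (ψ x) := by
  obtain ⟨F, hF, H⟩ := h
  obtain ⟨G, hG, H'⟩ := hψ
  refine ⟨_, computable_list_map hF (g := fun x c => G (x, c)) hG, fun x => ?_⟩
  simp [← H, List.map_map, Function.comp_def, H']

theorem RC.const {r : R} (h : ∃ c, ν c = r) : RC ν fun _ : X => r := by
  obtain ⟨c, rfl⟩ := h
  exact RC.code (Computable.const c)

theorem RC.rec {n : X → ℕ} (hn : Computable n) {φ : X → R} {ψ : X → ℕ → R → R} (h : RC ν φ)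
    (h' : RC ν fun p : X × ℕ × C => ψ p.1 p.2.1 (ν p.2.2)) :
    RC ν fun x => Nat.rec (motive := fun _ => R) (φ x) (ψ x) (n x) := by
  obtain ⟨F, hF, H⟩ := h
  obtain ⟨G, hG, H'⟩ := h'
  refine ⟨_, computable_iterate (h := fun x p => G (x, p)) hn hF hG, fun x => ?_⟩
  have key : ∀ k, ν (Nat.rec (motive := fun _ => C) (F x) (fun i y => G (x, (i, y))) k) =
      Nat.rec (motive := fun _ => R) (φ x) (ψ x) k := by
    intro k
    induction k with
    | zero => exact H x
    | succ k ih => exact (H' _).trans (by simp only [ih])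
  exact key _

end Represented

open Polynomial

/-! ### Effective arithmetic in R and in R[X] -/

section CodedRing

variable {Ω : Type*} [Primcodable Ω] {C : Type*} [Primcodable C] {R : Type*} [CommRing R]

/-- The difference ring `(R, σ)` is computable on the codes given by `ν : C → R`. -/
structure Coded (σ : R ≃+* R) (ν : C → R) : Prop where
  surj : Function.Surjective ν
  add : RC ν fun p : C × C => ν p.1 + ν p.2
  mul : RC ν fun p : C × C => ν p.1 * ν p.2
  neg : RC ν fun c : C => -ν c
  aut : RC ν fun c : C => σ (ν c)
  eq_zero : ComputablePred fun c : C => ν c = 0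

variable {σ : R ≃+* R} {ν : C → R}

namespace Coded

variable (hc : Coded σ ν)
include hc

theorem rc_const (r : R) : RC ν fun _ : Ω => r := RC.const (hc.surj r)

theorem rc_add {φ ψ : Ω → R} (h : RC ν φ) (h' : RC ν ψ) : RC ν fun x => φ x + ψ x := by
  obtain ⟨F, hF, H⟩ := h
  obtain ⟨G, hG, H'⟩ := h'
  exact (hc.add.precomp (hF.pair hG)).of_eq fun x => by simp [H, H']

theorem rc_mul {φ ψ : Ω → R} (h : RC ν φ) (h' : RC ν ψ) : RC ν fun x => φ x * ψ x := by
  obtain ⟨F, hF, H⟩ := h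
  obtain ⟨G, hG, H'⟩ := h'
  exact (hc.mul.precomp (hF.pair hG)).of_eq fun x => by simp [H, H']

theorem rc_neg {φ : Ω → R} (h : RC ν φ) : RC ν fun x => -φ x := by
  obtain ⟨F, hF, H⟩ := h
  exact (hc.neg.precomp hF).of_eq fun x => by simp [H]

theorem rc_sub {φ ψ : Ω → R} (h : RC ν φ) (h' : RC ν ψ) : RC ν fun x => φ x - ψ x :=
  (hc.rc_add h (hc.rc_neg h')).of_eq fun _ => (sub_eq_add_neg _ _).symm

theorem rc_aut {φ : Ω → R} (h : RC ν φ) : RC ν fun x => σ (φ x) := by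
  obtain ⟨F, hF, H⟩ := h
  exact (hc.aut.precomp hF).of_eq fun x => by simp [H]

theorem eq_zero' {φ : Ω → R} (h : RC ν φ) : ComputablePred fun x => φ x = 0 := by
  obtain ⟨F, hF, H⟩ := h
  exact (ComputablePred.comp' hc.eq_zero hF).of_eq fun x => by simp [H]

theorem eq' {φ ψ : Ω → R} (h : RC ν φ) (h' : RC ν ψ) : ComputablePred fun x => φ x = ψ x :=
  (hc.eq_zero' (hc.rc_sub h h')).of_eq fun _ => sub_eq_zero

theorem rc_iterate {n : Ω → ℕ} (hn : Computable n) {φ : Ω → R} (h : RC ν φ) :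
    RC ν fun x => (⇑σ)^[n x] (φ x) := by
  refine (RC.rec (ψ := fun _ _ r => σ r) hn h (hc.rc_aut (RC.code
    (Computable.snd.comp Computable.snd)))).of_eq fun x => ?_
  induction n x with
  | zero => rfl
  | succ k ih => rw [Function.iterate_succ_apply', ← ih]

theorem rc_pow {n : Ω → ℕ} (hn : Computable n) {φ : Ω → R} (h : RC ν φ) :
    RC ν fun x => φ x ^ n x := by
  refine (RC.rec (ψ := fun x _ r => r * φ x) hn (hc.rc_const 1) (hc.rc_mul (RC.code
    (Computable.snd.comp Computable.snd)) (h.precomp Computable.fst))).of_eq fun x => ?_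
  induction n x with
  | zero => simp
  | succ k ih => rw [pow_succ, ← ih]

theorem rc_sum {n : Ω → ℕ} (hn : Computable n) {φ : Ω → ℕ → R} (h : RC ν fun p : Ω × ℕ => φ p.1 p.2) :
    RC ν fun x => ∑ i ∈ Finset.range (n x), φ x i := by
  refine (RC.rec (ψ := fun x i r => r + φ x i) hn (hc.rc_const 0) (hc.rc_add (RC.code
    (Computable.snd.comp Computable.snd)) (h.precomp (Computable.fst.pair
      (Computable.fst.comp Computable.snd))))).of_eq fun x => ?_
  induction n x with
  | zero => simp
  | succ k ih => rw [Finset.sum_range_succ, ← ih]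

theorem rc_prod {n : Ω → ℕ} (hn : Computable n) {φ : Ω → ℕ → R} (h : RC ν fun p : Ω × ℕ => φ p.1 p.2) :
    RC ν fun x => ∏ i ∈ Finset.range (n x), φ x i := by
  refine (RC.rec (ψ := fun x i r => r * φ x i) hn (hc.rc_const 1) (hc.rc_mul (RC.code
    (Computable.snd.comp Computable.snd)) (h.precomp (Computable.fst.pair
      (Computable.fst.comp Computable.snd))))).of_eq fun x => ?_
  induction n x with
  | zero => simp
  | succ k ih => rw [Finset.prod_range_succ, ← ih]

theorem rc_natCast {n : Ω → ℕ} (hn : Computable n) : RC ν fun x => (n x : R) :=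
  (hc.rc_sum hn (φ := fun _ _ => 1) (hc.rc_const 1)).of_eq fun x => by simp

theorem rc_getD {φ : Ω → List R} (h : RC (List.map ν) φ) {n : Ω → ℕ} (hn : Computable n) :
    RC ν fun x => (φ x).getD (n x) 0 := h.getD hn (hc.surj 0)

end Coded

/-- The polynomial with the given list of coefficients. -/
noncomputable def polyOf (ν : C → R) (l : List C) : R[X] :=
  ∑ i ∈ Finset.range l.length, monomial i ((l.map ν).getD i 0)

omit [Primcodable C] in
theorem coeff_polyOf (ν : C → R) (l : List C) (i : ℕ) :
    (polyOf ν l).coeff i = (l.map ν).getD i 0 := by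
  simp only [polyOf, finsetSum_coeff, coeff_monomial, Finset.sum_ite_eq', Finset.mem_range]
  split_ifs with h
  · rfl
  · rw [List.getD_eq_default _ _ (by simpa using h)]

omit [Primcodable C] in
theorem coeff_polyOf_eq_zero (ν : C → R) (l : List C) {i : ℕ} (hi : l.length ≤ i) :
    (polyOf ν l).coeff i = 0 := by
  rw [coeff_polyOf, List.getD_eq_default _ _ (by simpa using hi)]

omit [Primcodable C] in
theorem polyOf_surjective (hν : Function.Surjective ν) : Function.Surjective (polyOf ν) := by
  intro f
  choose g hg using hν
  refine ⟨(List.range (f.natDegree + 1)).map fun i => g (f.coeff i), ?_⟩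
  ext i
  rw [coeff_polyOf, List.map_map]
  by_cases hi : i < f.natDegree + 1
  · simp [List.getD, hi, hg]
  · rw [List.getD_eq_default _ _ (by simpa using hi), coeff_eq_zero_of_natDegree_lt (by omega)]

/-- A computable polynomial is given by computable coefficients and a computable degree bound. -/
theorem rc_polyOf {φ : Ω → R[X]} {d : Ω → ℕ} (hd : Computable d) (hφ : ∀ x i, d x ≤ i → (φ x).coeff i = 0)
    (h : RC ν fun p : Ω × ℕ => (φ p.1).coeff p.2) : RC (polyOf ν) φ := by
  obtain ⟨F, hF, H⟩ := h
  refine ⟨_, computable_tabulate hd (F := fun x i => F (x, i)) hF, fun x => ?_⟩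
  ext i
  rw [coeff_polyOf, List.map_map]
  by_cases hi : i < d x
  · simp [List.getD, hi, H]
  · rw [List.getD_eq_default _ _ (by simpa using hi), hφ _ _ (by omega)]

/-- A code may end in zeros, so its length only bounds the degree. Finding an exact degree needs the
zero test, as in `exists_max_degree`. -/
theorem RC.exists_bound {φ : Ω → R[X]} (h : RC (polyOf ν) φ) :
    ∃ d : Ω → ℕ, Computable d ∧ ∀ x i, d x ≤ i → (φ x).coeff i = 0 := by
  obtain ⟨F, hF, H⟩ := h
  exact ⟨_, Computable.list_length.comp hF, fun x i hi => by rw [← H, coeff_polyOf_eq_zero _ _ hi]⟩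

namespace Coded

variable (hc : Coded σ ν)
include hc

theorem rc_coeff {φ : Ω → R[X]} (h : RC (polyOf ν) φ) {n : Ω → ℕ} (hn : Computable n) :
    RC ν fun x => (φ x).coeff (n x) := by
  obtain ⟨F, hF, H⟩ := h
  refine (hc.rc_getD (φ := fun x => (F x).map ν) ⟨F, hF, fun _ => rfl⟩ hn).of_eq fun x => ?_
  rw [← H, coeff_polyOf]

theorem rc_poly_add {φ ψ : Ω → R[X]} (h : RC (polyOf ν) φ) (h' : RC (polyOf ν) ψ) :
    RC (polyOf ν) fun x => φ x + ψ x := by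
  obtain ⟨d, hd, H⟩ := h.exists_bound
  obtain ⟨e, he, H'⟩ := h'.exists_bound
  refine rc_polyOf (computable_add hd he) (fun x i hi => ?_) ?_
  · rw [coeff_add, H _ _ (by omega), H' _ _ (by omega), add_zero]
  · simp only [coeff_add]
    exact hc.rc_add (hc.rc_coeff (h.precomp Computable.fst) Computable.snd)
      (hc.rc_coeff (h'.precomp Computable.fst) Computable.snd)

theorem rc_poly_neg {φ : Ω → R[X]} (h : RC (polyOf ν) φ) : RC (polyOf ν) fun x => -φ x := by
  obtain ⟨d, hd, H⟩ := h.exists_bound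
  refine rc_polyOf hd (fun x i hi => ?_) ?_
  · rw [coeff_neg, H _ _ hi, neg_zero]
  · simp only [coeff_neg]
    exact hc.rc_neg (hc.rc_coeff (h.precomp Computable.fst) Computable.snd)

theorem rc_poly_mul {φ ψ : Ω → R[X]} (h : RC (polyOf ν) φ) (h' : RC (polyOf ν) ψ) :
    RC (polyOf ν) fun x => φ x * ψ x := by
  obtain ⟨d, hd, H⟩ := h.exists_bound
  obtain ⟨e, he, H'⟩ := h'.exists_bound
  refine rc_polyOf (computable_add hd he) (fun x i hi => ?_) ?_
  · rw [coeff_mul]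
    refine Finset.sum_eq_zero fun p hp => ?_
    rw [Finset.HasAntidiagonal.mem_antidiagonal] at hp
    by_cases hp' : d x ≤ p.1
    · rw [H _ _ hp', zero_mul]
    · rw [H' _ _ (by omega), mul_zero]
  · simp only [coeff_mul, Finset.Nat.sum_antidiagonal_eq_sum_range_succ_mk]
    refine hc.rc_sum (Computable.succ.comp Computable.snd) (hc.rc_mul ?_ ?_)
    · exact hc.rc_coeff (h.precomp (Computable.fst.comp Computable.fst)) Computable.snd
    · exact hc.rc_coeff (h'.precomp (Computable.fst.comp Computable.fst))
        (computable_sub (Computable.snd.comp Computable.fst) Computable.snd)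

theorem rc_monomial {n : Ω → ℕ} (hn : Computable n) {φ : Ω → R} (h : RC ν φ) :
    RC (polyOf ν) fun x => monomial (n x) (φ x) := by
  refine rc_polyOf (Computable.succ.comp hn) (fun x i hi => ?_) ?_
  · rw [coeff_monomial, if_neg (by simp at hi; omega)]
  · simp only [coeff_monomial]
    exact RC.ite (computablePred_nat_eq (hn.comp Computable.fst) Computable.snd)
      (h.precomp Computable.fst) (hc.rc_const 0)

theorem rc_C {φ : Ω → R} (h : RC ν φ) : RC (polyOf ν) fun x => Polynomial.C (φ x) :=
  (hc.rc_monomial (Computable.const 0) h).of_eq fun x => by simp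

theorem poly_eq_zero : ComputablePred fun l : List C => polyOf ν l = 0 := by
  refine (ComputablePred.forall_lt' Computable.list_length (p := fun l i => (polyOf ν l).coeff i = 0)
    (hc.eq_zero' (hc.rc_coeff (RC.code Computable.fst) Computable.snd))).of_eq fun l => ?_
  constructor
  · intro h
    ext i
    by_cases hi : i < l.length
    · exact h i hi
    · exact coeff_polyOf_eq_zero _ _ (by omega)
  · rintro h i -
    rw [h, coeff_zero]

end Coded

/-- The automorphism of `R[X]` that extends `σ` and maps `X` to `X + β`. -/
noncomputable def polyAut (σ : R ≃+* R) (β : R) : R[X] ≃+* R[X] :=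
  (mapEquiv σ).trans (algEquivAevalXAddC β).toRingEquiv

theorem polyAut_C (σ : R ≃+* R) (β r : R) : polyAut σ β (Polynomial.C r) = Polynomial.C (σ r) := by
  simp [polyAut, algebraMap_eq]

theorem polyAut_X (σ : R ≃+* R) (β : R) : polyAut σ β X = X + Polynomial.C β := by
  simp [polyAut]

theorem polyAut_monomial (σ : R ≃+* R) (β r : R) (n : ℕ) :
    polyAut σ β (monomial n r) = Polynomial.C (σ r) * (X + Polynomial.C β) ^ n := by
  rw [← C_mul_X_pow_eq_monomial, map_mul, map_pow, polyAut_C, polyAut_X]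

/-- The ring operations do not involve the automorphism, so they are first recorded for the
identity. That already provides computable sums and powers in R[X], with which the image Σ σ(c_i)(X
+ β)^i can be evaluated. -/
theorem Coded.polynomial (hc : Coded σ ν) (β : R) : Coded (polyAut σ β) (polyOf ν) := by
  have h1 : Coded (RingEquiv.refl R[X]) (polyOf ν) :=
    { surj := polyOf_surjective hc.surj
      add := hc.rc_poly_add (RC.code Computable.fst) (RC.code Computable.snd)
      mul := hc.rc_poly_mul (RC.code Computable.fst) (RC.code Computable.snd)
      neg := hc.rc_poly_neg (RC.code Computable.id)
      aut := RC.code Computable.id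
      eq_zero := hc.poly_eq_zero }
  refine { h1 with aut := ?_ }
  have : ∀ l : List C, polyAut σ β (polyOf ν l) = ∑ i ∈ Finset.range l.length,
      Polynomial.C (σ ((polyOf ν l).coeff i)) * (X + Polynomial.C β) ^ i := by
    intro l
    conv_lhs => rw [polyOf]
    rw [map_sum]
    exact Finset.sum_congr rfl fun i _ => by rw [polyAut_monomial, coeff_polyOf]
  refine RC.of_eq ?_ fun l => (this l).symm
  refine h1.rc_sum Computable.list_length (h1.rc_mul (hc.rc_C (hc.rc_aut (hc.rc_coeff
    (RC.code Computable.fst) Computable.snd))) (h1.rc_pow Computable.snd (h1.rc_const _)))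

end CodedRing

/-! ### Bases of solution spaces as lists -/

section SolutionBases

variable {R : Type*} [CommRing R] {N : Type*} [AddCommGroup N] [Module R N]

/-- A sequence of constants. -/
def IsConst (σ : R ≃+* R) (z : ℕ → R) : Prop := ∀ k, σ (z k) = z k

/-- The coordinates of the linear combination of the first components of `L`. -/
def combC (L : List (List R × N)) (z : ℕ → R) (j : ℕ) : R :=
  ∑ k ∈ Finset.range L.length, z k * (L.getD k ([], 0)).1.getD j 0

/-- The linear combination of the second components of `L`. -/
def combG (L : List (List R × N)) (z : ℕ → R) : N :=
  ∑ k ∈ Finset.range L.length, z k • (L.getD k ([], 0)).2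

/-- The list `L` is a basis, over the constants, of the space of all `(c, g)` with `P c g`, where
`c` is a sequence of `d` constants. -/
structure IsBas (σ : R ≃+* R) (d : ℕ) (P : (ℕ → R) → N → Prop) (L : List (List R × N)) : Prop where
  length_eq : ∀ r ∈ L, r.1.length = d
  const : ∀ r ∈ L, ∀ x ∈ r.1, σ x = x
  mem : ∀ r ∈ L, P (fun j => r.1.getD j 0) r.2
  span : ∀ c, IsConst σ c → ∀ g, P c g → ∃ z, IsConst σ z ∧ (∀ j < d, c j = combC L z j) ∧ g = combG L z
  indep : ∀ z, IsConst σ z → (∀ j < d, combC L z j = 0) → combG L z = 0 → ∀ k < L.length, z k = 0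

/-- The parameterized linear difference equation. -/
def PLDE (σ : R ≃+* R) (a f : List R) (c : ℕ → R) (g : R) : Prop :=
  ∑ i ∈ Finset.range a.length, a.getD i 0 * (⇑σ)^[i] g = ∑ j ∈ Finset.range f.length, c j * f.getD j 0

theorem getD_mem_or {α : Type*} (l : List α) (i : ℕ) (d : α) : l.getD i d ∈ l ∨ l.getD i d = d := by
  by_cases hi : i < l.length
  · left; rw [List.getD_eq_getElem _ _ hi]; exact List.getElem_mem hi
  · right; exact List.getD_eq_default _ _ (by omega)

theorem IsBas.isConst_getD {σ : R ≃+* R} {d : ℕ} {P : (ℕ → R) → N → Prop} {L : List (List R × N)}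
    (h : IsBas σ d P L) (k : ℕ) : IsConst σ fun j => (L.getD k ([], 0)).1.getD j 0 := by
  intro j
  rcases getD_mem_or L k ([], 0) with hk | hk
  · rcases getD_mem_or (L.getD k ([], 0)).1 j 0 with hj | hj
    · exact h.const _ hk _ hj
    · simp only [hj, map_zero]
  · simp only [hk, List.getD_nil, map_zero]

omit [Module R N] in
theorem isConst_combC {σ : R ≃+* R} {L : List (List R × N)} {z : ℕ → R} (hz : IsConst σ z)
    (hL : ∀ k, IsConst σ fun j => (L.getD k ([], 0)).1.getD j 0) : IsConst σ (combC L z) := by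
  intro j
  simp only [combC, map_sum, map_mul]
  exact Finset.sum_congr rfl fun k _ => by rw [hz k, hL k j]

theorem IsBas.congr {σ : R ≃+* R} {d : ℕ} {P Q : (ℕ → R) → N → Prop} {L : List (List R × N)}
    (h : IsBas σ d P L) (hPQ : ∀ c g, IsConst σ c → (P c g ↔ Q c g)) : IsBas σ d Q L where
  length_eq := h.length_eq
  const := h.const
  mem r hr := (hPQ _ _ fun j => by
    rcases getD_mem_or r.1 j 0 with hj | hj
    · exact h.const _ hr _ hj
    · simp only [hj, map_zero]).1 (h.mem r hr)
  span c hc g hg := h.span c hc g ((hPQ c g hc).2 hg)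
  indep := h.indep

variable {C : Type*} {ν : C → R} {σ : R ≃+* R}

theorem getD_map_eq_get {α β : Type*} (l : List α) (f : α → β) (d : β) (i : Fin l.length) :
    (l.map f).getD i d = f (l.get i) := by
  simp [List.getD]

theorem getD_ofFn {β : Type*} {n : ℕ} (f : Fin n → β) (d : β) (i : Fin n) :
    (List.ofFn f).getD i d = f i := by
  simp [List.getD]

theorem mem_solutionSpace_iff (a f : List C) (p : (Fin f.length → constants σ) × R) :
    p ∈ solutionSpace σ (fun i : Fin a.length => ν (a.get i)) (fun j : Fin f.length => ν (f.get j)) ↔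
      PLDE σ (a.map ν) (f.map ν) (fun j => if h : j < f.length then (p.1 ⟨j, h⟩ : R) else 0) p.2 := by
  unfold PLDE
  rw [List.length_map, List.length_map, Finset.sum_range, Finset.sum_range]
  simp only [getD_map_eq_get, Fin.is_lt, dite_true]
  exact Iff.rfl

theorem PLDE.congr_left {a f : List R} {c c' : ℕ → R} {g : R} (h : ∀ j < f.length, c j = c' j) :
    PLDE σ a f c g ↔ PLDE σ a f c' g := by
  unfold PLDE
  have : ∑ j ∈ Finset.range f.length, c j * f.getD j 0 = ∑ j ∈ Finset.range f.length, c' j * f.getD j 0 :=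
    Finset.sum_congr rfl fun j hj => by rw [h j (Finset.mem_range.1 hj)]
  rw [this]

/-- Extension of a finite family of constants by zero. -/
def extendConst {n : ℕ} (z : Fin n → constants σ) (j : ℕ) : R := if h : j < n then (z ⟨j, h⟩ : R) else 0

theorem isConst_extendConst {n : ℕ} (z : Fin n → constants σ) : IsConst σ (extendConst z) := by
  intro j
  unfold extendConst
  split_ifs with h
  · exact (z _).2
  · exact map_zero _

theorem extendConst_val {n : ℕ} (z : Fin n → constants σ) (j : Fin n) : extendConst z j = z j := by
  simp [extendConst]

theorem combC_map_eq (ν : C → R) (L : List (List C × C)) (z : ℕ → R) (j : ℕ) :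
    combC (L.map (Prod.map (List.map ν) ν)) z j =
      ∑ k : Fin L.length, z k * ((L.get k).1.map ν).getD j 0 := by
  rw [combC, Finset.sum_range, List.length_map]
  exact Finset.sum_congr rfl fun k _ => by rw [getD_map_eq_get]; rfl

theorem combG_map_eq (ν : C → R) (L : List (List C × C)) (z : ℕ → R) :
    combG (L.map (Prod.map (List.map ν) ν)) z = ∑ k : Fin L.length, z k * ν (L.get k).2 := by
  rw [combG, Finset.sum_range, List.length_map]
  exact Finset.sum_congr rfl fun k _ => by rw [getD_map_eq_get]; rfl

/-- This replaces families indexed by `Fin` with values in the subring of constants by sequences in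
R indexed by ℕ, of which only finitely many entries matter. The later algorithms change the lengths
of lists all the time and would otherwise need transports. -/
theorem IsSolutionBasis.isBas {a f : List C} {L : List (List C × C)}
    (h : IsSolutionBasis σ ν (fun i : Fin a.length => ν (a.get i)) (fun j : Fin f.length => ν (f.get j)) L) :
    IsBas σ f.length (PLDE σ (a.map ν) (f.map ν)) (L.map (Prod.map (List.map ν) ν)) := by
  obtain ⟨b, hb⟩ := h
  have hL : ∀ r ∈ L.map (Prod.map (List.map ν) ν), ∃ k : Fin L.length,
      r = (List.ofFn fun j => (((b k : (Fin f.length → constants σ) × R).1 j : R)),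
        (b k : (Fin f.length → constants σ) × R).2) := by
    intro r hr
    obtain ⟨x, hx, rfl⟩ := List.mem_map.1 hr
    obtain ⟨k, rfl⟩ := List.mem_iff_get.1 hx
    exact ⟨k, Prod.ext (hb k).1 (hb k).2⟩
  have hC : ∀ (z : Fin L.length → constants σ) (j : Fin f.length),
      combC (L.map (Prod.map (List.map ν) ν)) (extendConst z) j =
        (((∑ k, z k • b k : solutionSpace σ _ _) : (Fin f.length → constants σ) × R).1 j : R) := by
    intro z j
    rw [combC_map_eq]
    simp only [extendConst_val, (hb _).1, getD_ofFn]
    simp [Prod.fst_sum]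
  have hG : ∀ (z : Fin L.length → constants σ),
      combG (L.map (Prod.map (List.map ν) ν)) (extendConst z) =
        ((∑ k, z k • b k : solutionSpace σ _ _) : (Fin f.length → constants σ) × R).2 := by
    intro z
    rw [combG_map_eq]
    simp only [extendConst_val, (hb _).2]
    simp [Prod.snd_sum, Subring.smul_def]
  refine ⟨?_, ?_, ?_, ?_, ?_⟩
  · intro r hr
    obtain ⟨k, rfl⟩ := hL r hr
    simp
  · intro r hr x hx
    obtain ⟨k, rfl⟩ := hL r hr
    simp only [List.mem_ofFn] at hx
    obtain ⟨j, rfl⟩ := hx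
    exact ((b k : (Fin f.length → constants σ) × R).1 j).2
  · intro r hr
    obtain ⟨k, rfl⟩ := hL r hr
    refine (PLDE.congr_left fun j hj => ?_).1 ((mem_solutionSpace_iff a f _).1 (b k).2)
    rw [List.length_map] at hj
    rw [dif_pos hj]
    exact (getD_ofFn (fun j => (((b k : (Fin f.length → constants σ) × R).1 j : R))) 0 ⟨j, hj⟩).symm
  · intro c hc g hg
    let v : solutionSpace σ (fun i : Fin a.length => ν (a.get i)) (fun j : Fin f.length => ν (f.get j)) :=
      ⟨(fun j => ⟨c j, hc j⟩, g), (mem_solutionSpace_iff a f _).2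
        ((PLDE.congr_left fun j hj => by rw [List.length_map] at hj; simp [hj]).1 hg)⟩
    refine ⟨extendConst fun k => b.repr v k, isConst_extendConst _, fun j hj => ?_, ?_⟩
    · refine Eq.trans ?_ (hC _ ⟨j, hj⟩).symm
      rw [b.sum_repr]
    · rw [hG, b.sum_repr]
  · intro z hz h1 h2 k hk
    rw [List.length_map] at hk
    let z' : Fin L.length → constants σ := fun k => ⟨z k, hz k⟩
    have hzz : ∀ k : Fin L.length, z k = extendConst z' k := fun k => by rw [extendConst_val]
    have h0 : ∑ k, z' k • b k = 0 := by
      apply Subtype.ext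
      apply Prod.ext
      · funext j
        apply Subtype.ext
        rw [← hC, combC_map_eq]
        have := h1 j j.2
        rw [combC_map_eq] at this
        simp only [hzz] at this
        exact this
      · rw [← hG, combG_map_eq]
        rw [combG_map_eq] at h2
        simp only [hzz] at h2
        exact h2
    have := Fintype.linearIndependent_iff.1 b.linearIndependent z' h0 ⟨k, hk⟩
    simpa [z'] using congrArg Subtype.val this

theorem IsBas.isSolutionBasis {a f : List C} {L : List (List C × C)}
    (h : IsBas σ f.length (PLDE σ (a.map ν) (f.map ν)) (L.map (Prod.map (List.map ν) ν))) :
    IsSolutionBasis σ ν (fun i : Fin a.length => ν (a.get i)) (fun j : Fin f.length => ν (f.get j)) L := by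
  have hmem : ∀ k : Fin L.length, ((L.get k).1.map ν, ν (L.get k).2) ∈ L.map (Prod.map (List.map ν) ν) :=
    fun k => List.mem_map.2 ⟨_, List.get_mem L k, rfl⟩
  have hlen : ∀ k : Fin L.length, ((L.get k).1.map ν).length = f.length := fun k => h.length_eq _ (hmem k)
  have hconst : ∀ (k : Fin L.length) (j : ℕ), σ (((L.get k).1.map ν).getD j 0) = ((L.get k).1.map ν).getD j 0 := by
    intro k j
    rcases getD_mem_or ((L.get k).1.map ν) j 0 with hj | hj
    · exact h.const _ (hmem k) _ hj
    · rw [hj, map_zero]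
  let v : Fin L.length → solutionSpace σ (fun i : Fin a.length => ν (a.get i))
      (fun j : Fin f.length => ν (f.get j)) := fun k =>
    ⟨(fun j => ⟨((L.get k).1.map ν).getD j 0, hconst k j⟩, ν (L.get k).2),
      (mem_solutionSpace_iff a f _).2 ((PLDE.congr_left fun j hj => by
        rw [List.length_map] at hj; simp only [hj, dite_true]).1 (h.mem _ (hmem k)))⟩
  have hC : ∀ (z : Fin L.length → constants σ) (j : Fin f.length),
      combC (L.map (Prod.map (List.map ν) ν)) (extendConst z) j =
        (((∑ k, z k • v k : solutionSpace σ _ _) : (Fin f.length → constants σ) × R).1 j : R) := by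
    intro z j
    rw [combC_map_eq]
    simp only [extendConst_val]
    simp [Prod.fst_sum, v]
  have hG : ∀ (z : Fin L.length → constants σ),
      combG (L.map (Prod.map (List.map ν) ν)) (extendConst z) =
        ((∑ k, z k • v k : solutionSpace σ _ _) : (Fin f.length → constants σ) × R).2 := by
    intro z
    rw [combG_map_eq]
    simp only [extendConst_val]
    simp [Prod.snd_sum, Subring.smul_def, v]
  have hli : LinearIndependent (constants σ) v := by
    rw [Fintype.linearIndependent_iff]
    intro z hz k
    have := h.indep (extendConst z) (isConst_extendConst z)
      (fun j hj => by have := hC z ⟨j, hj⟩; rw [hz] at this; exact this) (by rw [hG, hz]; rfl) k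
      (by rw [List.length_map]; exact k.2)
    rw [extendConst_val] at this
    exact Subtype.ext this
  have hsp : ⊤ ≤ Submodule.span (constants σ) (Set.range v) := by
    rintro ⟨⟨c, g⟩, hw⟩ -
    have hw' := (mem_solutionSpace_iff a f _).1 hw
    obtain ⟨z, hz, h1, h2⟩ := h.span _ (isConst_extendConst c) g hw'
    have : (⟨(c, g), hw⟩ : solutionSpace σ (fun i : Fin a.length => ν (a.get i))
        (fun j : Fin f.length => ν (f.get j))) = ∑ k : Fin L.length, (⟨z k, hz k⟩ : constants σ) • v k := by
      apply Subtype.ext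
      apply Prod.ext
      · funext j
        apply Subtype.ext
        rw [← hC, combC_map_eq]
        have := h1 j j.2
        rw [combC_map_eq, extendConst_val] at this
        simpa only [extendConst_val] using this
      · rw [← hG, combG_map_eq]
        rw [combG_map_eq] at h2
        simpa only [extendConst_val] using h2
    rw [this]
    exact Submodule.sum_mem _ fun k _ => Submodule.smul_mem _ _ (Submodule.subset_span ⟨k, rfl⟩)
  refine ⟨Module.Basis.mk hli hsp, fun k => ?_⟩
  rw [Module.Basis.mk_apply]
  refine ⟨?_, rfl⟩
  apply List.ext_get
  · rw [hlen, List.length_ofFn]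
  · intro j h1 h2
    simp only [List.get_ofFn, v]
    rw [List.get_eq_getElem, ← List.getD_eq_getElem _ 0 h1]
    rfl

/-- Reformulation of `PLDESolvable`. -/
def Solver [Primcodable C] (σ : R ≃+* R) (ν : C → R) : Prop :=
  ∃ S : List C × List C → List (List C × C), Computable S ∧
    ∀ a f : List C, (∃ x ∈ a, ν x ≠ 0) →
      IsBas σ f.length (PLDE σ (a.map ν) (f.map ν)) ((S (a, f)).map (Prod.map (List.map ν) ν))

theorem pldeSolvable_iff_solver [Primcodable C] : PLDESolvable σ ν ↔ Solver σ ν := by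
  constructor
  · rintro ⟨S, hS, H⟩
    exact ⟨S, hS, fun a f ha => (H a f ha).isBas⟩
  · rintro ⟨S, hS, H⟩
    exact ⟨S, hS, fun a f ha => (H a f ha).isSolutionBasis⟩

/-- Codes for lists of pairs `((c₁, …, c_d), g)`. -/
abbrev basOf {C' N : Type*} (ν : C → R) (μ : C' → N) : List (List C × C') → List (List R × N) :=
  List.map (Prod.map (List.map ν) μ)

/-- The solver is run on a computable family of equations, and codes disappear from the conclusion.
Nothing is claimed for those parameters at which all coefficients vanish; callers only use the
output elsewhere. -/
theorem Solver.apply [Primcodable C] {Ω : Type*} [Primcodable Ω] (h : Solver σ ν) {a f : Ω → List R}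
    (ha : RC (List.map ν) a) (hf : RC (List.map ν) f) :
    ∃ L : Ω → List (List R × R), RC (basOf ν ν) L ∧
      ∀ x, (∃ y ∈ a x, y ≠ 0) → IsBas σ (f x).length (PLDE σ (a x) (f x)) (L x) := by
  obtain ⟨S, hS, H⟩ := h
  obtain ⟨F, hF, HF⟩ := ha
  obtain ⟨G, hG, HG⟩ := hf
  refine ⟨_, ⟨_, hS.comp (hF.pair hG), fun x => rfl⟩, ?_⟩
  rintro x ⟨y, hy, hy0⟩
  rw [← HF] at hy
  obtain ⟨w, hw, rfl⟩ := List.mem_map.1 hy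
  have := H (F x) (G x) ⟨w, hw, hy0⟩
  rw [HF, HG] at this
  have hl : (f x).length = (G x).length := by rw [← HG, List.length_map]
  rw [hl]
  exact this

end SolutionBases

/-! ### Linear combinations of list entries with constant coefficients -/

section Combinations

variable {R : Type*} [CommRing R] {N : Type*} [AddCommGroup N] [Module R N] {σ : R ≃+* R}

theorem getD_tabulate {α : Type*} (s : ℕ) (φ : ℕ → α) (j : ℕ) (d : α) :
    ((List.range s).map φ).getD j d = if j < s then φ j else d := by
  by_cases h : j < s <;> simp [List.getD, h]

theorem sum_range_getD_map {α β M : Type*} [AddCommMonoid M] (L : List α) (F : α → β) (d : α) (d' : β)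
    (G : ℕ → β → M) :
    ∑ k ∈ Finset.range (L.map F).length, G k ((L.map F).getD k d') =
      ∑ k ∈ Finset.range L.length, G k (F (L.getD k d)) := by
  rw [List.length_map]
  refine Finset.sum_congr rfl fun k hk => ?_
  rw [Finset.mem_range] at hk
  rw [List.getD_eq_getElem _ _ (by simpa using hk), List.getD_eq_getElem _ _ hk, List.getElem_map]

omit [Module R N] in
theorem combC_map {R' N' : Type*} [CommRing R'] [AddCommGroup N'] (L : List (List R × N))
    (F : List R × N → List R' × N') (z : ℕ → R') (j : ℕ) : combC (L.map F) z j =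
      ∑ k ∈ Finset.range L.length, z k * (F (L.getD k ([], 0))).1.getD j 0 :=
  sum_range_getD_map L F _ _ fun k r => z k * r.1.getD j 0

omit [Module R N] in
theorem combG_map {R' N' : Type*} [CommRing R'] [AddCommGroup N'] [Module R' N'] (L : List (List R × N))
    (F : List R × N → List R' × N') (z : ℕ → R') : combG (L.map F) z =
      ∑ k ∈ Finset.range L.length, z k • (F (L.getD k ([], 0))).2 :=
  sum_range_getD_map L F _ _ fun k r => z k • r.2

omit [Module R N] in
theorem combC_cons (r : List R × N) (L : List (List R × N)) (z : ℕ → R) (j : ℕ) :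
    combC (r :: L) z j = z 0 * r.1.getD j 0 + combC L (fun k => z (k + 1)) j := by
  simp [combC, Finset.sum_range_succ', add_comm]

theorem combG_cons (r : List R × N) (L : List (List R × N)) (z : ℕ → R) :
    combG (r :: L) z = z 0 • r.2 + combG L (fun k => z (k + 1)) := by
  simp [combG, Finset.sum_range_succ', add_comm]

/-- The sequence `c, z 0, z 1, …`. -/
def consSeq (c : R) (z : ℕ → R) : ℕ → R
  | 0 => c
  | k + 1 => z k

omit [CommRing R] in
@[simp] theorem consSeq_zero (c : R) (z : ℕ → R) : consSeq c z 0 = c := rfl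

omit [CommRing R] in
@[simp] theorem consSeq_succ (c : R) (z : ℕ → R) (k : ℕ) : consSeq c z (k + 1) = z k := rfl

theorem IsConst.cons {z : ℕ → R} (hz : IsConst σ z) {c : R} (hc : σ c = c) :
    IsConst σ (consSeq c z) := by
  rintro (_ | k)
  · exact hc
  · exact hz k

theorem PLDE.comb {a f : List R} {L : List (List R × R)} {z : ℕ → R} (hz : IsConst σ z)
    (hL : ∀ k < L.length, PLDE σ a f (fun j => (L.getD k ([], 0)).1.getD j 0) (L.getD k ([], 0)).2) :
    PLDE σ a f (combC L z) (combG L z) := by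
  unfold PLDE at *
  have hs : ∀ i, (⇑σ)^[i] (combG L z) =
      ∑ k ∈ Finset.range L.length, z k * (⇑σ)^[i] (L.getD k ([], 0)).2 := by
    intro i
    induction i with
    | zero => rfl
    | succ i ih => simp only [Function.iterate_succ_apply', ih, map_sum, map_mul, hz _]
  simp only [hs, combC, Finset.mul_sum, Finset.sum_mul]
  rw [Finset.sum_comm, Finset.sum_comm (s := Finset.range f.length)]
  refine Finset.sum_congr rfl fun k hk => ?_
  have := congrArg (z k * ·) (hL k (Finset.mem_range.1 hk))
  simp only [Finset.mul_sum] at this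
  simpa only [mul_left_comm, mul_assoc] using this

theorem IsBas.mem_getD {d : ℕ} {P : (ℕ → R) → N → Prop} {L : List (List R × N)} (h : IsBas σ d P L)
    {k : ℕ} (hk : k < L.length) :
    P (fun j => (L.getD k ([], 0)).1.getD j 0) (L.getD k ([], 0)).2 := by
  rw [List.getD_eq_getElem _ _ hk]
  exact h.mem _ (List.getElem_mem hk)

-- A rank argument: the coordinate vectors are linearly independent in a free module of rank t over
-- the nontrivial commutative ring of constants. It bounds the number of rows during elimination.
omit [Module R N] in
theorem length_le_of_indep [Nontrivial R] {L : List (List R × N)} {t : ℕ}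
    (hL : ∀ k, IsConst σ fun j => (L.getD k ([], 0)).1.getD j 0)
    (h : ∀ z, IsConst σ z → (∀ j < t, combC L z j = 0) → ∀ k < L.length, z k = 0) : L.length ≤ t := by
  let v : Fin L.length → Fin t → constants σ := fun k j => ⟨(L.getD k ([], 0)).1.getD j 0, hL k j⟩
  have hv : LinearIndependent (constants σ) v := by
    rw [Fintype.linearIndependent_iff]
    intro z hz k
    have := h (extendConst z) (isConst_extendConst z) (fun j hj => by
      have := congrArg Subtype.val (congrFun hz ⟨j, hj⟩)
      rw [combC, Finset.sum_range]
      simpa [extendConst_val, v] using this) k k.2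
    rw [extendConst_val] at this
    exact Subtype.ext this
  simpa using hv.fintype_card_le_finrank

end Combinations

/-! ### Linear relations over the constants, found with the PLDE solver -/

section Kernel

variable {R : Type*} [CommRing R] [IsDomain R] {C : Type*} [Primcodable C] {σ : R ≃+* R} {ν : C → R}

/-- Linear relations of `ρ` (the second component is a dummy). -/
def Rel (ρ : List R) (c : ℕ → R) (g : R) : Prop :=
  ∑ j ∈ Finset.range ρ.length, c j * ρ.getD j 0 = 0 ∧ g = 0

/-- The relations of `ρ` are parametrized by the constants `z` and the relations `w` of the second
components of the second list. -/
structure KerInv (σ : R ≃+* R) (ρ : List R) (k : ℕ) (S : List (List R × R) × List (List R × R)) :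
    Prop where
  length_le : S.2.length + k ≤ ρ.length
  length_eq : ∀ r ∈ S.1, r.1.length = ρ.length ∧ r.2 = 0
  length_eq' : ∀ r ∈ S.2, r.1.length = ρ.length
  mem : ∀ z w, IsConst σ z → IsConst σ w → combG S.2 w = 0 →
    (∀ j < ρ.length, σ (combC S.1 z j + combC S.2 w j) = combC S.1 z j + combC S.2 w j) ∧
      ∑ j ∈ Finset.range ρ.length, (combC S.1 z j + combC S.2 w j) * ρ.getD j 0 = 0
  span : ∀ c, IsConst σ c → ∑ j ∈ Finset.range ρ.length, c j * ρ.getD j 0 = 0 →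
    ∃ z w, IsConst σ z ∧ IsConst σ w ∧ combG S.2 w = 0 ∧
      ∀ j < ρ.length, c j = combC S.1 z j + combC S.2 w j
  indep : ∀ z w, IsConst σ z → IsConst σ w → combG S.2 w = 0 →
    (∀ j < ρ.length, combC S.1 z j + combC S.2 w j = 0) →
    (∀ k < S.1.length, z k = 0) ∧ ∀ k < S.2.length, w k = 0

-- A row whose second component is zero imposes no condition on its coefficient, so that coefficient
-- becomes a free constant and the row moves to the finished list.
omit [IsDomain R] in
theorem KerInv.zero_step {ρ : List R} {k : ℕ} {D T : List (List R × R)} {d : List R}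
    (h : KerInv σ ρ k (D, (d, 0) :: T)) :
    KerInv σ ρ (k + 1) ((d, 0) :: D, T) := by
  have hC : ∀ (z w : ℕ → R) j, combC ((d, 0) :: D) z j + combC T w j = combC D (fun k => z (k + 1)) j +
      combC ((d, 0) :: T) (consSeq (z 0) w) j := by
    intro z w j
    rw [combC_cons, combC_cons]
    simp only [consSeq_zero, consSeq_succ]
    ring
  have hG : ∀ (z w : ℕ → R),
      combG ((d, 0) :: T) (consSeq (z 0) w) = combG T w := by
    intro z w
    rw [combG_cons]
    simp
  refine ⟨?_, ?_, ?_, ?_, ?_, ?_⟩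
  · have := h.length_le
    simp only [List.length_cons] at this ⊢
    omega
  · intro r hr
    rcases List.mem_cons.1 hr with rfl | hr
    · exact ⟨h.length_eq' _ List.mem_cons_self, rfl⟩
    · exact h.length_eq r hr
  · intro r hr
    exact h.length_eq' r (List.mem_cons_of_mem _ hr)
  · intro z w hz hw hT
    simp only [hC]
    exact h.mem _ _ (fun k => hz _) (hw.cons (hz 0)) (by rw [hG]; exact hT)
  · intro c hc hcρ
    obtain ⟨z, w, hz, hw, h1, h2⟩ := h.span c hc hcρ
    refine ⟨consSeq (w 0) z, fun k => w (k + 1), hz.cons (hw 0),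
      fun k => hw _, ?_, ?_⟩
    · rw [combG_cons] at h1
      simpa using h1
    · intro j hj
      rw [h2 j hj, combC_cons, combC_cons]
      simp only [consSeq_zero, consSeq_succ]
      ring
  · intro z w hz hw hT h0
    simp only [hC] at h0
    obtain ⟨h1, h2⟩ := h.indep _ _ (fun k => hz _) (hw.cons (hz 0)) (by rw [hG]; exact hT) h0
    constructor
    · rintro (_ | k) hk
      · exact h2 0 (by simp)
      · exact h1 k (by simpa using hk)
    · intro k hk
      exact h2 (k + 1) (by simpa using hk)

/-- The elimination of a nonzero element `e` from the relations. -/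
def elimStep (σ : R ≃+* R) (s : ℕ) (d : List R) (T : List (List R × R)) (r : List R × R) : List R × R :=
  ((List.range s).map fun j => ∑ k ∈ Finset.range T.length, r.1.getD k 0 * (T.getD k ([], 0)).1.getD j 0
    - r.2 * d.getD j 0, σ r.2 - r.2)

/-- With e ≠ 0, the condition w₀e + Σ w_k t_k = 0 says that g = -w₀ solves the order-zero equation
eg = Σ w_k t_k. A basis `V` of its solutions therefore parametrizes the admissible w, except that g
may fail to be constant. That missing condition is again linear and is stored as the new second
components σ(g) - g. The new rows may have nonconstant entries, which is why `KerInv.mem` asserts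
constancy only for combinations whose second component vanishes. -/
theorem KerInv.elim_step {ρ : List R} {k : ℕ} {D T V : List (List R × R)} {d : List R} {e : R}
    (h : KerInv σ ρ k (D, (d, e) :: T)) (he : e ≠ 0)
    (hV : IsBas σ T.length (PLDE σ [e] (T.map Prod.snd)) V) :
    KerInv σ ρ (k + 1) (D, V.map (elimStep σ ρ.length d T)) := by
  have hplde : ∀ c g, PLDE σ [e] (T.map Prod.snd) c g ↔ e * g = combG T c := by
    intro c g
    unfold PLDE
    rw [sum_range_getD_map T Prod.snd ([], 0) 0 fun j r => c j * r]
    simp [combG]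
  have hC : ∀ w j, j < ρ.length → combC (V.map (elimStep σ ρ.length d T)) w j =
      combC ((d, e) :: T) (consSeq (-combG V w) (combC V w)) j := by
    intro w j hj
    rw [combC_map, combC_cons]
    simp only [consSeq_zero, consSeq_succ, elimStep, getD_tabulate, if_pos hj, mul_sub, Finset.sum_sub_distrib]
    simp only [combC, combG, Finset.mul_sum, Finset.sum_mul, smul_eq_mul, neg_mul]
    rw [Finset.sum_comm]
    simp only [mul_assoc]
    ring
  have hG : ∀ w, IsConst σ w → combG (V.map (elimStep σ ρ.length d T)) w = σ (combG V w) - combG V w := by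
    intro w hw
    rw [combG_map]
    simp only [elimStep, smul_eq_mul, mul_sub, Finset.sum_sub_distrib]
    simp only [combG, map_sum, smul_eq_mul, map_mul, hw _]
  have hVc : ∀ w, IsConst σ w → IsConst σ (combC V w) := fun w hw => isConst_combC hw hV.isConst_getD
  have hVG : ∀ w, IsConst σ w →
      combG ((d, e) :: T) (consSeq (-combG V w) (combC V w)) = 0 := by
    intro w hw
    have := (hplde _ _).1 (PLDE.comb hw fun k hk => hV.mem_getD hk)
    rw [combG_cons]
    simp only [smul_eq_mul, consSeq_zero, consSeq_succ]
    rw [← this]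
    ring
  refine ⟨?_, h.length_eq, ?_, ?_, ?_, ?_⟩
  · have h1 := h.length_le
    -- As e is not a zero divisor, g is determined by the coordinates, so these alone are
    -- independent. Each elimination thus shortens the list by at least one, and `ρ.length` rounds
    -- suffice.
    have h2 : V.length ≤ T.length := by
      refine length_le_of_indep (σ := σ) hV.isConst_getD fun z hz h0 => hV.indep z hz h0 ?_
      have h3 := (hplde _ _).1 (PLDE.comb hz fun k hk => hV.mem_getD hk)
      have h4 : combG T (combC V z) = 0 := Finset.sum_eq_zero fun k hk => by
        rw [h0 k (Finset.mem_range.1 hk), zero_smul]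
      rw [h4] at h3
      exact (mul_eq_zero.1 h3).resolve_left he
    simp only [List.length_cons, List.length_map] at h1 ⊢
    omega
  · intro r hr
    obtain ⟨v, -, rfl⟩ := List.mem_map.1 hr
    simp [elimStep]
  · intro z w hz hw hT
    simp only at hT ⊢
    rw [hG w hw, sub_eq_zero] at hT
    have := h.mem z _ hz ((hVc w hw).cons (c := -combG V w) (by rw [map_neg, hT])) (hVG w hw)
    simp only at this
    refine ⟨fun j hj => ?_, ?_⟩
    · rw [hC w j hj]; exact this.1 j hj
    · refine Eq.trans ?_ this.2
      exact Finset.sum_congr rfl fun j hj => by rw [hC w j (Finset.mem_range.1 hj)]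
  · intro c hc hcρ
    obtain ⟨z, w, hz, hw, h1, h2⟩ := h.span c hc hcρ
    simp only at h1 h2
    rw [combG_cons] at h1
    -- The coefficient of the eliminated row enters as the unknown g = -w₀ of the order-zero
    -- equation.
    obtain ⟨y, hy, hy1, hy2⟩ := hV.span (fun k => w (k + 1)) (fun k => hw _) (-w 0) ((hplde _ _).2 (by
      simp only [smul_eq_mul] at h1
      linear_combination -h1))
    refine ⟨z, y, hz, hy, ?_, ?_⟩
    · simp only
      rw [hG y hy, ← hy2, map_neg, hw, sub_self]
    · intro j hj
      rw [h2 j hj]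
      simp only
      rw [hC y j hj, combC_cons, combC_cons, ← hy2, neg_neg]
      congr 2
      refine Finset.sum_congr rfl fun k hk => ?_
      simp only [consSeq_succ]
      rw [hy1 k (Finset.mem_range.1 hk)]
  · intro z w hz hw hT h0
    simp only at hT h0 ⊢
    rw [hG w hw, sub_eq_zero] at hT
    obtain ⟨h1, h2⟩ := h.indep z _ hz ((hVc w hw).cons (c := -combG V w) (by rw [map_neg, hT])) (hVG w hw)
      (fun j hj => by rw [← h0 j hj, hC w j hj])
    refine ⟨h1, ?_⟩
    rw [List.length_map]
    refine hV.indep w hw (fun j hj => h2 (j + 1) (by simpa using hj)) ?_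
    have := h2 0 (by simp)
    simpa using this

omit [IsDomain R] in
theorem KerInv.nil_step {ρ : List R} {k : ℕ} {D : List (List R × R)} (h : KerInv σ ρ k (D, []))
    (hk : k < ρ.length) : KerInv σ ρ (k + 1) (D, []) :=
  { h with length_le := by simpa using hk }

omit [IsDomain R] in
theorem KerInv.init (ρ : List R) : KerInv σ ρ 0 ([], (List.range ρ.length).map fun i =>
    ((List.range ρ.length).map fun j => if i = j then 1 else 0, ρ.getD i 0)) := by
  have hC : ∀ (z w : ℕ → R) j, j < ρ.length → combC (N := R) [] z j + combC ((List.range ρ.length).map fun i =>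
      ((List.range ρ.length).map fun j => if i = j then (1 : R) else 0, ρ.getD i 0)) w j = w j := by
    intro z w j hj
    simp only [combC, List.length_nil, Finset.range_zero, Finset.sum_empty, zero_add, List.length_map,
      List.length_range, getD_tabulate]
    rw [Finset.sum_eq_single j]
    · simp [hj]
    · intro i hi hij
      rw [if_pos (Finset.mem_range.1 hi)]
      simp only [getD_tabulate, if_pos hj, if_neg hij, mul_zero]
    · simp [hj]
  have hG : ∀ (w : ℕ → R), combG ((List.range ρ.length).map fun i =>
      ((List.range ρ.length).map fun j => if i = j then (1 : R) else 0, ρ.getD i 0)) w =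
      ∑ j ∈ Finset.range ρ.length, w j * ρ.getD j 0 := by
    intro w
    simp only [combG, List.length_map, List.length_range, getD_tabulate]
    exact Finset.sum_congr rfl fun i hi => by rw [if_pos (Finset.mem_range.1 hi)]; rfl
  refine ⟨by simp, by simp, ?_, ?_, ?_, ?_⟩
  · intro r hr
    obtain ⟨i, -, rfl⟩ := List.mem_map.1 hr
    simp
  · intro z w hz hw h0
    simp only at h0 ⊢
    refine ⟨fun j hj => by rw [hC z w j hj, hw], ?_⟩
    rw [hG] at h0
    refine Eq.trans ?_ h0
    exact Finset.sum_congr rfl fun j hj => by rw [hC z w j (Finset.mem_range.1 hj)]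
  · intro c hc h0
    refine ⟨c, c, hc, hc, by rw [hG, h0], fun j hj => (hC c c j hj).symm⟩
  · intro z w hz hw h0 h1
    refine ⟨by simp, fun k hk => ?_⟩
    have hk' : k < ρ.length := by simpa using hk
    rw [← hC z w k hk']
    exact h1 k hk'

-- The length bound leaves no pending rows, so the finished rows are unconditionally a basis. That
-- their entries are constants is read off by specializing to unit coefficient vectors.
omit [IsDomain R] in
theorem KerInv.isBas {ρ : List R} {D T : List (List R × R)} (h : KerInv σ ρ ρ.length (D, T)) :
    IsBas σ ρ.length (Rel ρ) D := by
  obtain rfl : T = [] := by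
    have := h.length_le
    exact List.eq_nil_of_length_eq_zero (by simp only at this; omega)
  have hT : ∀ (w : ℕ → R) j, combC (N := R) [] w j = 0 := fun w j => by simp [combC]
  have hT' : ∀ w, combG (R := R) (N := R) [] w = 0 := fun w => by simp [combG]
  have hD : ∀ z, combG D z = 0 := fun z => Finset.sum_eq_zero fun k hk => by
    rw [Finset.mem_range] at hk
    rw [List.getD_eq_getElem _ _ hk, (h.length_eq _ (List.getElem_mem hk)).2, smul_zero]
  have hunit : ∀ k < D.length, ∀ j, combC D (fun i => if i = k then 1 else 0) j =
      (D.getD k ([], 0)).1.getD j 0 := by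
    intro k hk j
    simp [combC, hk]
  have hu : ∀ k, IsConst σ fun i => if i = k then 1 else 0 := by
    intro k i
    simp only
    split_ifs <;> simp
  have hmem : ∀ r ∈ D, (∀ j < ρ.length, σ (r.1.getD j 0) = r.1.getD j 0) ∧
      ∑ j ∈ Finset.range ρ.length, r.1.getD j 0 * ρ.getD j 0 = 0 := by
    intro r hr
    obtain ⟨k, rfl⟩ := List.mem_iff_get.1 hr
    have := h.mem _ _ (hu k) (hu k) (hT' _)
    simp only [hT, hunit k k.2, add_zero] at this
    rwa [List.getD_eq_getElem _ _ k.2] at this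
  refine ⟨fun r hr => (h.length_eq r hr).1, ?_, ?_, ?_, ?_⟩
  · intro r hr x hx
    obtain ⟨j, rfl⟩ := List.mem_iff_get.1 hx
    have := (hmem r hr).1 j ((h.length_eq r hr).1 ▸ j.2)
    rwa [List.getD_eq_getElem _ _ j.2] at this
  · intro r hr
    exact ⟨(hmem r hr).2, (h.length_eq r hr).2⟩
  · rintro c hc g ⟨h1, h2⟩
    obtain ⟨z, w, hz, -, -, h3⟩ := h.span c hc h1
    refine ⟨z, hz, fun j hj => ?_, by rw [hD, h2]⟩
    rw [h3 j hj]
    simp only [hT, add_zero]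
  · intro z hz h1 _
    refine (h.indep z z hz hz (hT' _) fun j hj => ?_).1
    simp only [hT, add_zero]
    exact h1 j hj

theorem RC.tail {Ω : Type*} [Primcodable Ω] {R : Type*} {ν : C → R} {φ : Ω → List R} (h : RC (List.map ν) φ) :
    RC (List.map ν) fun x => (φ x).tail := by
  obtain ⟨F, hF, H⟩ := h
  exact ⟨_, Primrec.list_tail.to_comp.comp hF, fun x => by simp only [← H, List.map_tail]⟩

theorem RC.cons {Ω : Type*} [Primcodable Ω] {R : Type*} {ν : C → R} {φ : Ω → List R} {ψ : Ω → R}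
    (h' : RC ν ψ) (h : RC (List.map ν) φ) : RC (List.map ν) fun x => ψ x :: φ x := by
  obtain ⟨F, hF, H⟩ := h
  obtain ⟨G, hG, H'⟩ := h'
  exact ⟨_, Computable.list_cons.comp hG hF, fun x => by simp only [← H, ← H', List.map_cons]⟩

theorem RC.nil {Ω : Type*} [Primcodable Ω] {R : Type*} {ν : C → R} :
    RC (List.map ν) fun _ : Ω => ([] : List R) := RC.const ⟨[], rfl⟩

/-- A basis of the linear relations over the constants can be computed. -/
theorem exists_relations (hc : Coded σ ν) (hs : Solver σ ν) {Ω : Type*} [Primcodable Ω] {ρ : Ω → List R}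
    (hρ : RC (List.map ν) ρ) :
    ∃ D : Ω → List (List R × R), RC (basOf ν ν) D ∧ ∀ x, IsBas σ (ρ x).length (Rel (ρ x)) (D x) := by
  classical
  have hdef : ∃ c : List C × C, Prod.map (List.map ν) ν c = ([], 0) := by
    obtain ⟨c, hc0⟩ := hc.surj 0
    exact ⟨([], c), by simp [hc0]⟩
  suffices ∃ F : Ω → List (List C × C) × List (List C × C), Computable F ∧
      ∀ x, KerInv σ (ρ x) (ρ x).length (basOf ν ν (F x).1, basOf ν ν (F x).2) by
    obtain ⟨F, hF, hF'⟩ := this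
    exact ⟨_, ⟨_, Computable.fst.comp hF, fun x => rfl⟩, fun x => (hF' x).isBas⟩
  refine exists_computable_rec (Inv := fun x k (y : List (List C × C) × List (List C × C)) => KerInv σ (ρ x) k (basOf ν ν y.1, basOf ν ν y.2))
    hρ.length ?_ ?_
  · have h1 : RC (Prod.map (basOf ν ν) (basOf ν ν)) fun x => (([] : List (List R × R)),
        (List.range (ρ x).length).map fun i =>
          ((List.range (ρ x).length).map fun j => if i = j then (1 : R) else 0, (ρ x).getD i 0)) := by
      refine RC.nil.prod (RC.tabulate hρ.length (RC.prod (RC.tabulate (hρ.precomp Computable.fst).length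
        (RC.ite ?_ (hc.rc_const _) (hc.rc_const _))) (hc.rc_getD (hρ.precomp Computable.fst) Computable.snd)))
      exact computablePred_nat_eq (Computable.snd.comp Computable.fst) Computable.snd
    obtain ⟨F, hF, hF'⟩ := h1
    refine ⟨F, hF, fun x => ?_⟩
    have := KerInv.init (σ := σ) (ρ x)
    have h2 := hF' x
    beta_reduce at h2
    rw [← h2] at this
    exact this
  · let Ω' := Ω × ℕ × (List (List C × C) × List (List C × C))
    let D : Ω' → List (List R × R) := fun p => basOf ν ν p.2.2.1
    let T : Ω' → List (List R × R) := fun p => basOf ν ν p.2.2.2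
    have hD : RC (basOf ν ν) D := RC.code (Computable.fst.comp (Computable.snd.comp Computable.snd))
    have hT : RC (basOf ν ν) T := RC.code (Computable.snd.comp (Computable.snd.comp Computable.snd))
    have hρ' : RC (List.map ν) fun p : Ω' => ρ p.1 := hρ.precomp Computable.fst
    have hr : RC (Prod.map (List.map ν) ν) fun p : Ω' => (T p).getD 0 ([], 0) :=
      hT.getD (Computable.const 0) hdef
    have ht : RC (basOf ν ν) fun p : Ω' => (T p).tail := hT.tail
    -- An equation of order zero whose only coefficient is the second component of the first pending
    -- row. The step function discards this output when that component is zero or no row is pending.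
    obtain ⟨V, hV, hV'⟩ := hs.apply (Ω := Ω') (a := fun p => [((T p).getD 0 ([], 0)).2])
      (f := fun p => (T p).tail.map Prod.snd) (hr.snd.cons RC.nil)
      (ht.list_map (ψ := fun _ r => r.2) (RC.code (ν := Prod.map (List.map ν) ν) Computable.snd).snd)
    have helim : RC (basOf ν ν) fun p : Ω' =>
        (V p).map (elimStep σ (ρ p.1).length ((T p).getD 0 ([], 0)).1 (T p).tail) := by
      refine hV.list_map (ψ := fun p => elimStep σ (ρ p.1).length ((T p).getD 0 ([], 0)).1 (T p).tail) ?_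
      have hq : RC (Prod.map (List.map ν) ν) fun q : Ω' × (List C × C) => Prod.map (List.map ν) ν q.2 :=
        RC.code Computable.snd
      refine RC.prod (RC.tabulate (hρ'.length.comp Computable.fst) (hc.rc_sub ?_ ?_))
        (hc.rc_sub (hc.rc_aut hq.snd) hq.snd)
      · refine hc.rc_sum (ht.length.comp (Computable.fst.comp Computable.fst)) (hc.rc_mul ?_ ?_)
        · exact hc.rc_getD (hq.fst.precomp (Computable.fst.comp Computable.fst)) Computable.snd
        · exact hc.rc_getD (((ht.precomp (Computable.fst.comp
            (Computable.fst.comp Computable.fst))).getD Computable.snd hdef).fst)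
              (Computable.snd.comp Computable.fst)
      · exact hc.rc_mul (hq.snd.precomp Computable.fst)
          (hc.rc_getD (hr.fst.precomp (Computable.fst.comp Computable.fst)) Computable.snd)
    have hG : RC (Prod.map (basOf ν ν) (basOf ν ν)) fun p : Ω' =>
        if (T p).length = 0 then (D p, T p) else
        if ((T p).getD 0 ([], 0)).2 = 0 then ((T p).getD 0 ([], 0) :: D p, (T p).tail) else
        (D p, (V p).map (elimStep σ (ρ p.1).length ((T p).getD 0 ([], 0)).1 (T p).tail)) :=
      RC.ite (computablePred_nat_eq hT.length (Computable.const 0)) (hD.prod hT)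
        (RC.ite (hc.eq_zero' hr.snd) ((hr.cons hD).prod ht) (hD.prod helim))
    obtain ⟨G, hG, hG'⟩ := hG
    refine ⟨G, hG, fun x n y hn hy => ?_⟩
    have hG'' := hG' (x, n, y)
    beta_reduce at hG''
    suffices KerInv σ (ρ x) (n + 1) (Prod.map (basOf ν ν) (basOf ν ν) (G (x, n, y))) from this
    rw [hG'']
    have hVp := hV' (x, n, y)
    change KerInv σ (ρ x) n (D (x, n, y), T (x, n, y)) at hy
    generalize D (x, n, y) = D at hy ⊢
    generalize V (x, n, y) = V at hVp ⊢
    generalize T (x, n, y) = T at hy hVp ⊢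
    rcases T with _ | ⟨⟨d, e⟩, T⟩
    · simpa using hy.nil_step hn
    · by_cases he : e = 0
      · subst he
        simpa using hy.zero_step
      · have := hVp ⟨e, by simp, he⟩
        simp only [List.length_map, List.tail_cons, List.getD_cons_zero] at this
        simpa [he] using hy.elim_step he this

end Kernel

/-! ### Transport of a basis along a parametrization -/

section Composition

variable {R : Type*} [CommRing R] {N : Type*} [AddCommGroup N] [Module R N] {σ : R ≃+* R}

omit [Module R N] in
theorem combC_eq_zero_of_length_le {T : List (List R × N)} {d : ℕ} (hT : ∀ r ∈ T, r.1.length ≤ d)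
    (z : ℕ → R) {j : ℕ} (hj : d ≤ j) : combC T z j = 0 := by
  refine Finset.sum_eq_zero fun k hk => ?_
  rw [Finset.mem_range] at hk
  rw [List.getD_eq_getElem _ _ hk, List.getD_eq_default _ _ ((hT _ (List.getElem_mem hk)).trans hj), mul_zero]

omit [Module R N] in
theorem combC_congr {T : List (List R × N)} {z z' : ℕ → R} (h : ∀ k < T.length, z k = z' k) (j : ℕ) :
    combC T z j = combC T z' j :=
  Finset.sum_congr rfl fun k hk => by rw [h k (Finset.mem_range.1 hk)]

theorem combG_congr {T : List (List R × N)} {z z' : ℕ → R} (h : ∀ k < T.length, z k = z' k) :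
    combG T z = combG T z' :=
  Finset.sum_congr rfl fun k hk => by rw [h k (Finset.mem_range.1 hk)]

/-- The linear combination of the elements of `T` with the given list of coefficients. -/
def combine (d : ℕ) (T : List (List R × N)) (r : List R) : List R × N :=
  ((List.range d).map fun j => combC T (fun k => r.getD k 0) j, combG T fun k => r.getD k 0)

theorem combC_map_combine {N' : Type*} [AddCommGroup N'] {d : ℕ} (T : List (List R × N))
    (E : List (List R × N')) (w : ℕ → R) {j : ℕ} (hj : j < d) :
    combC (E.map fun r => combine d T r.1) w j = combC T (combC E w) j := by
  rw [combC_map]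
  simp only [combine, getD_tabulate, if_pos hj]
  simp only [combC, Finset.mul_sum, Finset.sum_mul]
  rw [Finset.sum_comm]
  simp only [mul_assoc]

theorem combG_map_combine {N' : Type*} [AddCommGroup N'] {d : ℕ} (T : List (List R × N))
    (E : List (List R × N')) (w : ℕ → R) :
    combG (E.map fun r => combine d T r.1) w = combG T (combC E w) := by
  rw [combG_map]
  simp only [combine]
  simp only [combG, combC, Finset.smul_sum, Finset.sum_smul]
  rw [Finset.sum_comm]
  simp only [smul_smul]

omit [Module R N] in
theorem isConst_combC_of_mem {T : List (List R × N)} {z : ℕ → R} (hz : IsConst σ z)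
    (hT : ∀ r ∈ T, ∀ x ∈ r.1, σ x = x) : IsConst σ (combC T z) := by
  refine isConst_combC hz fun k j => ?_
  rcases getD_mem_or T k ([], 0) with hk | hk
  · rcases getD_mem_or (T.getD k ([], 0)).1 j 0 with hj | hj
    · exact hT _ hk _ hj
    · simp only [hj, map_zero]
  · simp only [hk, List.getD_nil, map_zero]

theorem isConst_getD_of_mem {l : List R} (hl : ∀ x ∈ l, σ x = x) : IsConst σ fun j => l.getD j 0 := by
  intro j
  rcases getD_mem_or l j 0 with hj | hj
  · exact hl _ hj
  · simp only [hj, map_zero]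

/-- If the solutions of `P` are exactly the combinations of `T` whose coordinates satisfy `Q`, and
`T` is independent, then a basis of the admissible coordinate vectors yields a basis of the
solutions. This is how additional linear conditions are imposed on a candidate space already found.
-/
theorem IsBas.comp {d : ℕ} {T : List (List R × N)} {Q : (ℕ → R) → Prop} {P : (ℕ → R) → N → Prop}
    {E : List (List R × R)} (hE : IsBas σ T.length (fun y g => Q y ∧ g = 0) E)
    (hlen : ∀ r ∈ T, r.1.length ≤ d) (hconst : ∀ r ∈ T, ∀ x ∈ r.1, σ x = x)
    (hmem : ∀ y, IsConst σ y → Q y → P (combC T y) (combG T y))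
    (hspan : ∀ c, IsConst σ c → ∀ g, P c g →
      ∃ y, IsConst σ y ∧ Q y ∧ (∀ j < d, c j = combC T y j) ∧ g = combG T y)
    (hindep : ∀ y, IsConst σ y → (∀ j < d, combC T y j = 0) → combG T y = 0 → ∀ k < T.length, y k = 0) :
    IsBas σ d P (E.map fun r => combine d T r.1) := by
  refine ⟨?_, ?_, ?_, ?_, ?_⟩
  · intro r hr
    obtain ⟨s, -, rfl⟩ := List.mem_map.1 hr
    simp [combine]
  · intro r hr x hx
    obtain ⟨s, hs, rfl⟩ := List.mem_map.1 hr
    obtain ⟨j, -, rfl⟩ := List.mem_map.1 hx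
    exact isConst_combC_of_mem (isConst_getD_of_mem (hE.const s hs)) hconst j
  · intro r hr
    obtain ⟨s, hs, rfl⟩ := List.mem_map.1 hr
    have h := hmem _ (isConst_getD_of_mem (hE.const s hs)) (hE.mem s hs).1
    have : (fun j => (combine d T s.1).1.getD j 0) = combC T fun k => s.1.getD k 0 := by
      funext j
      simp only [combine, getD_tabulate]
      split_ifs with hj
      · rfl
      · exact (combC_eq_zero_of_length_le hlen _ (by omega)).symm
    rw [this]
    exact h
  · intro c hc g hg
    obtain ⟨y, hy, hQ, h1, h2⟩ := hspan c hc g hg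
    obtain ⟨w, hw, h3, -⟩ := hE.span y hy 0 ⟨hQ, rfl⟩
    refine ⟨w, hw, fun j hj => ?_, ?_⟩
    · rw [combC_map_combine _ _ _ hj, h1 j hj]
      exact combC_congr h3 j
    · rw [combG_map_combine, h2]
      exact combG_congr h3
  · intro w hw h1 h2
    rw [combG_map_combine] at h2
    have h3 := hindep (combC E w) (isConst_combC hw hE.isConst_getD)
      (fun j hj => by rw [← combC_map_combine _ _ _ hj]; exact h1 j hj) h2
    rw [List.length_map]
    refine hE.indep w hw h3 (Finset.sum_eq_zero fun k hk => ?_)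
    rw [(hE.mem_getD (Finset.mem_range.1 hk)).2, smul_zero]

variable {C : Type*} [Primcodable C] {ν : C → R} {C' : Type*} [Primcodable C'] {μ : C' → N}
  {Ω : Type*} [Primcodable Ω]

omit [Module R N] [Primcodable C'] in
omit [Primcodable C] in
theorem exists_code_nil_zero (hμ : ∃ c, μ c = 0) :
    ∃ c : List C × C', Prod.map (List.map ν) μ c = ([], 0) := by
  obtain ⟨c, hc0⟩ := hμ
  exact ⟨([], c), by simp [hc0]⟩

omit [Module R N] in
theorem Coded.rc_combC (hc : Coded σ ν) (hμ : ∃ c, μ c = 0) {T : Ω → List (List R × N)}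
    (hT : RC (basOf ν μ) T) {z : Ω → ℕ → R} (hz : RC ν fun p : Ω × ℕ => z p.1 p.2) {j : Ω → ℕ}
    (hj : Computable j) : RC ν fun x => combC (T x) (z x) (j x) :=
  hc.rc_sum hT.length (hc.rc_mul hz (hc.rc_getD
    ((hT.precomp Computable.fst).getD Computable.snd (exists_code_nil_zero hμ)).fst (hj.comp Computable.fst)))

end Composition

/-! ### Difference operators on R[X] and their leading coefficients -/

section Polynomials

variable {R : Type*} [CommRing R]

/-- The shift of `X` under the `s`-fold iteration of the automorphism. -/
def iterShift (σ : R ≃+* R) (β : R) (s : ℕ) : R := ∑ k ∈ Finset.range s, (⇑σ)^[k] β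

theorem iterate_polyAut_C (σ : R ≃+* R) (β r : R) (s : ℕ) :
    (⇑(polyAut σ β))^[s] (Polynomial.C r) = Polynomial.C ((⇑σ)^[s] r) := by
  induction s with
  | zero => rfl
  | succ s ih => rw [Function.iterate_succ_apply', ih, polyAut_C, Function.iterate_succ_apply']

theorem map_iterShift (σ : R ≃+* R) (β : R) (s : ℕ) : iterShift σ β (s + 1) = β + σ (iterShift σ β s) := by
  rw [iterShift, Finset.sum_range_succ', iterShift, map_sum, add_comm]
  simp only [Function.iterate_succ_apply', Function.iterate_zero, id]

theorem iterate_polyAut_X (σ : R ≃+* R) (β : R) (s : ℕ) :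
    (⇑(polyAut σ β))^[s] X = X + Polynomial.C (iterShift σ β s) := by
  induction s with
  | zero => simp [iterShift]
  | succ s ih =>
    rw [Function.iterate_succ_apply', ih, map_add, polyAut_X, polyAut_C, map_iterShift, map_add, add_assoc]

theorem iterate_polyAut (σ : R ≃+* R) (β : R) (s : ℕ) {g : R[X]} {n : ℕ} (hg : g.natDegree ≤ n) :
    (⇑(polyAut σ β))^[s] g = ∑ N ∈ Finset.range (n + 1),
      Polynomial.C ((⇑σ)^[s] (g.coeff N)) * (X + Polynomial.C (iterShift σ β s)) ^ N := by
  conv_lhs => rw [g.as_sum_range_C_mul_X_pow' (Nat.lt_succ_of_le hg)]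
  rw [← RingEquiv.coe_toRingHom, ← RingHom.coe_pow, map_sum]
  simp only [map_mul, map_pow]
  rw [RingHom.coe_pow, RingEquiv.coe_toRingHom]
  simp only [iterate_polyAut_C, iterate_polyAut_X]

theorem coeff_iterate_polyAut (σ : R ≃+* R) (β : R) (s : ℕ) {g : R[X]} {n : ℕ} (hg : g.natDegree ≤ n) (k : ℕ) :
    ((⇑(polyAut σ β))^[s] g).coeff k = ∑ N ∈ Finset.range (n + 1),
      (⇑σ)^[s] (g.coeff N) * (iterShift σ β s ^ (N - k) * (N.choose k)) := by
  rw [iterate_polyAut σ β s hg, finsetSum_coeff]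
  simp only [coeff_C_mul, coeff_X_add_C_pow]

theorem natDegree_iterate_polyAut_le (σ : R ≃+* R) (β : R) (s : ℕ) {g : R[X]} {n : ℕ} (hg : g.natDegree ≤ n) :
    ((⇑(polyAut σ β))^[s] g).natDegree ≤ n := by
  rw [natDegree_le_iff_coeff_eq_zero]
  intro k hk
  rw [coeff_iterate_polyAut σ β s hg]
  refine Finset.sum_eq_zero fun N hN => ?_
  rw [Finset.mem_range] at hN
  rw [Nat.choose_eq_zero_of_lt (by omega), Nat.cast_zero, mul_zero, mul_zero]

theorem coeff_iterate_polyAut_top (σ : R ≃+* R) (β : R) (s : ℕ) {g : R[X]} {n : ℕ} (hg : g.natDegree ≤ n) :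
    ((⇑(polyAut σ β))^[s] g).coeff n = (⇑σ)^[s] (g.coeff n) := by
  rw [coeff_iterate_polyAut σ β s hg, Finset.sum_eq_single n]
  · simp
  · intro N hN hne
    rw [Finset.mem_range] at hN
    rw [Nat.choose_eq_zero_of_lt (by omega), Nat.cast_zero, mul_zero, mul_zero]
  · simp

/-- The linear difference operator with the given coefficients. -/
def diffOp (τ : R ≃+* R) (a : List R) (g : R) : R := ∑ i ∈ Finset.range a.length, a.getD i 0 * (⇑τ)^[i] g

theorem diffOp_add (τ : R ≃+* R) (a : List R) (g h : R) : diffOp τ a (g + h) = diffOp τ a g + diffOp τ a h := by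
  simp only [diffOp, iterate_map_add, mul_add, Finset.sum_add_distrib]

theorem diffOp_sum_mul (τ : R ≃+* R) (a : List R) {s : Finset ℕ} {y : ℕ → R} (hy : ∀ k, τ (y k) = y k)
    (h : ℕ → R) : diffOp τ a (∑ k ∈ s, y k * h k) = ∑ k ∈ s, y k * diffOp τ a (h k) := by
  have hi : ∀ i, (⇑τ)^[i] (∑ k ∈ s, y k * h k) = ∑ k ∈ s, y k * (⇑τ)^[i] (h k) := by
    intro i
    induction i with
    | zero => rfl
    | succ i ih => simp only [Function.iterate_succ_apply', ih, map_sum, map_mul, hy]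
  simp only [diffOp, hi, Finset.mul_sum]
  rw [Finset.sum_comm]
  simp only [mul_left_comm]

/-- The shift X ↦ X + β changes only lower coefficients, so at the top the operator acts through its
coefficients of X^p. This is what brings equations over R[X] down to R. -/
theorem coeff_diffOp_top (σ : R ≃+* R) (β : R) {a : List R[X]} {p n : ℕ}
    (ha : ∀ x ∈ a, x.natDegree ≤ p) {g : R[X]} (hg : g.natDegree ≤ n) :
    (diffOp (polyAut σ β) a g).coeff (n + p) = diffOp σ (a.map fun x => x.coeff p) (g.coeff n) := by
  rw [diffOp, finsetSum_coeff, diffOp, sum_range_getD_map a (fun x => x.coeff p) 0 0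
    fun i x => x * (⇑σ)^[i] (g.coeff n)]
  refine Finset.sum_congr rfl fun i hi => ?_
  have hd : (a.getD i 0).natDegree ≤ p := by
    rcases getD_mem_or a i 0 with h | h
    · exact ha _ h
    · rw [h]; simp
  rw [add_comm n p, coeff_mul_add_eq_of_natDegree_le hd (natDegree_iterate_polyAut_le σ β i hg),
    coeff_iterate_polyAut_top σ β i hg]

end Polynomials

/-! ### Solutions of bounded degree, coefficient by coefficient -/

section BoundedDegree

variable {R : Type*} [CommRing R]

/-- The parameterized equation over `R[X]` with right-hand side parameters in `R`. -/
def PolyEq (σ : R ≃+* R) (β : R) (a f : List R[X]) (c : ℕ → R) (g : R[X]) : Prop :=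
  diffOp (polyAut σ β) a g = ∑ j ∈ Finset.range f.length, Polynomial.C (c j) * f.getD j 0

/-- The defect of a candidate solution. -/
noncomputable def residual (σ : R ≃+* R) (β : R) (a f : List R[X]) (r : List R × R[X]) : R[X] :=
  ∑ j ∈ Finset.range f.length, Polynomial.C (r.1.getD j 0) * f.getD j 0 - diffOp (polyAut σ β) a r.2

/-- The defect is linear over the constants. Hence a combination of candidates is a solution exactly
when the same combination of their residuals vanishes. -/
theorem residual_comb {σ : R ≃+* R} {β : R} {a f : List R[X]} {T : List (List R × R[X])} {y : ℕ → R}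
    (hy : IsConst σ y) :
    ∑ j ∈ Finset.range f.length, Polynomial.C (combC T y j) * f.getD j 0
        - diffOp (polyAut σ β) a (combG T y) =
      ∑ k ∈ Finset.range T.length, Polynomial.C (y k) * residual σ β a f (T.getD k ([], 0)) := by
  simp only [combG, smul_eq_C_mul]
  rw [diffOp_sum_mul _ _ (fun k => by rw [polyAut_C, hy])]
  simp only [residual, mul_sub, Finset.sum_sub_distrib]
  congr 1
  simp only [combC, map_sum, map_mul, Finset.sum_mul, Finset.mul_sum]
  rw [Finset.sum_comm]
  simp only [mul_assoc]

/-- All solutions of degree `< n₀` are, up to terms of degree `< n`, unique combinations of `T`. -/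
structure BddInv (σ : R ≃+* R) (β : R) (a f : List R[X]) (n₀ n : ℕ) (T : List (List R × R[X])) : Prop where
  length_eq : ∀ r ∈ T, r.1.length = f.length
  const : ∀ r ∈ T, ∀ x ∈ r.1, σ x = x
  span : ∀ c, IsConst σ c → ∀ g, PolyEq σ β a f c g → (∀ i, n₀ ≤ i → g.coeff i = 0) →
    ∃ y, IsConst σ y ∧ (∀ j < f.length, c j = combC T y j) ∧ ∀ i, n ≤ i → (g - combG T y).coeff i = 0
  indep : ∀ y, IsConst σ y → (∀ j < f.length, combC T y j = 0) → (∀ i, n ≤ i → (combG T y).coeff i = 0) →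
    ∀ k < T.length, y k = 0

theorem BddInv.init (σ : R ≃+* R) (β : R) (a f : List R[X]) (n₀ : ℕ) :
    BddInv σ β a f n₀ n₀ ((List.range f.length).map fun i =>
      ((List.range f.length).map fun j => if i = j then 1 else 0, 0)) := by
  have hC : ∀ (w : ℕ → R) j, j < f.length → combC ((List.range f.length).map fun i =>
      ((List.range f.length).map fun j => if i = j then (1 : R) else 0, (0 : R[X]))) w j = w j := by
    intro w j hj
    simp only [combC, List.length_map, List.length_range, getD_tabulate]
    rw [Finset.sum_eq_single j]
    · simp [hj]
    · intro i hi hij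
      rw [if_pos (Finset.mem_range.1 hi)]
      simp only [getD_tabulate, if_pos hj, if_neg hij, mul_zero]
    · simp [hj]
  have hG : ∀ (w : ℕ → R), combG ((List.range f.length).map fun i =>
      ((List.range f.length).map fun j => if i = j then (1 : R) else 0, (0 : R[X]))) w = 0 := by
    intro w
    refine Finset.sum_eq_zero fun i _ => ?_
    rw [getD_tabulate]
    split_ifs <;> simp
  refine ⟨?_, ?_, ?_, ?_⟩
  · intro r hr
    obtain ⟨i, -, rfl⟩ := List.mem_map.1 hr
    simp
  · intro r hr x hx
    obtain ⟨i, -, rfl⟩ := List.mem_map.1 hr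
    obtain ⟨j, -, rfl⟩ := List.mem_map.1 hx
    split_ifs <;> simp
  · intro c hc g hg hg0
    exact ⟨c, hc, fun j hj => (hC c j hj).symm, fun i hi => by rw [hG, sub_zero, hg0 i hi]⟩
  · intro y hy h1 h2 k hk
    rw [List.length_map, List.length_range] at hk
    rw [← hC y k hk]
    exact h1 k hk

/-- The step from degree `n + 1` to degree `n`. -/
noncomputable def bddStep (d n : ℕ) (T : List (List R × R[X])) (r : List R × R) : List R × R[X] :=
  ((combine d T r.1).1, (combine d T r.1).2 + monomial n r.2)

theorem combC_map_bddStep {d n : ℕ} (T : List (List R × R[X])) (V : List (List R × R)) (w : ℕ → R) {j : ℕ}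
    (hj : j < d) : combC (V.map (bddStep d n T)) w j = combC T (combC V w) j := by
  rw [← combC_map_combine T V w hj, combC_map, combC_map]
  rfl

theorem combG_map_bddStep {d n : ℕ} (T : List (List R × R[X])) (V : List (List R × R)) (w : ℕ → R) :
    combG (V.map (bddStep d n T)) w = combG T (combC V w) + monomial n (combG V w) := by
  rw [← combG_map_combine (d := d) T V w, combG_map, combG_map]
  simp only [bddStep, smul_add, Finset.sum_add_distrib]
  simp only [combG, map_sum, smul_monomial]

/-- After subtraction of the right combination of `T` a solution has degree at most n, and the
coefficient of X^(n+p) in its equation is a PLDE over R for the unknown coefficient of X^n. The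
right-hand sides are the corresponding coefficients of the residuals, with the coordinates in `T` as
parameters, so `V` delivers the surviving coordinates together with the next coefficient. Only a
necessary condition is used here; the full equation is imposed in `BddInv.isBas`. -/
theorem BddInv.step {σ : R ≃+* R} {β : R} {a f : List R[X]} {n₀ n p : ℕ} {T : List (List R × R[X])}
    {V : List (List R × R)} (h : BddInv σ β a f n₀ (n + 1) T) (ha : ∀ x ∈ a, x.natDegree ≤ p)
    (hV : IsBas σ T.length (PLDE σ (a.map fun x => x.coeff p)
      (T.map fun r => (residual σ β a f r).coeff (n + p))) V) :
    BddInv σ β a f n₀ n (V.map (bddStep f.length n T)) := by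
  have hVc : ∀ w, IsConst σ w → IsConst σ (combC V w) := fun w hw => isConst_combC hw hV.isConst_getD
  refine ⟨?_, ?_, ?_, ?_⟩
  · intro r hr
    obtain ⟨s, -, rfl⟩ := List.mem_map.1 hr
    simp [bddStep, combine]
  · intro r hr x hx
    obtain ⟨s, hs, rfl⟩ := List.mem_map.1 hr
    obtain ⟨j, -, rfl⟩ := List.mem_map.1 hx
    exact isConst_combC_of_mem (isConst_getD_of_mem (hV.const s hs)) h.const j
  · intro c hc g hg hg0
    obtain ⟨y, hy, h1, h2⟩ := h.span c hc g hg hg0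
    have hdeg : (g - combG T y).natDegree ≤ n := by
      rw [natDegree_le_iff_coeff_eq_zero]
      exact fun i hi => h2 i hi
    have hres : diffOp (polyAut σ β) a (g - combG T y) =
        ∑ k ∈ Finset.range T.length, Polynomial.C (y k) * residual σ β a f (T.getD k ([], 0)) := by
      rw [← residual_comb hy]
      have h3 : ∑ j ∈ Finset.range f.length, Polynomial.C (combC T y j) * f.getD j 0 =
          diffOp (polyAut σ β) a g := by
        rw [show diffOp (polyAut σ β) a g = _ from hg]
        exact Finset.sum_congr rfl fun j hj => by rw [h1 j (Finset.mem_range.1 hj)]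
      rw [h3]
      have h4 := diffOp_add (polyAut σ β) a (g - combG T y) (combG T y)
      rw [sub_add_cancel] at h4
      rw [h4, add_sub_cancel_right]
    have hpl : PLDE σ (a.map fun x => x.coeff p) (T.map fun r => (residual σ β a f r).coeff (n + p)) y
        ((g - combG T y).coeff n) := by
      have h5 := congrArg (fun q => q.coeff (n + p)) hres
      simp only [coeff_diffOp_top σ β ha hdeg, finsetSum_coeff, coeff_C_mul] at h5
      unfold PLDE
      rw [sum_range_getD_map T (fun r => (residual σ β a f r).coeff (n + p)) ([], 0) 0 fun j x => y j * x]
      exact h5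
    obtain ⟨w, hw, h3, h4⟩ := hV.span y hy _ hpl
    refine ⟨w, hw, fun j hj => ?_, fun i hi => ?_⟩
    · rw [combC_map_bddStep _ _ _ hj, h1 j hj]
      exact combC_congr h3 j
    · rw [combG_map_bddStep, ← combG_congr h3, ← h4, ← sub_sub, coeff_sub, coeff_monomial]
      split_ifs with hni
      · rw [hni, sub_self]
      · rw [h2 i (by omega), sub_zero]
  · intro w hw h1 h2
    have h3 : ∀ k < T.length, combC V w k = 0 := by
      refine h.indep _ (hVc w hw) (fun j hj => ?_) fun i hi => ?_
      · rw [← combC_map_bddStep _ _ _ hj]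
        exact h1 j hj
      · have := h2 i (by omega)
        rwa [combG_map_bddStep, coeff_add, coeff_monomial, if_neg (by omega), add_zero] at this
    rw [List.length_map]
    refine hV.indep w hw h3 ?_
    have := h2 n le_rfl
    rw [combG_map_bddStep, coeff_add, coeff_monomial, if_pos rfl] at this
    have h4 : combG T (combC V w) = 0 := Finset.sum_eq_zero fun k hk => by
      rw [h3 k (Finset.mem_range.1 hk), zero_smul]
    simpa [h4] using this

/-- With all coefficients determined, every solution is a combination of `T`, and the combinations
that really are solutions are singled out by the relations `D` between the residuals. -/
theorem BddInv.isBas {σ : R ≃+* R} {β : R} {a f : List R[X]} {n₀ : ℕ} {T : List (List R × R[X])}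
    {D : List (List R × R)} (h : BddInv σ β a f n₀ 0 T)
    (hn₀ : ∀ c, IsConst σ c → ∀ g, PolyEq σ β a f c g → ∀ i, n₀ ≤ i → g.coeff i = 0)
    (hD : IsBas σ T.length (fun y g => ∑ k ∈ Finset.range T.length, Polynomial.C (y k) *
      residual σ β a f (T.getD k ([], 0)) = 0 ∧ g = 0) D) :
    IsBas σ f.length (PolyEq σ β a f) (D.map fun r => combine f.length T r.1) := by
  refine hD.comp (fun r hr => (h.length_eq r hr).le) h.const ?_ ?_ ?_
  · intro y hy hres
    rw [← residual_comb hy, sub_eq_zero] at hres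
    exact hres.symm
  · intro c hc g hg
    obtain ⟨y, hy, h1, h2⟩ := h.span c hc g hg (hn₀ c hc g hg)
    have hgy : g = combG T y := by
      rw [← sub_eq_zero]
      ext i
      exact h2 i (Nat.zero_le i)
    refine ⟨y, hy, ?_, h1, hgy⟩
    rw [← residual_comb hy, ← hgy, show diffOp (polyAut σ β) a g = _ from hg, sub_eq_zero]
    exact Finset.sum_congr rfl fun j hj => by rw [h1 j (Finset.mem_range.1 hj)]
  · intro y hy h1 h2
    refine h.indep y hy h1 fun i _ => by rw [h2, coeff_zero]

/-- A basis over `R` with constants in `R` is one over `R[X]`, if `R[X]` has no new constants. -/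
theorem IsBas.toPoly {σ : R ≃+* R} {β : R} {a f : List R[X]}
    (hK : ∀ x : R[X], polyAut σ β x = x → ∃ r, σ r = r ∧ x = Polynomial.C r)
    {L : List (List R × R[X])} (h : IsBas σ f.length (PolyEq σ β a f) L) :
    IsBas (polyAut σ β) f.length (PLDE (polyAut σ β) a f)
      (L.map fun r => (r.1.map Polynomial.C, r.2)) := by
  have hC : ∀ (z : ℕ → R) j, combC (L.map fun r => (r.1.map (Polynomial.C : R →+* R[X]), r.2))
      (fun k => Polynomial.C (z k)) j = Polynomial.C (combC L z j) := by
    intro z j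
    rw [combC_map, combC, map_sum]
    refine Finset.sum_congr rfl fun k _ => ?_
    rw [map_mul]
    congr 1
    simp only [List.getD, List.getElem?_map, ← map_zero (Polynomial.C : R →+* R[X]), Option.getD_map]
  have hG : ∀ (z : ℕ → R), combG (L.map fun r => (r.1.map (Polynomial.C : R →+* R[X]), r.2))
      (fun k => Polynomial.C (z k)) = combG L z := by
    intro z
    rw [combG_map, combG]
    exact Finset.sum_congr rfl fun k _ => by rw [smul_eq_mul, smul_eq_C_mul]
  -- Since R[X] has no new constants, coefficient sequences over R[X] and over R are the same.
  have hlift : ∀ z, IsConst (polyAut σ β) z → ∃ z', IsConst σ z' ∧ z = fun k => Polynomial.C (z' k) := by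
    intro z hz
    choose z' h1 h2 using fun k => hK (z k) (hz k)
    exact ⟨z', h1, funext h2⟩
  refine ⟨?_, ?_, ?_, ?_, ?_⟩
  · intro r hr
    obtain ⟨s, hs, rfl⟩ := List.mem_map.1 hr
    simpa using h.length_eq s hs
  · intro r hr x hx
    obtain ⟨s, hs, rfl⟩ := List.mem_map.1 hr
    obtain ⟨y, hy, rfl⟩ := List.mem_map.1 hx
    rw [polyAut_C, h.const s hs y hy]
  · intro r hr
    obtain ⟨s, hs, rfl⟩ := List.mem_map.1 hr
    have := h.mem s hs
    unfold PolyEq diffOp at this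
    unfold PLDE
    rw [this]
    refine Finset.sum_congr rfl fun j _ => ?_
    congr 1
    simp only [List.getD, List.getElem?_map, ← map_zero (Polynomial.C : R →+* R[X]), Option.getD_map]
  · intro c hc g hg
    obtain ⟨c, hc', rfl⟩ := hlift c hc
    obtain ⟨z, hz, h1, h2⟩ := h.span c hc' g hg
    refine ⟨fun k => Polynomial.C (z k), fun k => by rw [polyAut_C, hz], fun j hj => ?_, ?_⟩
    · simp only [hC, h1 j hj]
    · rw [hG, h2]
  · intro z hz h1 h2
    obtain ⟨z, hz', rfl⟩ := hlift z hz
    rw [hG] at h2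
    intro k hk
    rw [List.length_map] at hk
    beta_reduce
    rw [h.indep z hz' (fun j hj => C_injective (by rw [← hC, h1 j hj, map_zero])) h2 k hk, map_zero]

end BoundedDegree

/-! ### The solver over R[X], given a degree bound -/

section BoundedSolver

variable {R : Type*} [CommRing R] {σ : R ≃+* R} {C : Type*} [Primcodable C] {ν : C → R}
  {Ω : Type*} [Primcodable Ω]

theorem Coded.rc_combG (hc : Coded σ ν) {T : Ω → List (List R × R)} (hT : RC (basOf ν ν) T)
    {z : Ω → ℕ → R} (hz : RC ν fun p : Ω × ℕ => z p.1 p.2) : RC ν fun x => combG (T x) (z x) :=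
  hc.rc_sum hT.length (hc.rc_mul hz (((hT.precomp Computable.fst).getD Computable.snd
    (exists_code_nil_zero (hc.surj 0))).snd))

theorem Coded.rc_combG_poly (hc : Coded σ ν) {T : Ω → List (List R × R[X])}
    (hT : RC (basOf ν (polyOf ν)) T) {z : Ω → ℕ → R} (hz : RC ν fun p : Ω × ℕ => z p.1 p.2) :
    RC (polyOf ν) fun x => combG (T x) (z x) := by
  have hp := hc.polynomial 0
  refine (hp.rc_sum hT.length (φ := fun x k => Polynomial.C (z x k) * ((T x).getD k ([], 0)).2)
    (hp.rc_mul (hc.rc_C hz) (((hT.precomp Computable.fst).getD Computable.snd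
    (exists_code_nil_zero (hp.surj 0))).snd))).of_eq fun x => ?_
  exact Finset.sum_congr rfl fun k _ => (smul_eq_C_mul _).symm

theorem Coded.rc_combine (hc : Coded σ ν) {N : Type*} [AddCommGroup N] [Module R N] {C' : Type*}
    [Primcodable C'] {μ : C' → N} (hμ : ∃ c, μ c = 0) {T : Ω → List (List R × N)} (hT : RC (basOf ν μ) T)
    {d : Ω → ℕ} (hd : Computable d) {r : Ω → List R} (hr : RC (List.map ν) r)
    (hG : RC μ fun x => combG (T x) fun k => (r x).getD k 0) :
    RC (Prod.map (List.map ν) μ) fun x => combine (d x) (T x) (r x) :=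
  (RC.tabulate hd (hc.rc_combC hμ (hT.precomp Computable.fst) (hc.rc_getD
    (hr.precomp (Computable.fst.comp Computable.fst)) Computable.snd) Computable.snd)).prod hG

theorem rel_tabulate_iff (s : ℕ) (φ : ℕ → R) (c : ℕ → R) (g : R) :
    Rel ((List.range s).map φ) c g ↔ ∑ w ∈ Finset.range s, c w * φ w = 0 ∧ g = 0 := by
  unfold Rel
  have : ∑ j ∈ Finset.range ((List.range s).map φ).length, c j * ((List.range s).map φ).getD j 0 =
      ∑ w ∈ Finset.range s, c w * φ w := by
    rw [List.length_map, List.length_range]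
    exact Finset.sum_congr rfl fun w hw => by rw [getD_tabulate, if_pos (Finset.mem_range.1 hw)]
  rw [this]

theorem isBas_unit (σ : R ≃+* R) (d : ℕ) : IsBas σ d (fun _ (g : R) => g = 0)
    ((List.range d).map fun i => ((List.range d).map fun j => if i = j then 1 else 0, 0)) := by
  have hC : ∀ (w : ℕ → R) j, j < d → combC ((List.range d).map fun i =>
      ((List.range d).map fun j => if i = j then (1 : R) else 0, (0 : R))) w j = w j := by
    intro w j hj
    simp only [combC, List.length_map, List.length_range, getD_tabulate]
    rw [Finset.sum_eq_single j]
    · simp [hj]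
    · intro i hi hij
      rw [if_pos (Finset.mem_range.1 hi)]
      simp only [getD_tabulate, if_pos hj, if_neg hij, mul_zero]
    · simp [hj]
  have hG : ∀ (w : ℕ → R), combG ((List.range d).map fun i =>
      ((List.range d).map fun j => if i = j then (1 : R) else 0, (0 : R))) w = 0 := by
    intro w
    refine Finset.sum_eq_zero fun i _ => ?_
    rw [getD_tabulate]
    split_ifs <;> simp
  refine ⟨?_, ?_, ?_, ?_, ?_⟩
  · intro r hr
    obtain ⟨i, -, rfl⟩ := List.mem_map.1 hr
    simp
  · intro r hr x hx
    obtain ⟨i, -, rfl⟩ := List.mem_map.1 hr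
    obtain ⟨j, -, rfl⟩ := List.mem_map.1 hx
    split_ifs <;> simp
  · intro r hr
    obtain ⟨i, -, rfl⟩ := List.mem_map.1 hr
    rfl
  · intro c hc g hg
    exact ⟨c, hc, fun j hj => (hC c j hj).symm, by rw [hG, hg]⟩
  · intro y hy h1 h2 k hk
    rw [List.length_map, List.length_range] at hk
    rw [← hC y k hk]
    exact h1 k hk

/-- A basis of the linear relations between polynomials can be computed. -/
theorem exists_relations_poly [IsDomain R] (hc : Coded σ ν) (hs : Solver σ ν) {ρ : Ω → List R[X]}
    (hρ : RC (List.map (polyOf ν)) ρ) :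
    ∃ D : Ω → List (List R × R), RC (basOf ν ν) D ∧ ∀ x, IsBas σ (ρ x).length
      (fun y g => ∑ k ∈ Finset.range (ρ x).length, Polynomial.C (y k) * (ρ x).getD k 0 = 0 ∧ g = 0) (D x) := by
  have hp := hc.polynomial 0
  have hρk : RC (polyOf ν) fun p : Ω × ℕ => (ρ p.1).getD p.2 0 :=
    hp.rc_getD (hρ.precomp Computable.fst) Computable.snd
  obtain ⟨b, hb, hb'⟩ := hρk.exists_bound
  -- The sum of the individual bounds serves as a common degree bound for all the polynomials.
  let B : Ω → ℕ := fun x => ((List.range (ρ x).length).map fun k => b (x, k)).sum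
  have hB : Computable B := computable_list_sum (computable_tabulate hρ.length hb)
  have hB' : ∀ x, ∀ k < (ρ x).length, ∀ i, B x ≤ i → ((ρ x).getD k 0).coeff i = 0 := by
    intro x k hk i hi
    refine hb' (x, k) i (le_trans ?_ hi)
    exact List.single_le_sum (by simp) _ (List.mem_map.2 ⟨k, List.mem_range.2 hk, rfl⟩)
  suffices ∃ F : Ω → List (List C × C), Computable F ∧ ∀ x, IsBas σ (ρ x).length
      (fun y g => (∀ i < B x, ∑ k ∈ Finset.range (ρ x).length, y k * ((ρ x).getD k 0).coeff i = 0) ∧ g = 0)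
      (basOf ν ν (F x)) by
    obtain ⟨F, hF, hF'⟩ := this
    refine ⟨_, ⟨F, hF, fun x => rfl⟩, fun x => (hF' x).congr fun y g _ => ?_⟩
    refine and_congr_left fun _ => ⟨fun h => ?_, fun h i _ => ?_⟩
    · ext i
      rw [finsetSum_coeff, coeff_zero]
      simp only [coeff_C_mul]
      by_cases hi : i < B x
      · exact h i hi
      · refine Finset.sum_eq_zero fun k hk => ?_
        rw [hB' x k (Finset.mem_range.1 hk) i (by omega), mul_zero]
    · have := congrArg (fun q => q.coeff i) h
      simpa only [finsetSum_coeff, coeff_C_mul, coeff_zero] using this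
  -- The coefficient conditions are imposed one degree at a time. Each round solves a single
  -- relation in R between the values of the current basis vectors and composes the bases by
  -- `IsBas.comp`.
  refine exists_computable_rec (Inv := fun x n (y : List (List C × C)) => IsBas σ (ρ x).length
      (fun y g => (∀ i < n, ∑ k ∈ Finset.range (ρ x).length, y k * ((ρ x).getD k 0).coeff i = 0) ∧ g = 0)
      (basOf ν ν y)) hB ?_ ?_
  · have h1 : RC (basOf ν ν) fun x => (List.range (ρ x).length).map fun i =>
        ((List.range (ρ x).length).map fun j => if i = j then (1 : R) else 0, (0 : R)) :=
      RC.tabulate hρ.length (RC.prod (RC.tabulate (hρ.precomp Computable.fst).length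
        (RC.ite (computablePred_nat_eq (Computable.snd.comp Computable.fst) Computable.snd)
          (hc.rc_const _) (hc.rc_const _))) (hc.rc_const _))
    obtain ⟨F, hF, hF'⟩ := h1
    refine ⟨F, hF, fun x => ?_⟩
    have h2 := hF' x
    beta_reduce at h2
    rw [h2]
    exact (isBas_unit σ _).congr fun c g _ => by simp
  · let Ω' := Ω × ℕ × List (List C × C)
    let D : Ω' → List (List R × R) := fun p => basOf ν ν p.2.2
    have hD : RC (basOf ν ν) D := RC.code (Computable.snd.comp Computable.snd)
    have hdef := exists_code_nil_zero (ν := ν) (hc.surj 0)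
    have hρ' : RC (List.map (polyOf ν)) fun p : Ω' => ρ p.1 := hρ.precomp Computable.fst
    have hr : RC (List.map ν) fun p : Ω' => (List.range (D p).length).map fun w =>
        ∑ k ∈ Finset.range (ρ p.1).length, ((D p).getD w ([], 0)).1.getD k 0 * ((ρ p.1).getD k 0).coeff p.2.1 := by
      refine RC.tabulate hD.length (hc.rc_sum (hρ'.length.comp Computable.fst) (hc.rc_mul ?_ ?_))
      · exact hc.rc_getD (((hD.precomp Computable.fst).getD Computable.snd hdef).fst.precomp
          Computable.fst) Computable.snd
      · exact hc.rc_coeff (hp.rc_getD (hρ'.precomp (Computable.fst.comp Computable.fst)) Computable.snd)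
          (Computable.fst.comp (Computable.snd.comp (Computable.fst.comp Computable.fst)))
    obtain ⟨E, hE, hE'⟩ := exists_relations hc hs hr
    have hG : RC (basOf ν ν) fun p : Ω' => (E p).map fun r => combine (ρ p.1).length (D p) r.1 := by
      have hq : RC (Prod.map (List.map ν) ν) fun q : Ω' × (List C × C) => Prod.map (List.map ν) ν q.2 :=
        RC.code Computable.snd
      refine hE.list_map (ψ := fun p r => combine (ρ p.1).length (D p) r.1) ?_
      exact hc.rc_combine (hc.surj 0) (hD.precomp Computable.fst) (hρ'.length.comp Computable.fst) hq.fst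
        (hc.rc_combG (hD.precomp Computable.fst) (hc.rc_getD (hq.fst.precomp Computable.fst) Computable.snd))
    obtain ⟨G, hG, hG'⟩ := hG
    refine ⟨G, hG, fun x n y hn hy => ?_⟩
    have h2 := hG' (x, n, y)
    beta_reduce at h2
    rw [h2]
    have hEx := (hE' (x, n, y)).congr fun c g _ => rel_tabulate_iff _ _ c g
    rw [List.length_map, List.length_range] at hEx
    refine IsBas.comp hEx (fun r hr => (hy.length_eq r hr).le) hy.const ?_ ?_ ?_
    · intro z hz hrel
      have hcol : ∀ i, ∑ k ∈ Finset.range (ρ x).length, combC (basOf ν ν y) z k * ((ρ x).getD k 0).coeff i =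
          ∑ w ∈ Finset.range (basOf ν ν y).length, z w * ∑ k ∈ Finset.range (ρ x).length,
            ((basOf ν ν y).getD w ([], 0)).1.getD k 0 * ((ρ x).getD k 0).coeff i := by
        intro i
        simp only [combC, Finset.sum_mul, Finset.mul_sum]
        rw [Finset.sum_comm]
        simp only [mul_assoc]
      refine ⟨fun i hi => ?_, Finset.sum_eq_zero fun k hk => by
        rw [(hy.mem_getD (Finset.mem_range.1 hk)).2, smul_zero]⟩
      rw [hcol]
      rcases Nat.lt_succ_iff_lt_or_eq.1 hi with hi | rfl
      · exact Finset.sum_eq_zero fun w hw => by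
          rw [(hy.mem_getD (Finset.mem_range.1 hw)).1 i hi, mul_zero]
      · exact hrel
    · rintro c hcc g ⟨h1, h3⟩
      obtain ⟨z, hz, h4, h5⟩ := hy.span c hcc g ⟨fun i hi => h1 i (Nat.lt_succ_of_lt hi), h3⟩
      refine ⟨z, hz, ?_, h4, h5⟩
      refine Eq.trans ?_ (h1 n (Nat.lt_succ_self n))
      refine Eq.trans ?_ (Finset.sum_congr rfl fun k hk => by rw [h4 k (Finset.mem_range.1 hk)]).symm
      simp only [combC, Finset.sum_mul, Finset.mul_sum]
      rw [Finset.sum_comm]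
      simp only [mul_assoc]
      rfl
    · exact hy.indep

/-- The maximal degree of a list of polynomials can be computed. -/
theorem exists_max_degree (hc : Coded σ ν) {a : Ω → List R[X]} (ha : RC (List.map (polyOf ν)) a) :
    ∃ p : Ω → ℕ, Computable p ∧ ∀ x, (∃ y ∈ a x, y ≠ 0) →
      (∀ y ∈ a x, y.natDegree ≤ p x) ∧ ∃ y ∈ a x, y.coeff (p x) ≠ 0 := by
  have hp := hc.polynomial 0
  have hak : RC (polyOf ν) fun p : Ω × ℕ => (a p.1).getD p.2 0 :=
    hp.rc_getD (ha.precomp Computable.fst) Computable.snd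
  obtain ⟨b, hb, hb'⟩ := hak.exists_bound
  have hget : ∀ x (q : R[X] → Prop), (∃ y ∈ a x, q y) ↔ ∃ k < (a x).length, q ((a x).getD k 0) := by
    intro x q
    constructor
    · rintro ⟨y, hy, hq⟩
      obtain ⟨k, hk, rfl⟩ := List.getElem_of_mem hy
      exact ⟨k, hk, by rwa [List.getD_eq_getElem _ _ hk]⟩
    · rintro ⟨k, hk, hq⟩
      rw [List.getD_eq_getElem _ _ hk] at hq
      exact ⟨_, List.getElem_mem hk, hq⟩
  -- The restriction i < b makes the condition a finite check. Beyond the bound b all coefficients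
  -- vanish anyway.
  let D : Ω → ℕ → Prop := fun x p => (∃ k < (a x).length, ((a x).getD k 0).coeff p ≠ 0) ∧
    ∀ k < (a x).length, ∀ i < b (x, k), p < i → ((a x).getD k 0).coeff i = 0
  have hD : ComputablePred fun q : Ω × ℕ => D q.1 q.2 := by
    refine ComputablePred.and' (ComputablePred.exists_lt' (ha.length.comp Computable.fst) (hc.eq_zero'
      (hc.rc_coeff (hp.rc_getD (ha.precomp (Computable.fst.comp Computable.fst)) Computable.snd)
        (Computable.snd.comp Computable.fst))).not) ?_
    refine ComputablePred.forall_lt' (ha.length.comp Computable.fst) (ComputablePred.forall_lt'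
      (hb.comp ((Computable.fst.comp Computable.fst).pair Computable.snd)) (ComputablePred.imp'
        (computablePred_nat_lt (Computable.snd.comp (Computable.fst.comp Computable.fst)) Computable.snd) ?_))
    exact hc.eq_zero' (hc.rc_coeff (hp.rc_getD (ha.precomp (Computable.fst.comp (Computable.fst.comp
      Computable.fst))) (Computable.snd.comp Computable.fst)) Computable.snd)
  have hpre : ComputablePred fun x => ∃ y ∈ a x, y ≠ 0 :=
    (ComputablePred.exists_lt' ha.length (p := fun x k => (a x).getD k 0 ≠ 0)
      (hp.eq_zero' hak).not).of_eq fun x => (hget x (· ≠ 0)).symm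
  obtain ⟨p, hpc, hp'⟩ := exists_computable_search hD hpre fun x hx => by
    classical
    obtain ⟨k, hk, hk0⟩ := (hget x _).1 hx
    obtain ⟨m, hm, hmax⟩ := Finset.exists_max_image (Finset.range (a x).length)
      (fun k => ((a x).getD k 0).degree) ⟨k, Finset.mem_range.2 hk⟩
    have hm0 : (a x).getD m 0 ≠ 0 := by
      intro h0
      have := hmax k (Finset.mem_range.2 hk)
      rw [h0, degree_zero, le_bot_iff, degree_eq_bot] at this
      exact hk0 this
    refine ⟨((a x).getD m 0).natDegree, ⟨m, Finset.mem_range.1 hm, ?_⟩, fun k hk i _ hi => ?_⟩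
    · exact leadingCoeff_ne_zero.2 hm0
    · exact coeff_eq_zero_of_natDegree_lt ((natDegree_le_natDegree (hmax k (Finset.mem_range.2 hk))).trans_lt hi)
  refine ⟨p, hpc, fun x hx => ?_⟩
  obtain ⟨h1, h2⟩ := hp' x hx
  refine ⟨fun y hy => ?_, (hget x fun y => y.coeff (p x) ≠ 0).2 h1⟩
  obtain ⟨k, hk, rfl⟩ := List.getElem_of_mem hy
  rw [natDegree_le_iff_coeff_eq_zero]
  intro i hi
  rw [← List.getD_eq_getElem _ 0 hk]
  by_cases hib : i < b (x, k)
  · exact h2 k hk i hib hi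
  · exact hb' (x, k) i (by omega)

/-- If the degrees of the solutions can be bounded, the equations over `R[X]` can be solved. -/
theorem Solver.polynomial_of_bound [IsDomain R] (hc : Coded σ ν) (hs : Solver σ ν) {β : R}
    (hK : ∀ x : R[X], polyAut σ β x = x → ∃ r, σ r = r ∧ x = Polynomial.C r)
    (hN : ∃ N : List (List C) × List (List C) → ℕ, Computable N ∧ ∀ a f : List (List C),
      (∃ x ∈ a, polyOf ν x ≠ 0) → ∀ c, IsConst σ c → ∀ g,
        PolyEq σ β (a.map (polyOf ν)) (f.map (polyOf ν)) c g → ∀ i, N (a, f) ≤ i → g.coeff i = 0) :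
    Solver (polyAut σ β) (polyOf ν) := by
  obtain ⟨N, hNc, hN⟩ := hN
  have hp := hc.polynomial β
  let Ω := List (List C) × List (List C)
  let a : Ω → List R[X] := fun x => x.1.map (polyOf ν)
  let f : Ω → List R[X] := fun x => x.2.map (polyOf ν)
  have ha : RC (List.map (polyOf ν)) a := RC.code Computable.fst
  have hf : RC (List.map (polyOf ν)) f := RC.code Computable.snd
  obtain ⟨p, hpc, hp'⟩ := exists_max_degree hc ha
  have hres : ∀ {Ψ : Type _} [Primcodable Ψ] {x : Ψ → Ω} (_ : Computable x) {r : Ψ → List R × R[X]}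
      (_ : RC (Prod.map (List.map ν) (polyOf ν)) r),
      RC (polyOf ν) fun q => residual σ β (a (x q)) (f (x q)) (r q) := by
    intro Ψ _ x hx r hr
    refine hp.rc_sub (hp.rc_sum (hf.length.comp hx) (hp.rc_mul (hc.rc_C (hc.rc_getD
      (hr.fst.precomp Computable.fst) Computable.snd)) (hp.rc_getD (hf.precomp (hx.comp Computable.fst))
        Computable.snd))) ?_
    exact hp.rc_sum (ha.length.comp hx) (hp.rc_mul (hp.rc_getD (ha.precomp (hx.comp Computable.fst))
      Computable.snd) (hp.rc_iterate Computable.snd (hr.snd.precomp Computable.fst)))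
  -- The loop counter n increases while the degree `N x - n` still to be treated decreases. The
  -- final value 0 therefore first appears as `N x - N x`.
  have hT : ∃ F : Ω → List (List C × List C), Computable F ∧ ∀ x, (∃ y ∈ a x, y ≠ 0) →
      BddInv σ β (a x) (f x) (N x) (N x - N x) (basOf ν (polyOf ν) (F x)) := by
    refine exists_computable_rec (Inv := fun x n (y : List (List C × List C)) => (∃ y ∈ a x, y ≠ 0) →
      BddInv σ β (a x) (f x) (N x) (N x - n) (basOf ν (polyOf ν) y)) hNc ?_ ?_
    · have h1 : RC (basOf ν (polyOf ν)) fun x : Ω => (List.range (f x).length).map fun i =>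
          ((List.range (f x).length).map fun j => if i = j then (1 : R) else 0, (0 : R[X])) :=
        RC.tabulate hf.length (RC.prod (RC.tabulate (hf.precomp Computable.fst).length
          (RC.ite (computablePred_nat_eq (Computable.snd.comp Computable.fst) Computable.snd)
            (hc.rc_const _) (hc.rc_const _))) (hp.rc_const _))
      obtain ⟨F, hF, hF'⟩ := h1
      refine ⟨F, hF, fun x _ => ?_⟩
      have h2 := hF' x
      beta_reduce at h2
      rw [h2]
      exact BddInv.init σ β _ _ _
    · let Ω' := Ω × ℕ × List (List C × List C)
      let T : Ω' → List (List R × R[X]) := fun q => basOf ν (polyOf ν) q.2.2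
      have hT : RC (basOf ν (polyOf ν)) T := RC.code (Computable.snd.comp Computable.snd)
      have hn : Computable fun q : Ω' => N q.1 - (q.2.1 + 1) :=
        computable_sub (hNc.comp Computable.fst) (Computable.succ.comp (Computable.fst.comp Computable.snd))
      obtain ⟨V, hV, hV'⟩ := hs.apply (Ω := Ω') (a := fun q => (a q.1).map fun y => y.coeff (p q.1))
        (f := fun q => (T q).map fun r => (residual σ β (a q.1) (f q.1) r).coeff
          (N q.1 - (q.2.1 + 1) + p q.1))
        ((ha.precomp Computable.fst).list_map (ψ := fun q y => y.coeff (p q.1)) (hc.rc_coeff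
          (RC.code Computable.snd) (hpc.comp (Computable.fst.comp Computable.fst))))
        (hT.list_map (ψ := fun q r => (residual σ β (a q.1) (f q.1) r).coeff
          (N q.1 - (q.2.1 + 1) + p q.1)) (hc.rc_coeff (hres (Computable.fst.comp Computable.fst)
            (RC.code Computable.snd)) (computable_add (hn.comp Computable.fst)
              (hpc.comp (Computable.fst.comp Computable.fst)))))
      have hG : RC (basOf ν (polyOf ν)) fun q : Ω' =>
          (V q).map (bddStep (f q.1).length (N q.1 - (q.2.1 + 1)) (T q)) := by
        refine hV.list_map (ψ := fun q => bddStep (f q.1).length (N q.1 - (q.2.1 + 1)) (T q)) ?_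
        have hq : RC (Prod.map (List.map ν) ν) fun q : Ω' × (List C × C) => Prod.map (List.map ν) ν q.2 :=
          RC.code Computable.snd
        have h1 := hc.rc_combine (hp.surj 0) (hT.precomp (Computable.fst (β := List C × C)))
          ((hf.length.comp Computable.fst).comp Computable.fst) hq.fst
          (hc.rc_combG_poly (hT.precomp Computable.fst) (hc.rc_getD (hq.fst.precomp Computable.fst)
            Computable.snd))
        exact h1.fst.prod (hp.rc_add h1.snd (hc.rc_monomial (hn.comp Computable.fst) hq.snd))
      obtain ⟨G, hG, hG'⟩ := hG
      refine ⟨G, hG, fun x n y hn hy hx => ?_⟩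
      have h2 := hG' (x, n, y)
      beta_reduce at h2
      rw [h2]
      have h3 := hy hx
      rw [show N x - n = N x - (n + 1) + 1 by omega] at h3
      have h4 := hV' (x, n, y) (by
        obtain ⟨z, hz, hz0⟩ := (hp' x hx).2
        exact ⟨_, List.mem_map.2 ⟨z, hz, rfl⟩, hz0⟩)
      rw [List.length_map] at h4
      exact h3.step (hp' x hx).1 h4
  obtain ⟨F, hF, hF'⟩ := hT
  have hFT : RC (basOf ν (polyOf ν)) fun x => basOf ν (polyOf ν) (F x) := RC.code hF
  -- The relations between the residuals of the final candidates: these turn candidates into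
  -- solutions.
  obtain ⟨D, hD, hD'⟩ := exists_relations_poly hc hs (Ω := Ω)
    (ρ := fun x => (basOf ν (polyOf ν) (F x)).map (residual σ β (a x) (f x)))
    (hFT.list_map (ψ := fun x => residual σ β (a x) (f x)) (hres Computable.fst (RC.code Computable.snd)))
  have hL : RC (basOf ν (polyOf ν)) fun x => (D x).map fun r =>
      combine (f x).length (basOf ν (polyOf ν) (F x)) r.1 := by
    have hq : RC (Prod.map (List.map ν) ν) fun q : Ω × (List C × C) => Prod.map (List.map ν) ν q.2 :=
      RC.code Computable.snd
    refine hD.list_map (ψ := fun x r => combine (f x).length (basOf ν (polyOf ν) (F x)) r.1) ?_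
    exact hc.rc_combine (hp.surj 0) (hFT.precomp Computable.fst) (hf.length.comp Computable.fst) hq.fst
      (hc.rc_combG_poly (hFT.precomp Computable.fst) (hc.rc_getD (hq.fst.precomp Computable.fst)
        Computable.snd))
  have hL' : RC (basOf (polyOf ν) (polyOf ν)) fun x => ((D x).map fun r =>
      combine (f x).length (basOf ν (polyOf ν) (F x)) r.1).map fun r => (r.1.map Polynomial.C, r.2) := by
    refine hL.list_map (ψ := fun x r => (r.1.map (Polynomial.C : R →+* R[X]), r.2)) ?_
    have hq : RC (Prod.map (List.map ν) (polyOf ν)) fun q : Ω × (List C × List C) =>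
      Prod.map (List.map ν) (polyOf ν) q.2 := RC.code Computable.snd
    exact (hq.fst.list_map (ψ := fun _ r => Polynomial.C r) (hc.rc_C (RC.code Computable.snd))).prod hq.snd
  obtain ⟨S, hS, hS'⟩ := hL'
  refine ⟨S, hS, fun l m hl => ?_⟩
  have h2 := hS' (l, m)
  beta_reduce at h2
  have hx : ∃ y ∈ a (l, m), y ≠ 0 := by
    obtain ⟨y, hy, hy0⟩ := hl
    exact ⟨_, List.mem_map.2 ⟨y, hy, rfl⟩, hy0⟩
  have h3 := hF' (l, m) hx
  rw [Nat.sub_self] at h3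
  have hD'' := hD' (l, m)
  rw [List.length_map] at hD''
  have h4 := h3.isBas (fun c hcc g hg => hN l m hl c hcc g hg) (hD''.congr fun y g _ => by
    have h6 := sum_range_getD_map (basOf ν (polyOf ν) (F (l, m))) (residual σ β (a (l, m)) (f (l, m)))
      ([], 0) 0 fun k q => Polynomial.C (y k) * q
    rw [List.length_map (residual σ β (a (l, m)) (f (l, m)))] at h6
    rw [h6])
  have h5 := h4.toPoly hK
  rw [← h2] at h5
  have hlen : (f (l, m)).length = m.length := List.length_map _
  rw [hlen] at h5
  exact h5

end BoundedSolver

/-! ### Finiteness of the set of defective degrees -/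

section Finiteness

variable {W : Type*} [Field W]

/-- A degree function on a difference field, for which differences lower the degree by at most one. -/
structure DegreeFunction (τ : W ≃+* W) (deg : W → ℤ) : Prop where
  mul : ∀ x y, x ≠ 0 → y ≠ 0 → deg (x * y) = deg x + deg y
  add_le : ∀ x y k, (x ≠ 0 → deg x ≤ k) → (y ≠ 0 → deg y ≤ k) → x + y ≠ 0 → deg (x + y) ≤ k
  neg : ∀ x, deg (-x) = deg x
  map : ∀ x, x ≠ 0 → deg (τ x) = deg x
  diff : ∀ y, y ≠ 0 → deg y ≠ 0 → τ y - y ≠ 0 ∧ deg y - 1 ≤ deg (τ y - y)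

/-- The degree of `x` is at most `k`. -/
def DegLE (deg : W → ℤ) (k : ℤ) (x : W) : Prop := x ≠ 0 → deg x ≤ k

namespace DegreeFunction

variable {τ : W ≃+* W} {deg : W → ℤ} (hd : DegreeFunction τ deg)
include hd

theorem le_add {k : ℤ} {x y : W} (hx : DegLE deg k x) (hy : DegLE deg k y) : DegLE deg k (x + y) :=
  hd.add_le x y k hx hy

theorem le_neg {k : ℤ} {x : W} (hx : DegLE deg k x) : DegLE deg k (-x) := fun h => by
  rw [hd.neg]; exact hx (neg_ne_zero.1 h)

theorem le_sub {k : ℤ} {x y : W} (hx : DegLE deg k x) (hy : DegLE deg k y) : DegLE deg k (x - y) := by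
  rw [sub_eq_add_neg]; exact hd.le_add hx (hd.le_neg hy)

theorem le_mul {k l : ℤ} {x y : W} (hx : DegLE deg k x) (hy : DegLE deg l y) : DegLE deg (k + l) (x * y) := by
  intro h
  have h1 := left_ne_zero_of_mul h
  have h2 := right_ne_zero_of_mul h
  rw [hd.mul x y h1 h2]
  exact add_le_add (hx h1) (hy h2)

theorem le_sum {k : ℤ} {s : Finset ℕ} {x : ℕ → W} (hx : ∀ i ∈ s, DegLE deg k (x i)) :
    DegLE deg k (∑ i ∈ s, x i) :=
  Finset.sum_induction x (DegLE deg k) (fun _ _ => hd.le_add) (fun h => (h rfl).elim) hx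

theorem iterate {x : W} (hx : x ≠ 0) (i : ℕ) : (⇑τ)^[i] x ≠ 0 ∧ deg ((⇑τ)^[i] x) = deg x := by
  induction i with
  | zero => exact ⟨hx, rfl⟩
  | succ i ih =>
    rw [Function.iterate_succ_apply']
    exact ⟨(map_ne_zero_iff τ τ.injective).2 ih.1, (hd.map _ ih.1).trans ih.2⟩

end DegreeFunction

theorem iterate_eq_add_sum (τ : W ≃+* W) (y : W) (i : ℕ) :
    (⇑τ)^[i] y = y + ∑ j ∈ Finset.range i, (⇑τ)^[j] (τ y - y) := by
  induction i with
  | zero => simp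
  | succ i ih =>
    rw [Finset.sum_range_succ, ← add_assoc, ← ih, iterate_map_sub, ← Function.iterate_succ_apply]
    ring

/-- Summation by parts. The tail sums on the right become the coefficients of the operator of
smaller order in the reduction of order. -/
theorem sum_mul_sum_range (A x : ℕ → W) (M : ℕ) :
    ∑ i ∈ Finset.range (M + 1), A i * ∑ j ∈ Finset.range i, x j =
      ∑ j ∈ Finset.range M, (∑ i ∈ Finset.Ico (j + 1) (M + 1), A i) * x j := by
  induction M with
  | zero => simp
  | succ M ih =>
    rw [Finset.sum_range_succ, ih, Finset.sum_range_succ (fun j => (∑ i ∈ Finset.Ico (j + 1) _, A i) * x j),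
      Finset.sum_range_succ x, mul_add, ← add_assoc]
    congr 1
    · rw [Finset.mul_sum, ← Finset.sum_add_distrib]
      refine Finset.sum_congr rfl fun j hj => ?_
      rw [Finset.mem_range] at hj
      rw [Finset.sum_Ico_succ_top (show j + 1 ≤ M + 1 by omega) A, add_mul]
    · simp

/-- An operator with `M` coefficients lowers the degree by `M` or more (relative to its generic behaviour)
only in finitely many degrees. -/
theorem finite_defective_degrees {τ : W ≃+* W} {deg : W → ℤ} (hd : DegreeFunction τ deg) (M : ℕ) :
    ∀ (a : ℕ → W) (p : ℤ), (∀ i < M, DegLE deg p (a i)) → (∃ i < M, a i ≠ 0 ∧ deg (a i) = p) →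
      {n : ℤ | ∃ g, g ≠ 0 ∧ deg g = n ∧
        DegLE deg (n + p - M) (∑ i ∈ Finset.range M, a i * (⇑τ)^[i] g)}.Finite := by
  induction M with
  | zero => rintro a p - ⟨i, hi, -⟩; omega
  | succ M ih =>
    intro a p ha hp
    set S := {n : ℤ | ∃ g, g ≠ 0 ∧ deg g = n ∧
        DegLE deg (n + p - (M + 1 : ℕ)) (∑ i ∈ Finset.range (M + 1), a i * (⇑τ)^[i] g)} with hS
    rcases S.eq_empty_or_nonempty with hne | ⟨n₀, g₀, hg₀, hn₀, hL₀⟩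
    · rw [hne]; exact Set.finite_empty
    -- Reduction of order along a fixed defective g₀: for g = g₀y the difference L(g) - L(g₀)y is
    -- the operator with coefficients `b` applied to τ(y) - y.
    let A : ℕ → W := fun i => a i * (⇑τ)^[i] g₀
    let b : ℕ → W := fun j => ∑ i ∈ Finset.Ico (j + 1) (M + 1), A i
    have hA : ∀ i < M + 1, DegLE deg (p + n₀) (A i) := fun i hi =>
      hd.le_mul (ha i hi) fun _ => ((hd.iterate hg₀ i).2.trans hn₀).le
    have hb : ∀ j < M, DegLE deg (p + n₀) (b j) := fun j _ =>
      hd.le_sum fun i hi => hA i (Finset.mem_Ico.1 hi).2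
    -- The coefficients `b` attain the maximal degree. Otherwise all A_i would have smaller degree,
    -- since A_(i+1) = b_i - b_(i+1) and A_0 = L(g₀) - b_0, where L(g₀) has small degree; but some
    -- a_i has degree exactly p.
    have hbp : ∃ j < M, b j ≠ 0 ∧ deg (b j) = p + n₀ := by
      by_contra hcon
      push Not at hcon
      have hb1 : ∀ j < M + 1, DegLE deg (p + n₀ - 1) (b j) := by
        intro j hj
        rcases Nat.lt_succ_iff_lt_or_eq.1 hj with hj | rfl
        · intro h0
          have h1 := hb j hj h0
          have h2 := hcon j hj h0
          omega
        · intro h0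
          simp [b] at h0
      have hA1 : ∀ i < M + 1, DegLE deg (p + n₀ - 1) (A i) := by
        rintro (_ | i) hi
        · have h1 : A 0 = ∑ i ∈ Finset.range (M + 1), A i - b 0 := by
            simp only [b]
            rw [Finset.range_eq_Ico, Finset.sum_eq_sum_Ico_succ_bot (by omega)]
            ring
          rw [h1]
          refine hd.le_sub (fun h0 => (hL₀ h0).trans ?_) (hb1 0 hi)
          push_cast
          omega
        · have h1 : A (i + 1) = b i - b (i + 1) := by
            simp only [b]
            rw [Finset.sum_eq_sum_Ico_succ_bot (by omega)]
            ring
          rw [h1]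
          exact hd.le_sub (hb1 i (by omega)) (hb1 (i + 1) hi)
      obtain ⟨i, hi, hai, hpi⟩ := hp
      have h1 := (hd.iterate hg₀ i)
      have h2 := hA1 i hi (mul_ne_zero hai h1.1)
      rw [hd.mul _ _ hai h1.1, hpi, h1.2, hn₀] at h2
      omega
    have hfin := ih b (p + n₀) hb hbp
    refine ((hfin.image (· + n₀)).union ((hfin.image (· + (n₀ + 1))).union (Set.finite_singleton n₀))).subset ?_
    rintro n ⟨g, hg, hn, hL⟩
    -- If n = n₀ then y has degree 0, and its difference could vanish or drop arbitrarily far in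
    -- degree. This one degree is simply added to the finite set.
    by_cases hnn : n = n₀
    · right; right; exact hnn
    let y := g / g₀
    have hy : y ≠ 0 := div_ne_zero hg hg₀
    have hgy : g = g₀ * y := (mul_div_cancel₀ g hg₀).symm
    have hdy : deg y = n - n₀ := by
      have := hd.mul g₀ y hg₀ hy
      rw [← hgy, hn, hn₀] at this
      omega
    obtain ⟨hz, hz1⟩ := hd.diff y hy (by omega)
    have hz2 : deg (τ y - y) ≤ n - n₀ := hd.le_sub (k := n - n₀) (fun _ => by rw [hd.map y hy, hdy])
      (fun _ => hdy.le) hz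
    have hop : ∑ j ∈ Finset.range M, b j * (⇑τ)^[j] (τ y - y) =
        ∑ i ∈ Finset.range (M + 1), a i * (⇑τ)^[i] g -
          (∑ i ∈ Finset.range (M + 1), a i * (⇑τ)^[i] g₀) * y := by
      rw [← sum_mul_sum_range, Finset.sum_mul, ← Finset.sum_sub_distrib]
      refine Finset.sum_congr rfl fun i _ => ?_
      rw [hgy, iterate_map_mul]
      have := iterate_eq_add_sum τ y i
      simp only [A]
      rw [this]
      ring
    have hmem : ∀ n', deg (τ y - y) = n' → n' ∈ {n : ℤ | ∃ g, g ≠ 0 ∧ deg g = n ∧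
        DegLE deg (n + (p + n₀) - M) (∑ i ∈ Finset.range M, b i * (⇑τ)^[i] g)} := by
      intro n' hn'
      refine ⟨_, hz, hn', ?_⟩
      rw [hop]
      refine hd.le_sub (fun h0 => (hL h0).trans ?_) (fun h0 => (hd.le_mul hL₀ (fun _ => hdy.le) h0).trans ?_)
      · push_cast; omega
      · push_cast; omega
    -- The difference has the degree of y or one less, so n is one of two translates of a defective
    -- degree of the smaller operator.
    rcases (by omega : deg (τ y - y) = n - n₀ ∨ deg (τ y - y) = n - n₀ - 1) with h | h
    · left; exact ⟨n - n₀, hmem _ h, by ring⟩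
    · right; left; exact ⟨n - n₀ - 1, hmem _ h, by ring⟩

variable {Q : Type*} [Field Q] [CharZero Q]

theorem polyAut_injective {R : Type*} [CommRing R] (σ : R ≃+* R) (β : R) :
    Function.Injective (polyAut σ β) := (polyAut σ β).injective

theorem natDegree_polyAut {R : Type*} [CommRing R] (σ : R ≃+* R) (β : R) (g : R[X]) :
    (polyAut σ β g).natDegree = g.natDegree := by
  refine le_antisymm (natDegree_iterate_polyAut_le σ β 1 le_rfl) ?_
  by_cases h : g = 0
  · simp [h]
  · refine le_natDegree_of_ne_zero ?_
    rw [show polyAut σ β g = (⇑(polyAut σ β))^[1] g from rfl, coeff_iterate_polyAut_top σ β 1 le_rfl]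
    simpa using h

theorem leadingCoeff_polyAut {R : Type*} [CommRing R] (σ : R ≃+* R) (β : R) (g : R[X]) :
    (polyAut σ β g).leadingCoeff = σ g.leadingCoeff := by
  rw [leadingCoeff, natDegree_polyAut]
  exact coeff_iterate_polyAut_top σ β 1 le_rfl

/-- For a monic polynomial of degree N, the only contribution of the shift to the second coefficient
is Nβ, from the leading term. In characteristic 0 this turns coincidences of second coefficients
into solutions of σ(h) - h = β. -/
theorem nextCoeff_polyAut {R : Type*} [CommRing R] (σ : R ≃+* R) (β : R) {g : R[X]} (hg : g.Monic) :
    (polyAut σ β g).nextCoeff = σ g.nextCoeff + g.natDegree * β := by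
  rcases Nat.eq_zero_or_pos g.natDegree with h | h
  · rw [nextCoeff, nextCoeff, natDegree_polyAut, if_pos h, if_pos h]
    simp [h]
  · rw [nextCoeff_of_natDegree_pos (by rwa [natDegree_polyAut]), nextCoeff_of_natDegree_pos h,
      natDegree_polyAut]
    have := coeff_iterate_polyAut σ β 1 (le_refl g.natDegree) (g.natDegree - 1)
    rw [Function.iterate_one] at this
    rw [this, Finset.sum_range_succ, ]
    obtain ⟨m, hm⟩ : ∃ m, g.natDegree = m + 1 := ⟨_, (Nat.succ_pred_eq_of_pos h).symm⟩
    have hlead : g.coeff (m + 1) = 1 := by rw [← hm]; exact hg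
    rw [hm, Nat.add_sub_cancel, Finset.sum_eq_single m, hlead, Function.iterate_one, Nat.sub_self, Nat.choose_self,
      Nat.add_sub_cancel_left, Nat.choose_succ_self_right, iterShift, Finset.sum_range_one, Function.iterate_zero,
      id, map_one]
    · push_cast; ring
    · intro N hN hne
      rw [Finset.mem_range] at hN
      rw [Nat.choose_eq_zero_of_lt (by omega), Nat.cast_zero, mul_zero, mul_zero]
    · simp

/-- The degree of a Wronskian. -/
theorem le_natDegree_wronskian {σ : Q ≃+* Q} {β : Q} (hβ : ∀ h : Q, σ h - h ≠ β) {f g : Q[X]} (hf : f ≠ 0)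
    (hg : g ≠ 0) (hfg : f.natDegree ≠ g.natDegree) :
    polyAut σ β f * g - f * polyAut σ β g ≠ 0 ∧
      f.natDegree + g.natDegree ≤ (polyAut σ β f * g - f * polyAut σ β g).natDegree + 1 := by
  suffices ∃ k, f.natDegree + g.natDegree ≤ k + 1 ∧
      (polyAut σ β f * g - f * polyAut σ β g).coeff k ≠ 0 by
    obtain ⟨k, hk, h0⟩ := this
    refine ⟨fun h => h0 (by rw [h, coeff_zero]), hk.trans (Nat.succ_le_succ (le_natDegree_of_ne_zero h0))⟩
  -- Either the leading coefficients do not cancel and the degree is the full sum, or f and g can be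
  -- made monic simultaneously and the next coefficient decides.
  by_cases hlead : σ f.leadingCoeff * g.leadingCoeff = f.leadingCoeff * σ g.leadingCoeff
  · let F := Polynomial.C f.leadingCoeff⁻¹ * f
    let G := Polynomial.C g.leadingCoeff⁻¹ * g
    have hf0 := leadingCoeff_ne_zero.2 hf
    have hg0 := leadingCoeff_ne_zero.2 hg
    have hF : F.Monic := monic_C_mul_of_mul_leadingCoeff_eq_one (inv_mul_cancel₀ hf0)
    have hG : G.Monic := monic_C_mul_of_mul_leadingCoeff_eq_one (inv_mul_cancel₀ hg0)
    have hfF : f = Polynomial.C f.leadingCoeff * F := by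
      rw [← mul_assoc, ← map_mul, mul_inv_cancel₀ hf0, map_one, one_mul]
    have hgG : g = Polynomial.C g.leadingCoeff * G := by
      rw [← mul_assoc, ← map_mul, mul_inv_cancel₀ hg0, map_one, one_mul]
    have hFd : F.natDegree = f.natDegree := natDegree_C_mul (inv_ne_zero hf0)
    have hGd : G.natDegree = g.natDegree := natDegree_C_mul (inv_ne_zero hg0)
    have hσF : (polyAut σ β F).Monic := by
      rw [Monic, leadingCoeff_polyAut, hF, map_one]
    have hσG : (polyAut σ β G).Monic := by
      rw [Monic, leadingCoeff_polyAut, hG, map_one]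
    have hw : polyAut σ β f * g - f * polyAut σ β g =
        Polynomial.C (f.leadingCoeff * σ g.leadingCoeff) * (polyAut σ β F * G - F * polyAut σ β G) := by
      conv_lhs => rw [hfF, hgG]
      have h := congrArg Polynomial.C hlead
      simp only [map_mul] at h
      simp only [map_mul, polyAut_C]
      linear_combination (polyAut σ β F * G) * h
    refine ⟨f.natDegree + g.natDegree - 1, by omega, ?_⟩
    rw [hw, coeff_C_mul]
    refine mul_ne_zero (mul_ne_zero hf0 ((map_ne_zero_iff σ σ.injective).2 hg0)) ?_
    have h1 : (polyAut σ β F * G).nextCoeff = σ F.nextCoeff + F.natDegree * β + G.nextCoeff := by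
      rw [hσF.nextCoeff_mul hG, nextCoeff_polyAut σ β hF]
    have h2 : (F * polyAut σ β G).nextCoeff = F.nextCoeff + (σ G.nextCoeff + G.natDegree * β) := by
      rw [hF.nextCoeff_mul hσG, nextCoeff_polyAut σ β hG]
    have hd1 : (polyAut σ β F * G).natDegree = f.natDegree + g.natDegree := by
      rw [hσF.natDegree_mul hG, natDegree_polyAut, hFd, hGd]
    have hd2 : (F * polyAut σ β G).natDegree = f.natDegree + g.natDegree := by
      rw [hF.natDegree_mul hσG, natDegree_polyAut, hFd, hGd]
    rw [nextCoeff_of_natDegree_pos (by omega), hd1] at h1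
    rw [nextCoeff_of_natDegree_pos (by omega), hd2] at h2
    rw [coeff_sub, h1, h2, hFd, hGd]
    have hc : ((f.natDegree : Q) - g.natDegree) ≠ 0 := sub_ne_zero.2 (by exact_mod_cast hfg)
    intro h0
    have hσc : σ ((f.natDegree : Q) - g.natDegree) = f.natDegree - g.natDegree := by
      rw [map_sub, map_natCast, map_natCast]
    -- A vanishing second coefficient would read (σ - 1)(G' - F') = (deg f - deg g)β, with F', G'
    -- the second coefficients of `F` and `G`. Division by the nonzero integer deg f - deg g, a
    -- constant, contradicts the choice of β.
    refine hβ ((G.nextCoeff - F.nextCoeff) / (f.natDegree - g.natDegree)) ?_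
    rw [map_div₀, hσc, ← sub_div, div_eq_iff hc, map_sub]
    linear_combination -h0
  · refine ⟨f.natDegree + g.natDegree, by omega, ?_⟩
    have h1 := coeff_mul_degree_add_degree (polyAut σ β f) g
    have h2 := coeff_mul_degree_add_degree f (polyAut σ β g)
    rw [natDegree_polyAut] at h1 h2
    rw [coeff_sub, h1, h2, leadingCoeff_polyAut, leadingCoeff_polyAut]
    exact sub_ne_zero.2 hlead

/-- The extension of an automorphism to the field of fractions. -/
noncomputable def fracAut {B K : Type*} [CommRing B] [Field K] [Algebra B K] [IsFractionRing B K]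
    (σ : B ≃+* B) : K ≃+* K := IsFractionRing.ringEquivOfRingEquiv σ

theorem fracAut_algebraMap {B K : Type*} [CommRing B] [Field K] [Algebra B K] [IsFractionRing B K]
    (σ : B ≃+* B) (x : B) : fracAut σ (algebraMap B K x) = algebraMap B K (σ x) :=
  IsFractionRing.ringEquivOfRingEquiv_algebraMap σ x

/-- Only the behaviour of differences needs an argument. For y = f/g the numerator of τ(y) - y is
the Wronskian-like expression of `le_natDegree_wronskian`, over the denominator σ(g)g of degree 2
deg g. -/
theorem degreeFunction_intDegree {σ : Q ≃+* Q} {β : Q} (hβ : ∀ h : Q, σ h - h ≠ β) :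
    DegreeFunction (fracAut (polyAut σ β) : RatFunc Q ≃+* RatFunc Q) RatFunc.intDegree := by
  have hrep : ∀ y : RatFunc Q, y ≠ 0 → ∃ f g : Q[X], f ≠ 0 ∧ g ≠ 0 ∧
      y = algebraMap Q[X] (RatFunc Q) f / algebraMap Q[X] (RatFunc Q) g := by
    intro y hy
    exact ⟨y.num, y.denom, RatFunc.num_ne_zero hy, y.denom_ne_zero, (RatFunc.num_div_denom y).symm⟩
  have h0 : ∀ {f : Q[X]}, f ≠ 0 → algebraMap Q[X] (RatFunc Q) f ≠ 0 := fun hf =>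
    RatFunc.algebraMap_ne_zero hf
  have hσ : ∀ {f : Q[X]}, f ≠ 0 → polyAut σ β f ≠ 0 := fun hf =>
    (map_ne_zero_iff _ (polyAut_injective σ β)).2 hf
  have hdeg : ∀ {f g : Q[X]}, f ≠ 0 → g ≠ 0 →
      (algebraMap Q[X] (RatFunc Q) f / algebraMap Q[X] (RatFunc Q) g).intDegree = f.natDegree - g.natDegree := by
    intro f g hf hg
    rw [RatFunc.intDegree_div (h0 hf) (h0 hg), RatFunc.intDegree_polynomial, RatFunc.intDegree_polynomial]
  refine ⟨fun x y => RatFunc.intDegree_mul, ?_, RatFunc.intDegree_neg, ?_, ?_⟩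
  · intro x y k hx hy hxy
    by_cases hy0 : y = 0
    · subst hy0
      rw [add_zero] at hxy ⊢
      exact hx hxy
    by_cases hx0 : x = 0
    · subst hx0
      rw [zero_add]
      exact hy hy0
    exact (RatFunc.intDegree_add_le hy0 hxy).trans (max_le (hx hx0) (hy hy0))
  · intro y hy
    obtain ⟨f, g, hf, hg, rfl⟩ := hrep y hy
    rw [map_div₀, fracAut_algebraMap, fracAut_algebraMap, hdeg (hσ hf) (hσ hg), hdeg hf hg,
      natDegree_polyAut, natDegree_polyAut]
  · intro y hy hy0
    obtain ⟨f, g, hf, hg, rfl⟩ := hrep y hy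
    rw [hdeg hf hg] at hy0
    obtain ⟨h1, h2⟩ := le_natDegree_wronskian hβ hf hg (by omega)
    have h3 : fracAut (polyAut σ β) (algebraMap Q[X] (RatFunc Q) f / algebraMap Q[X] (RatFunc Q) g) -
        algebraMap Q[X] (RatFunc Q) f / algebraMap Q[X] (RatFunc Q) g =
        algebraMap Q[X] (RatFunc Q) (polyAut σ β f * g - f * polyAut σ β g) /
          algebraMap Q[X] (RatFunc Q) (polyAut σ β g * g) := by
      have hg1 := h0 hg
      have hg2 := h0 (hσ hg)
      rw [map_div₀, fracAut_algebraMap, fracAut_algebraMap, map_sub, map_mul, map_mul, map_mul]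
      field_simp
    have h4 : polyAut σ β g * g ≠ 0 := mul_ne_zero (hσ hg) hg
    rw [h3, hdeg h1 h4, hdeg hf hg, natDegree_mul (hσ hg) hg, natDegree_polyAut]
    refine ⟨div_ne_zero (h0 h1) (h0 h4), ?_⟩
    push_cast
    omega

/-- The hypothesis is the same statement with denominators cleared, so that it can be phrased inside
R. -/
theorem fracAut_sub_ne {R : Type*} [CommRing R] [IsDomain R] {σ : R ≃+* R} {β : R}
    (hβ : ∀ p q : R, q ≠ 0 → σ p * q - p * σ q ≠ β * q * σ q)
    (x : FractionRing R) : fracAut σ x - x ≠ algebraMap R _ β := by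
  obtain ⟨p, q, hq, rfl⟩ := IsFractionRing.div_surjective (A := R) x
  have hq0 := nonZeroDivisors.ne_zero hq
  have hinj := IsFractionRing.injective R (FractionRing R)
  have h1 : algebraMap R (FractionRing R) q ≠ 0 := (map_ne_zero_iff _ hinj).2 hq0
  have h2 : algebraMap R (FractionRing R) (σ q) ≠ 0 := (map_ne_zero_iff _ hinj).2
    ((map_ne_zero_iff σ σ.injective).2 hq0)
  intro hx
  refine hβ p q hq0 (hinj ?_)
  rw [map_div₀, fracAut_algebraMap, fracAut_algebraMap, div_sub_div _ _ h2 h1,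
    div_eq_iff (mul_ne_zero h2 h1)] at hx
  simp only [map_sub, map_mul]
  linear_combination hx

theorem map_polyAut_algebraMap {R : Type*} [CommRing R] [IsDomain R] (σ : R ≃+* R) (β : R) (g : R[X]) :
    (polyAut σ β g).map (algebraMap R (FractionRing R)) =
      polyAut (fracAut σ) (algebraMap R _ β) (g.map (algebraMap R (FractionRing R))) := by
  have : (mapRingHom (algebraMap R (FractionRing R))).comp (polyAut σ β : R[X] →+* R[X]) =
      (polyAut (fracAut σ) (algebraMap R (FractionRing R) β) : (FractionRing R)[X] →+* (FractionRing R)[X]).comp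
        (mapRingHom (algebraMap R (FractionRing R))) := by
    apply Polynomial.ringHom_ext
    · intro r
      simp [polyAut_C, fracAut_algebraMap]
    · simp [polyAut_X]
  exact RingHom.congr_fun this g

/-- Only finitely many degrees are defective for an operator with coefficients in `R[X]`. -/
theorem finite_defective_natDegrees {R : Type*} [CommRing R] [IsDomain R] [CharZero R] {σ : R ≃+* R} {β : R}
    (hβ : ∀ p q : R, q ≠ 0 → σ p * q - p * σ q ≠ β * q * σ q) {a : List R[X]} {p : ℕ}
    (ha : ∀ x ∈ a, x.natDegree ≤ p) (hp : ∃ x ∈ a, x.coeff p ≠ 0) :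
    {n : ℕ | ∃ g : R[X], g ≠ 0 ∧ g.natDegree = n ∧
      ∀ i, n + p < i + a.length → (diffOp (polyAut σ β) a g).coeff i = 0}.Finite := by
  let Q := FractionRing R
  have : CharZero Q := IsFractionRing.charZero_of_isFractionRing R
  let σQ : Q ≃+* Q := fracAut σ
  let βQ : Q := algebraMap R Q β
  have hβQ : ∀ h : Q, σQ h - h ≠ βQ := fracAut_sub_ne hβ
  have hd := degreeFunction_intDegree hβQ
  -- Reduction of order divides by g₀, so the operator is moved to the rational functions over the
  -- field of fractions of R. This embedding preserves degrees and commutes with the automorphisms.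
  let ι : R[X] →+* RatFunc Q := (algebraMap Q[X] (RatFunc Q)).comp (mapRingHom (algebraMap R Q))
  have hinj : Function.Injective (mapRingHom (algebraMap R Q)) :=
    map_injective _ (IsFractionRing.injective R Q)
  have hι : Function.Injective ι := (RatFunc.algebraMap_injective Q).comp hinj
  have hιd : ∀ g : R[X], (ι g).intDegree = g.natDegree := fun g => by
    simp only [ι, RingHom.comp_apply, RatFunc.intDegree_polynomial, coe_mapRingHom]
    rw [natDegree_map_eq_of_injective (IsFractionRing.injective R Q)]
  have hισ : ∀ g : R[X], ι (polyAut σ β g) = fracAut (polyAut σQ βQ) (ι g) := by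
    intro g
    simp only [ι, RingHom.comp_apply, fracAut_algebraMap, coe_mapRingHom]
    rw [map_polyAut_algebraMap]
  have hισi : ∀ i (g : R[X]), ι ((⇑(polyAut σ β))^[i] g) = (⇑(fracAut (polyAut σQ βQ)))^[i] (ι g) := by
    intro i g
    induction i with
    | zero => rfl
    | succ i ih => rw [Function.iterate_succ_apply', Function.iterate_succ_apply', hισ, ih]
  have hmem : ∀ i < a.length, a.getD i 0 ∈ a := fun i hi => by
    rw [List.getD_eq_getElem _ _ hi]; exact List.getElem_mem hi
  have hfin := finite_defective_degrees hd a.length (fun i => ι (a.getD i 0)) p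
    (fun i hi _ => by rw [hιd]; exact_mod_cast ha _ (hmem i hi)) (by
      obtain ⟨x, hx, hx0⟩ := hp
      obtain ⟨i, hi, rfl⟩ := List.getElem_of_mem hx
      refine ⟨i, hi, ?_, ?_⟩
      · rw [List.getD_eq_getElem _ _ hi]
        refine (map_ne_zero_iff ι hι).2 fun h => hx0 (by rw [h, coeff_zero])
      · rw [hιd, List.getD_eq_getElem _ _ hi]
        exact_mod_cast le_antisymm (ha _ (List.getElem_mem hi)) (le_natDegree_of_ne_zero hx0))
  refine (hfin.preimage (f := fun n : ℕ => (n : ℤ)) Nat.cast_injective.injOn).subset ?_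
  rintro n ⟨g, hg, hn, hL⟩
  refine ⟨ι g, (map_ne_zero_iff ι hι).2 hg, by rw [hιd, hn], ?_⟩
  have hop : ∑ i ∈ Finset.range a.length, ι (a.getD i 0) * (⇑(fracAut (polyAut σQ βQ)))^[i] (ι g) =
      ι (diffOp (polyAut σ β) a g) := by
    simp only [diffOp, map_sum, map_mul, hισi]
  rw [hop]
  intro h0
  rw [hιd]
  have h1 : diffOp (polyAut σ β) a g ≠ 0 := fun h => h0 (by rw [h, map_zero])
  by_contra hlt
  push Not at hlt
  refine leadingCoeff_ne_zero.2 h1 (hL _ ?_)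
  omega

end Finiteness

/-! ### The top coefficients of L(g) for an undetermined degree n -/

section Levels

variable {R : Type*} [CommRing R]

/-- The contribution of a coefficient `b` to the coefficient `j` degrees below the top of a difference
operator of degree `p`, up to the binomial coefficient of weight `q`. -/
noncomputable def levelTerm (σ : R ≃+* R) (β : R) (a : List R[X]) (p j q : ℕ) (b : R) : R :=
  ∑ s ∈ Finset.range a.length, iterShift σ β s ^ q * (⇑σ)^[s] b *
    (if j ≤ p + q then (a.getD s 0).coeff (p + q - j) else 0)

/-- The coefficient `l` degrees below the top of the image of `∑ i, g i * X ^ (n - i)` under a difference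
operator of degree `p`. -/
noncomputable def levelEq (σ : R ≃+* R) (β : R) (a : List R[X]) (p n l : ℕ) (g : ℕ → R) : R :=
  ∑ i ∈ Finset.range (l + 1), ∑ q ∈ Finset.range (l + 1),
    ((n - i).choose q : R) * levelTerm σ β a p (l - i) q (g i)

theorem coeff_getD_eq_zero {a : List R[X]} {p : ℕ} (ha : ∀ x ∈ a, x.natDegree ≤ p) (s : ℕ) {k : ℕ} (hk : p < k) :
    (a.getD s 0).coeff k = 0 := by
  rcases getD_mem_or a s 0 with h | h
  · exact coeff_eq_zero_of_natDegree_lt ((ha _ h).trans_lt hk)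
  · rw [h, coeff_zero]

theorem levelTerm_eq_zero (σ : R ≃+* R) (β : R) {a : List R[X]} {p : ℕ} (ha : ∀ x ∈ a, x.natDegree ≤ p)
    {j q : ℕ} (h : j < q) (b : R) : levelTerm σ β a p j q b = 0 :=
  Finset.sum_eq_zero fun s _ => by
    rw [if_pos (by omega), coeff_getD_eq_zero ha s (by omega), mul_zero]

/-- The binomial expansion of (X + shift)^N, sorted by the power q of the shift. Terms with q > j
would need a coefficient of the operator beyond degree p and drop out, so the number of terms
depends only on the level j and not on N. -/
theorem coeff_diffOp_monomial (σ : R ≃+* R) (β : R) {a : List R[X]} {p : ℕ} (ha : ∀ x ∈ a, x.natDegree ≤ p)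
    {N m j : ℕ} (hj : j ≤ N) (hm : m + j = N + p) (b : R) :
    (diffOp (polyAut σ β) a (monomial N b)).coeff m =
      ∑ q ∈ Finset.range (j + 1), (N.choose q : R) * levelTerm σ β a p j q b := by
  simp only [diffOp, finsetSum_coeff, levelTerm, Finset.mul_sum]
  rw [Finset.sum_comm]
  refine Finset.sum_congr rfl fun s _ => ?_
  rw [← C_mul_X_pow_eq_monomial, iterate_map_mul, iterate_map_pow, iterate_polyAut_C, iterate_polyAut_X,
    add_comm X, add_pow, Finset.mul_sum, Finset.mul_sum, finsetSum_coeff]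
  refine Eq.symm (Finset.sum_subset_zero_on_sdiff (Finset.range_mono (by omega)) ?_ ?_)
  · intro q hq
    rw [Finset.mem_sdiff, Finset.mem_range, Finset.mem_range] at hq
    rw [show a.getD s 0 * (Polynomial.C ((⇑σ)^[s] b) * (Polynomial.C (iterShift σ β s) ^ q * X ^ (N - q) *
      (N.choose q : R[X]))) = Polynomial.C ((⇑σ)^[s] b * iterShift σ β s ^ q * (N.choose q : R)) *
        (a.getD s 0 * X ^ (N - q)) by simp only [map_mul, map_pow, map_natCast]; ring, coeff_C_mul,
      coeff_mul_X_pow', if_pos (by omega), coeff_getD_eq_zero ha s (by omega), mul_zero]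
  · intro q hq
    rw [Finset.mem_range] at hq
    rw [show a.getD s 0 * (Polynomial.C ((⇑σ)^[s] b) * (Polynomial.C (iterShift σ β s) ^ q * X ^ (N - q) *
      (N.choose q : R[X]))) = Polynomial.C ((⇑σ)^[s] b * iterShift σ β s ^ q * (N.choose q : R)) *
        (a.getD s 0 * X ^ (N - q)) by simp only [map_mul, map_pow, map_natCast]; ring, coeff_C_mul,
      coeff_mul_X_pow']
    by_cases hjp : j ≤ p + q
    · rw [if_pos hjp, if_pos (by omega), show m - (N - q) = p + q - j by omega]
      ring
    · rw [if_neg hjp, if_neg (by omega)]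
      ring

theorem coeff_diffOp_eq_zero (σ : R ≃+* R) (β : R) {a : List R[X]} {p : ℕ} (ha : ∀ x ∈ a, x.natDegree ≤ p)
    {g : R[X]} {n m : ℕ} (hg : g.natDegree ≤ n) (hm : n + p < m) :
    (diffOp (polyAut σ β) a g).coeff m = 0 := by
  simp only [diffOp, finsetSum_coeff]
  refine Finset.sum_eq_zero fun s _ => coeff_eq_zero_of_natDegree_lt (natDegree_mul_le.trans_lt ?_)
  have h1 := natDegree_iterate_polyAut_le σ β s hg
  have h2 : (a.getD s 0).natDegree ≤ p := by
    rcases getD_mem_or a s 0 with h | h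
    · exact ha _ h
    · rw [h]; simp
  omega

theorem diffOp_sum (τ : R ≃+* R) (a : List R) (s : Finset ℕ) (h : ℕ → R) :
    diffOp τ a (∑ k ∈ s, h k) = ∑ k ∈ s, diffOp τ a (h k) := by
  simpa using diffOp_sum_mul τ a (s := s) (y := fun _ => 1) (fun _ => map_one τ) h

theorem coeff_diffOp_sum_monomial (σ : R ≃+* R) (β : R) {a : List R[X]} {p : ℕ} (ha : ∀ x ∈ a, x.natDegree ≤ p)
    {n l : ℕ} (hl : l ≤ n) (g : ℕ → R) :
    (diffOp (polyAut σ β) a (∑ i ∈ Finset.range (n + 1), monomial (n - i) (g i))).coeff (n + p - l) =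
      levelEq σ β a p n l g := by
  rw [diffOp_sum, finsetSum_coeff, levelEq]
  refine Eq.symm (Finset.sum_subset_zero_on_sdiff (Finset.range_mono (by omega)) ?_ ?_)
  · intro i hi
    rw [Finset.mem_sdiff, Finset.mem_range, Finset.mem_range] at hi
    exact coeff_diffOp_eq_zero σ β ha (natDegree_monomial_le _) (by omega)
  · intro i hi
    rw [Finset.mem_range] at hi
    rw [coeff_diffOp_monomial σ β ha (j := l - i) (by omega) (by omega)]
    refine (Finset.sum_subset (Finset.range_mono (by omega)) fun q _ hq => ?_).symm
    rw [Finset.mem_range] at hq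
    rw [levelTerm_eq_zero σ β ha (by omega), mul_zero]

theorem sum_monomial_coeff_sub {g : R[X]} {n : ℕ} (hg : g.natDegree ≤ n) :
    ∑ i ∈ Finset.range (n + 1), monomial (n - i) (g.coeff (n - i)) = g := by
  have h := Finset.sum_range_reflect (fun i => monomial i (g.coeff i)) (n + 1)
  rw [Nat.add_sub_cancel] at h
  exact h.trans (as_sum_range' g (n + 1) (by omega)).symm

theorem levelTerm_sum (σ : R ≃+* R) (β : R) (a : List R[X]) (p j q : ℕ) {s : Finset ℕ} {z : ℕ → R}
    (hz : IsConst σ z) (b : ℕ → R) :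
    levelTerm σ β a p j q (∑ u ∈ s, z u * b u) = ∑ u ∈ s, z u * levelTerm σ β a p j q (b u) := by
  have hz' : ∀ k u, (⇑σ)^[k] (z u) = z u := fun k u => Function.iterate_fixed (hz u) k
  have h : ∀ k, (⇑σ)^[k] (∑ u ∈ s, z u * b u) = ∑ u ∈ s, z u * (⇑σ)^[k] (b u) := by
    intro k
    induction k with
    | zero => rfl
    | succ k ih => simp only [Function.iterate_succ_apply', ih, map_sum, map_mul, hz _]
  simp only [levelTerm, h, Finset.mul_sum, Finset.sum_mul]
  rw [Finset.sum_comm]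
  exact Finset.sum_congr rfl fun u _ => Finset.sum_congr rfl fun k _ => by ring

theorem levelTerm_zero_zero (σ : R ≃+* R) (β : R) (a : List R[X]) (p : ℕ) (b : R) :
    levelTerm σ β a p 0 0 b = diffOp σ (a.map fun x => x.coeff p) b := by
  simp only [levelTerm, diffOp, List.length_map]
  refine Finset.sum_congr rfl fun s _ => ?_
  rw [pow_zero, one_mul, if_pos (Nat.zero_le _), mul_comm]
  congr 1
  rw [show (0 : R) = (0 : R[X]).coeff p from (coeff_zero p).symm, List.getD_map]
  rfl

theorem levelTerm_zero (σ : R ≃+* R) (β : R) (a : List R[X]) (p j q : ℕ) :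
    levelTerm σ β a p j q 0 = 0 :=
  Finset.sum_eq_zero fun s _ => by rw [iterate_map_zero, mul_zero, zero_mul]

theorem levelEq_congr (σ : R ≃+* R) (β : R) (a : List R[X]) (p n : ℕ) {l : ℕ} {g g' : ℕ → R}
    (h : ∀ i ≤ l, g i = g' i) : levelEq σ β a p n l g = levelEq σ β a p n l g' :=
  Finset.sum_congr rfl fun i hi => by rw [h i (by rw [Finset.mem_range] at hi; omega)]

/-- Splitting off the top unknown. -/
theorem levelEq_eq_add (σ : R ≃+* R) (β : R) {a : List R[X]} {p : ℕ} (ha : ∀ x ∈ a, x.natDegree ≤ p)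
    (n l : ℕ) (g : ℕ → R) : levelEq σ β a p n l g =
      ∑ i ∈ Finset.range l, ∑ q ∈ Finset.range (l + 1), ((n - i).choose q : R) * levelTerm σ β a p (l - i) q (g i)
        + diffOp σ (a.map fun x => x.coeff p) (g l) := by
  rw [levelEq, Finset.sum_range_succ, Nat.sub_self]
  congr 1
  rw [Finset.sum_eq_single 0, Nat.choose_zero_right, Nat.cast_one, one_mul, levelTerm_zero_zero]
  · intro q _ hq
    rw [levelTerm_eq_zero σ β ha (by omega), mul_zero]
  · simp

/-- The value at level `i` of a combination of generators that are tagged with levels. -/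
def genVal (G : List (ℕ × R)) (z : ℕ → R) (i : ℕ) : R :=
  ∑ u ∈ Finset.range G.length, z u * if (G.getD u (0, 0)).1 = i then (G.getD u (0, 0)).2 else 0

/-- A pair (generator u, binomial weight q) with q ≤ l is encoded as u(l + 1) + q, so that pairs can
index a list of right-hand sides. -/
theorem sum_range_mul_divMod {M : Type*} [AddCommMonoid M] (s l : ℕ) (F : ℕ → ℕ → M) :
    ∑ r ∈ Finset.range (s * (l + 1)), F (r / (l + 1)) (r % (l + 1)) =
      ∑ u ∈ Finset.range s, ∑ q ∈ Finset.range (l + 1), F u q := by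
  induction s with
  | zero => simp
  | succ s ih =>
    rw [Nat.succ_mul, Finset.sum_range_add, ih, Finset.sum_range_succ _ s]
    refine congrArg _ (Finset.sum_congr rfl fun q hq => ?_)
    rw [Finset.mem_range] at hq
    rw [mul_comm, Nat.mul_add_div (Nat.succ_pos l), Nat.mul_add_mod, Nat.div_eq_of_lt hq, Nat.mod_eq_of_lt hq,
      add_zero]

/-- The right-hand sides from which level `l` is solved. -/
noncomputable def levelRhs (σ : R ≃+* R) (β : R) (a : List R[X]) (p l : ℕ) (G : List (ℕ × R)) : List R :=
  (List.range (G.length * (l + 1))).map fun r => levelTerm σ β a p (l - (G.getD (r / (l + 1)) (0, 0)).1)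
    (r % (l + 1)) (G.getD (r / (l + 1)) (0, 0)).2

/-- The combination of right-hand sides that belongs to a combination of generators. -/
def levelCoord (n l : ℕ) (G : List (ℕ × R)) (z : ℕ → R) (r : ℕ) : R :=
  ((n - (G.getD (r / (l + 1)) (0, 0)).1).choose (r % (l + 1)) : R) * z (r / (l + 1))

/-- The degree n is separated from the data: the right-hand sides `levelRhs` do not depend on n,
which occurs only through binomial coefficients in the constant coordinates `levelCoord`. A single
PLDE over R can therefore treat all degrees at once. -/
theorem levelEq_genVal (σ : R ≃+* R) (β : R) (a : List R[X]) (p n : ℕ) {l : ℕ} {G : List (ℕ × R)}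
    (hG : ∀ r ∈ G, r.1 < l) {z : ℕ → R} (hz : IsConst σ z) :
    ∑ i ∈ Finset.range l, ∑ q ∈ Finset.range (l + 1),
        ((n - i).choose q : R) * levelTerm σ β a p (l - i) q (genVal G z i) =
      ∑ r ∈ Finset.range (levelRhs σ β a p l G).length,
        levelCoord n l G z r * (levelRhs σ β a p l G).getD r 0 := by
  let F : ℕ → ℕ → R := fun u q => ((n - (G.getD u (0, 0)).1).choose q : R) * z u *
    levelTerm σ β a p (l - (G.getD u (0, 0)).1) q (G.getD u (0, 0)).2
  have h1 : ∑ r ∈ Finset.range (levelRhs σ β a p l G).length,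
      levelCoord n l G z r * (levelRhs σ β a p l G).getD r 0 =
      ∑ r ∈ Finset.range (G.length * (l + 1)), F (r / (l + 1)) (r % (l + 1)) := by
    have hl : (levelRhs σ β a p l G).length = G.length * (l + 1) := by simp [levelRhs]
    rw [hl]
    refine Finset.sum_congr rfl fun r hr => ?_
    rw [Finset.mem_range] at hr
    rw [levelRhs, getD_tabulate, if_pos hr, levelCoord]
  rw [h1, sum_range_mul_divMod G.length l F]
  simp only [F, genVal, levelTerm_sum σ β a p _ _ hz, Finset.mul_sum]
  rw [Finset.sum_congr rfl fun i _ => Finset.sum_comm, Finset.sum_comm]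
  refine Finset.sum_congr rfl fun u hu => ?_
  rw [Finset.mem_range] at hu
  have hlev : (G.getD u (0, 0)).1 < l := by
    rw [List.getD_eq_getElem _ _ hu]; exact hG _ (List.getElem_mem hu)
  rw [Finset.sum_eq_single (G.getD u (0, 0)).1]
  · refine Finset.sum_congr rfl fun q _ => ?_
    rw [if_pos rfl]
    ring
  · intro i _ hi
    refine Finset.sum_eq_zero fun q _ => ?_
    rw [if_neg (Ne.symm hi), levelTerm_zero, mul_zero, mul_zero]
  · intro h
    exact (h (Finset.mem_range.2 hlev)).elim

end Levels

/-! ### Solving the top levels with coefficients polynomial in n -/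

section LevelInvariant

variable {R : Type*} [CommRing R]

/-- The falling factorial of `X - i` of weight `q`. -/
noncomputable def descPoly (R : Type*) [CommRing R] (i q : ℕ) : R[X] :=
  ∏ k ∈ Finset.range q, (X - Polynomial.C ((i + k : ℕ) : R))

/-- Multiplication by q! turns the binomial coefficient into a polynomial in n with integer
coefficients. No division is needed, and R need not contain the rationals. -/
theorem eval_descPoly {i n : ℕ} (hin : i ≤ n) (q : ℕ) :
    (descPoly R i q).eval (n : R) = (q.factorial : R) * ((n - i).choose q : R) := by
  have h : ∀ q, (descPoly R i q).eval (n : R) = ((n - i).descFactorial q : R) := by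
    intro q
    induction q with
    | zero => simp [descPoly]
    | succ q ih =>
      rw [descPoly, Finset.prod_range_succ, eval_mul]
      erw [ih]
      rw [Nat.descFactorial_succ, eval_sub, eval_X, eval_C, Nat.cast_mul, mul_comm]
      rcases le_or_gt q (n - i) with hq | hq
      · rw [Nat.cast_sub hq, Nat.cast_sub hin]
        push_cast
        ring
      · rw [Nat.descFactorial_eq_zero_iff_lt.2 hq, Nat.cast_zero, mul_zero, mul_zero]
  rw [h, Nat.descFactorial_eq_factorial_mul_choose, Nat.cast_mul]

/-- The sequence `z` satisfies the linear conditions given by the rows, evaluated at `n`. -/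
def RowsHold (T : List (List R[X])) (n : ℕ) (z : ℕ → R) : Prop :=
  ∀ r ∈ T, ∑ u ∈ Finset.range r.length, (r.getD u 0).eval (n : R) * z u = 0

/-- The state after the levels below `l` have been solved: tagged generators, and linear conditions on the
coefficients of the generators that depend polynomially on the degree. -/
structure LevelInv (σ : R ≃+* R) (β : R) (a : List R[X]) (p l : ℕ) (S : List (ℕ × R) × List (List R[X])) :
    Prop where
  level_lt : ∀ r ∈ S.1, r.1 < l
  row_length : ∀ r ∈ S.2, r.length ≤ S.1.length
  row_const : ∀ r ∈ S.2, ∀ x ∈ r, ∀ k, σ (x.coeff k) = x.coeff k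
  indep : ∀ z, IsConst σ z → genVal S.1 z 0 = 0 → ∀ u < S.1.length, (S.1.getD u (0, 0)).1 = 0 → z u = 0
  sound : ∀ n, l ≤ n → ∀ z, IsConst σ z → RowsHold S.2 n z → ∀ k < l, levelEq σ β a p n k (genVal S.1 z) = 0
  complete : ∀ n, l ≤ n → ∀ g, (∀ k < l, levelEq σ β a p n k g = 0) →
    ∃ z, IsConst σ z ∧ RowsHold S.2 n z ∧ ∀ i < l, g i = genVal S.1 z i

theorem LevelInv.init (σ : R ≃+* R) (β : R) (a : List R[X]) (p : ℕ) : LevelInv σ β a p 0 ([], []) where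
  level_lt := by simp
  row_length := by simp
  row_const := by simp
  indep := by simp
  sound := by simp
  complete n _ g _ := ⟨fun _ => 0, fun _ => map_zero σ, by simp [RowsHold], by simp⟩

/-- The row that links a new solution basis to the old generators. -/
noncomputable def levelRow (l : ℕ) (G : List (ℕ × R)) (B : List (List R × R)) (r : ℕ) : List R[X] :=
  (List.range (G.length + B.length)).map fun j =>
    if j < G.length then
      if j = r / (l + 1) then descPoly R (G.getD (r / (l + 1)) (0, 0)).1 (r % (l + 1)) else 0
    else Polynomial.C (((r % (l + 1)).factorial : R) * (B.getD (j - G.length) ([], 0)).1.getD r 0)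

/-- Solving the level `l`. -/
noncomputable def levelStep (l : ℕ) (S : List (ℕ × R) × List (List R[X])) (B : List (List R × R)) :
    List (ℕ × R) × List (List R[X]) :=
  (S.1 ++ B.map fun r => (l, r.2), S.2 ++ (List.range (S.1.length * (l + 1))).map (levelRow l S.1 B))

theorem genVal_congr {G : List (ℕ × R)} {z z' : ℕ → R} (h : ∀ u < G.length, z u = z' u) (i : ℕ) :
    genVal G z i = genVal G z' i :=
  Finset.sum_congr rfl fun u hu => by rw [h u (Finset.mem_range.1 hu)]

theorem genVal_eq_zero {G : List (ℕ × R)} {l : ℕ} (hG : ∀ r ∈ G, r.1 < l) (z : ℕ → R) {i : ℕ} (hi : l ≤ i) :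
    genVal G z i = 0 :=
  Finset.sum_eq_zero fun u hu => by
    rw [Finset.mem_range] at hu
    rw [if_neg, mul_zero]
    rw [List.getD_eq_getElem _ _ hu]
    have := hG _ (List.getElem_mem hu)
    omega

theorem genVal_append (l : ℕ) (G : List (ℕ × R)) (B : List (List R × R)) (z : ℕ → R) (i : ℕ) :
    genVal (G ++ B.map fun r => (l, r.2)) z i =
      genVal G z i + if l = i then combG B fun v => z (G.length + v) else 0 := by
  rw [genVal, List.length_append, Finset.sum_range_add, List.length_map]
  congr 1
  · refine Finset.sum_congr rfl fun u hu => ?_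
    rw [List.getD_append _ _ _ _ (Finset.mem_range.1 hu)]
  · have h : ∀ v ∈ Finset.range B.length, (G ++ B.map fun r => (l, r.2)).getD (G.length + v) (0, 0) =
        (l, (B.getD v ([], 0)).2) := by
      intro v hv
      rw [Finset.mem_range] at hv
      rw [List.getD_append_right _ _ _ _ (Nat.le_add_right _ _), Nat.add_sub_cancel_left,
        List.getD_eq_getElem _ _ (by simpa using hv), List.getElem_map, List.getD_eq_getElem _ _ hv]
    rw [Finset.sum_congr rfl fun v hv => by rw [h v hv]]
    split_ifs
    · rfl
    · simp

/-- Evaluated at n, the row for the pair r expresses, up to a factorial, that the binomial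
coordinate of r and the corresponding coordinate of the combination of the new basis add up to zero.
-/
theorem sum_levelRow {l n : ℕ} {G : List (ℕ × R)} (hG : ∀ r ∈ G, r.1 < l) (hn : l ≤ n)
    (B : List (List R × R)) {r : ℕ} (hr : r < G.length * (l + 1)) (z : ℕ → R) :
    ∑ u ∈ Finset.range (levelRow l G B r).length, ((levelRow l G B r).getD u 0).eval (n : R) * z u =
      ((r % (l + 1)).factorial : R) * (levelCoord n l G z r + combC B (fun v => z (G.length + v)) r) := by
  have hu : r / (l + 1) < G.length := Nat.div_lt_of_lt_mul (by rwa [mul_comm])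
  have hlev : (G.getD (r / (l + 1)) (0, 0)).1 < l := by
    rw [List.getD_eq_getElem _ _ hu]; exact hG _ (List.getElem_mem hu)
  have hlen : (levelRow l G B r).length = G.length + B.length := by simp [levelRow]
  rw [hlen, Finset.sum_range_add, mul_add]
  congr 1
  · rw [Finset.sum_eq_single (r / (l + 1)), levelRow, getD_tabulate, if_pos (by omega), if_pos hu, if_pos rfl,
      eval_descPoly (by omega), levelCoord, mul_assoc]
    · intro u hu hne
      rw [Finset.mem_range] at hu
      rw [levelRow, getD_tabulate, if_pos (by omega), if_pos hu, if_neg hne, eval_zero, zero_mul]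
    · intro h
      exact (h (Finset.mem_range.2 hu)).elim
  · rw [combC, Finset.mul_sum]
    refine Finset.sum_congr rfl fun v hv => ?_
    rw [Finset.mem_range] at hv
    rw [levelRow, getD_tabulate, if_pos (by omega), if_neg (by omega), eval_C, Nat.add_sub_cancel_left]
    ring

theorem coeff_descPoly_const (σ : R ≃+* R) (i q k : ℕ) : σ ((descPoly R i q).coeff k) = (descPoly R i q).coeff k := by
  have h : (descPoly R i q).map (σ : R →+* R) = descPoly R i q := by
    simp only [descPoly, Polynomial.map_prod, Polynomial.map_sub, map_X, map_C]
    exact Finset.prod_congr rfl fun k _ => by rw [map_natCast (σ : R →+* R)]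
  conv_rhs => rw [← h, coeff_map]
  rfl

theorem levelRow_const {σ : R ≃+* R} (l : ℕ) (G : List (ℕ × R)) {B : List (List R × R)}
    (hB : ∀ r ∈ B, ∀ x ∈ r.1, σ x = x) (r : ℕ) : ∀ x ∈ levelRow l G B r, ∀ k, σ (x.coeff k) = x.coeff k := by
  intro x hx k
  rw [levelRow, List.mem_map] at hx
  obtain ⟨j, -, rfl⟩ := hx
  split_ifs
  · exact coeff_descPoly_const σ _ _ _
  · rw [coeff_zero, map_zero]
  · rw [coeff_C]
    split_ifs
    · rw [map_mul, map_natCast]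
      congr 1
      rcases getD_mem_or B (j - G.length) ([], 0) with h | h
      · rcases getD_mem_or (B.getD (j - G.length) ([], 0)).1 r 0 with h' | h'
        · exact hB _ h _ h'
        · rw [h', map_zero]
      · rw [h]; simp
    · exact map_zero σ

/-- The equation at level l has the form α(g_l) + (contribution of higher coefficients) = 0, where
the contribution is a combination of `levelRhs` with coordinates depending on n. Solving the PLDE
with all these coordinates free gives `B`. Its second components generate the possible g_l, and the
demand that the free coordinates equal the negatives of the true ones is exactly the set of new
rows. -/
theorem LevelInv.step [IsDomain R] [CharZero R] {σ : R ≃+* R} {β : R} {a : List R[X]} {p l : ℕ}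
    {S : List (ℕ × R) × List (List R[X])} (h : LevelInv σ β a p l S) (ha : ∀ x ∈ a, x.natDegree ≤ p)
    {B : List (List R × R)} (hB : IsBas σ (levelRhs σ β a p l S.1).length
      (PLDE σ (a.map fun x => x.coeff p) (levelRhs σ β a p l S.1)) B) :
    LevelInv σ β a p (l + 1) (levelStep l S B) := by
  have hlen : (levelRhs σ β a p l S.1).length = S.1.length * (l + 1) := by simp [levelRhs]
  have hrows : ∀ n, l ≤ n → ∀ z, RowsHold (levelStep l S B).2 n z ↔ RowsHold S.2 n z ∧
      ∀ r < S.1.length * (l + 1), levelCoord n l S.1 z r + combC B (fun v => z (S.1.length + v)) r = 0 := by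
    intro n hn z
    simp only [RowsHold, levelStep, List.mem_append, or_imp, forall_and, List.mem_map, List.mem_range,
      forall_exists_index, and_imp, forall_apply_eq_imp_iff₂]
    refine and_congr_right fun _ => forall₂_congr fun r hr => ?_
    rw [sum_levelRow h.level_lt hn B hr, mul_eq_zero, or_iff_right]
    -- Characteristic 0 permits cancelling the factorial by which the row was scaled.
    exact_mod_cast Nat.factorial_ne_zero _
  have htop : ∀ z, genVal (levelStep l S B).1 z l = combG B fun v => z (S.1.length + v) := fun z => by
    rw [levelStep, genVal_append, if_pos rfl, genVal_eq_zero h.level_lt z le_rfl, zero_add]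
  have hlow : ∀ z, ∀ i < l, genVal (levelStep l S B).1 z i = genVal S.1 z i := fun z i hi => by
    rw [levelStep, genVal_append, if_neg (by omega), add_zero]
  have hsucc : ∀ n z, IsConst σ z → ∀ g : ℕ → R, (∀ i < l, g i = genVal S.1 z i) →
      levelEq σ β a p n l g = ∑ r ∈ Finset.range (levelRhs σ β a p l S.1).length,
        levelCoord n l S.1 z r * (levelRhs σ β a p l S.1).getD r 0 + diffOp σ (a.map fun x => x.coeff p) (g l) := by
    intro n z hz g hg
    rw [levelEq_eq_add σ β ha, ← levelEq_genVal σ β a p n h.level_lt hz]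
    congr 1
    exact Finset.sum_congr rfl fun i hi => by rw [hg i (Finset.mem_range.1 hi)]
  refine ⟨?_, ?_, ?_, ?_, ?_, ?_⟩
  · intro r hr
    rw [levelStep, List.mem_append, List.mem_map] at hr
    rcases hr with hr | ⟨r', -, rfl⟩
    · exact (h.level_lt r hr).trans (Nat.lt_succ_self l)
    · exact Nat.lt_succ_self l
  · intro r hr
    rw [levelStep, List.mem_append, List.mem_map] at hr
    rw [levelStep, List.length_append, List.length_map]
    rcases hr with hr | ⟨r', -, rfl⟩
    · exact (h.row_length r hr).trans (Nat.le_add_right _ _)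
    · simp [levelRow]
  · intro r hr
    rw [levelStep, List.mem_append, List.mem_map] at hr
    rcases hr with hr | ⟨r', -, rfl⟩
    · exact h.row_const r hr
    · exact levelRow_const l S.1 hB.const r'
  · intro z hz h0 u hu hlev
    by_cases hl : l = 0
    · subst hl
      -- At level 0 there are no right-hand sides yet, so `B` is a basis of the kernel of α and its
      -- second components are independent.
      have hnil : S.1 = [] := List.eq_nil_iff_forall_not_mem.2 fun r hr => Nat.not_lt_zero _ (h.level_lt r hr)
      rw [htop] at h0
      rw [levelStep, List.length_append, List.length_map, hnil] at hu
      have := hB.indep _ (fun k => hz _) (by rw [hlen, hnil]; simp) h0 u (by simpa using hu)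
      simpa [hnil] using this
    · rw [hlow z 0 (Nat.pos_of_ne_zero hl)] at h0
      by_cases hu' : u < S.1.length
      · refine h.indep z hz h0 u hu' ?_
        rwa [levelStep, List.getD_append _ _ _ _ hu'] at hlev
      · rw [levelStep, List.getD_append_right _ _ _ _ (not_lt.1 hu'), List.getD_eq_getElem, List.getElem_map] at hlev
        · exact (hl hlev).elim
        · rw [levelStep, List.length_append] at hu
          omega
  · intro n hn z hz hT k hk
    rw [hrows n (by omega)] at hT
    rcases Nat.lt_succ_iff_lt_or_eq.1 hk with hk | rfl
    · rw [levelEq_congr σ β a p n fun i hi => hlow z i (by omega)]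
      exact h.sound n (by omega) z hz hT.1 k hk
    · rw [hsucc n z hz _ (hlow z), htop]
      have hP := PLDE.comb (σ := σ) (z := fun v => z (S.1.length + v)) (fun v => hz _) fun v hv => hB.mem_getD hv
      rw [PLDE] at hP
      rw [diffOp, hP, ← Finset.sum_add_distrib]
      refine Finset.sum_eq_zero fun r hr => ?_
      rw [Finset.mem_range, hlen] at hr
      rw [← add_mul, hT.2 r hr, zero_mul]
  · intro n hn g hg
    obtain ⟨z, hz, hT, hgz⟩ := h.complete n (by omega) g fun k hk => hg k (by omega)
    have hl := hg l (Nat.lt_succ_self l)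
    rw [hsucc n z hz g hgz] at hl
    have hcoord : IsConst σ fun r => -levelCoord n l S.1 z r := fun r => by
      simp only [levelCoord, map_neg, map_mul, map_natCast, hz _]
    obtain ⟨y, hy, hc, hG⟩ := hB.span _ hcoord (g l) (by
      rw [PLDE]
      simp only [neg_mul, Finset.sum_neg_distrib]
      exact eq_neg_of_add_eq_zero_right hl)
    -- The old coordinates followed by the coordinates of the new level. The old rows do not see the
    -- extension, because their length is at most the old number of generators.
    let z' : ℕ → R := fun u => if u < S.1.length then z u else y (u - S.1.length)
    have hz1 : ∀ u < S.1.length, z' u = z u := fun u hu => if_pos hu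
    have hz2 : (fun v => z' (S.1.length + v)) = y := funext fun v => by
      simp only [z']; rw [if_neg (by omega), Nat.add_sub_cancel_left]
    refine ⟨z', fun u => ?_, (hrows n (by omega) z').2 ⟨fun r hr => ?_, fun r hr => ?_⟩, fun i hi => ?_⟩
    · simp only [z']
      split_ifs
      · exact hz u
      · exact hy _
    · rw [← hT r hr]
      refine Finset.sum_congr rfl fun u hu => ?_
      rw [hz1 u ((Finset.mem_range.1 hu).trans_le (h.row_length r hr))]
    · have hu : r / (l + 1) < S.1.length := Nat.div_lt_of_lt_mul (by rwa [mul_comm])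
      rw [hz2, ← hc r (by rwa [hlen]), levelCoord, hz1 _ hu, levelCoord]
      exact add_neg_cancel _
    · rcases Nat.lt_succ_iff_lt_or_eq.1 hi with hi | rfl
      · rw [hlow z' i hi, genVal_congr hz1, hgz i hi]
      · rw [htop, hz2, hG]

end LevelInvariant

/-! ### Elimination certificates -/

section Certificates

/-- Over a domain, either a multiple of a unit vector is a combination of the given rows, or some kernel
vector of the rows does not vanish at the corresponding place. -/
theorem exists_combination_or_kernel {D : Type*} [CommRing D] [IsDomain D] {m s : ℕ} (r : Fin m → Fin s → D)
    (u : Fin s) :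
    (∃ (w : Fin m → D) (P : D), P ≠ 0 ∧ ∀ v, ∑ i, w i * r i v = if v = u then P else 0) ∨
      ∃ z : Fin s → D, z u ≠ 0 ∧ ∀ i, ∑ v, r i v * z v = 0 := by
  let Q := FractionRing D
  have hinj : Function.Injective (algebraMap D Q) := IsFractionRing.injective D Q
  let rQ : Fin m → Fin s → Q := fun i v => algebraMap D Q (r i v)
  -- Over the field of fractions, the unit vector either lies in the row space or is separated from
  -- it by a linear functional vanishing on the rows. Clearing denominators gives the two
  -- alternatives.
  by_cases h : Pi.single u 1 ∈ Submodule.span Q (Set.range rQ)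
  · left
    obtain ⟨c, hc⟩ := (Submodule.mem_span_range_iff_exists_fun Q).1 h
    obtain ⟨b, hb⟩ := IsLocalization.exist_integer_multiples_of_finite (nonZeroDivisors D) c
    choose w hw using hb
    refine ⟨w, b, nonZeroDivisors.ne_zero b.2, fun v => hinj ?_⟩
    have hv := congrFun hc v
    rw [Finset.sum_apply] at hv
    have h1 : algebraMap D Q (∑ i, w i * r i v) = algebraMap D Q b * ∑ i, (c i • rQ i) v := by
      rw [map_sum, Finset.mul_sum]
      refine Finset.sum_congr rfl fun i _ => ?_
      rw [map_mul, hw, Algebra.smul_def, Pi.smul_apply, smul_eq_mul, mul_assoc]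
    rw [h1, hv, Pi.single_apply]
    split_ifs <;> simp
  · right
    obtain ⟨f, hf, hle⟩ := Submodule.exists_le_ker_of_notMem h
    obtain ⟨b, hb⟩ := IsLocalization.exist_integer_multiples_of_finite (nonZeroDivisors D)
      fun v => f (Pi.single v 1)
    choose z hz using hb
    have hz' : ∀ v, algebraMap D Q (z v) = algebraMap D Q b * f (Pi.single v 1) := fun v => by
      rw [hz, Algebra.smul_def]
    refine ⟨z, fun h0 => ?_, fun i => hinj ?_⟩
    · have h1 := hz' u
      rw [h0, map_zero, eq_comm, mul_eq_zero] at h1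
      rcases h1 with h1 | h1
      · exact nonZeroDivisors.ne_zero b.2 (hinj (by rw [h1, map_zero]))
      · exact hf h1
    · have h1 : f (rQ i) = 0 := hle (Submodule.subset_span ⟨i, rfl⟩)
      have h2 : rQ i = ∑ v, rQ i v • Pi.single v (1 : Q) := by
        ext v
        simp [Finset.sum_apply, Pi.single_apply]
      rw [h2, map_sum] at h1
      rw [map_sum, map_zero, ← mul_zero (algebraMap D Q b), ← h1, Finset.mul_sum]
      refine Finset.sum_congr rfl fun v _ => ?_
      rw [map_mul, hz', map_smul, smul_eq_mul]
      ring

variable {R : Type*} [CommRing R]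

/-- The pair `w` certifies that the coefficient of the generator `u` vanishes for all but finitely many
degrees. -/
def IsCert (σ : R ≃+* R) (S : List (ℕ × R) × List (List R[X])) (u : ℕ) (w : List R[X] × R[X]) : Prop :=
  (w.2 ≠ 0 ∧ ∀ k, σ (w.2.coeff k) = w.2.coeff k) ∧ ∀ v < S.1.length,
    ∑ i ∈ Finset.range S.2.length, w.1.getD i 0 * (S.2.getD i []).getD v 0 = if v = u then w.2 else 0

/-- Combining the conditions on z with the multipliers evaluated at n leaves only the coordinate u,
multiplied by the value of the certificate polynomial. -/
theorem IsCert.eq_zero {σ : R ≃+* R} {S : List (ℕ × R) × List (List R[X])} {u : ℕ} {w : List R[X] × R[X]}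
    (h : IsCert σ S u w) (hS : ∀ r ∈ S.2, r.length ≤ S.1.length) (hu : u < S.1.length) {n : ℕ} {z : ℕ → R}
    (hz : RowsHold S.2 n z) : w.2.eval (n : R) * z u = 0 := by
  have h1 : ∑ v ∈ Finset.range S.1.length, (∑ i ∈ Finset.range S.2.length,
      w.1.getD i 0 * (S.2.getD i []).getD v 0).eval (n : R) * z v = w.2.eval (n : R) * z u := by
    rw [Finset.sum_eq_single u, h.2 u hu, if_pos rfl]
    · intro v hv hne
      rw [h.2 v (Finset.mem_range.1 hv), if_neg hne, eval_zero, zero_mul]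
    · intro h'
      exact (h' (Finset.mem_range.2 hu)).elim
  rw [← h1]
  simp only [eval_finsetSum, eval_mul, Finset.sum_mul, mul_assoc]
  rw [Finset.sum_comm]
  refine Finset.sum_eq_zero fun i hi => ?_
  rw [← Finset.mul_sum]
  have hmem : S.2.getD i [] ∈ S.2 := by
    rw [List.getD_eq_getElem _ _ (Finset.mem_range.1 hi)]; exact List.getElem_mem _
  have h2 := hz _ hmem
  rw [Finset.sum_subset (Finset.range_mono (hS _ hmem))] at h2
  · rw [h2, mul_zero]
  · intro v _ hv
    rw [Finset.mem_range, not_lt] at hv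
    rw [List.getD_eq_default _ _ hv, eval_zero, zero_mul]

theorem exists_lift_constants {σ : R ≃+* R} {x : R[X]} (hx : ∀ k, σ (x.coeff k) = x.coeff k) :
    ∃ y : (constants σ)[X], y.map (constants σ).subtype = x := by
  have : x ∈ Polynomial.lifts (constants σ).subtype := by
    rw [Polynomial.lifts_iff_coeff_lifts]
    exact fun k => ⟨⟨_, hx k⟩, rfl⟩
  simpa [Polynomial.mem_lifts] using this

/-- If there were no certificate, a polynomial kernel vector of the rows would have a nonzero entry
at u. Its specializations at n satisfy the first `a.length` level equations and give a nonzero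
leading coefficient for almost all n, so almost all n would be defective. The argument runs over the
domain of polynomials with constant coefficients, so that specialized vectors consist of constants.
-/
theorem LevelInv.exists_cert [IsDomain R] [CharZero R] {σ : R ≃+* R} {β : R} {a : List R[X]} {p : ℕ}
    {S : List (ℕ × R) × List (List R[X])} (h : LevelInv σ β a p a.length S) (ha : ∀ x ∈ a, x.natDegree ≤ p)
    (hfin : {n : ℕ | ∃ g : R[X], g ≠ 0 ∧ g.natDegree = n ∧
      ∀ i, n + p < i + a.length → (diffOp (polyAut σ β) a g).coeff i = 0}.Finite)
    {u : ℕ} (hu : u < S.1.length) (hlev : (S.1.getD u (0, 0)).1 = 0) : ∃ w, IsCert σ S u w := by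
  have hlift : ∀ i v : ℕ, ∃ y : (constants σ)[X],
      y.map (constants σ).subtype = (S.2.getD i []).getD v 0 := by
    intro i v
    refine exists_lift_constants fun k => ?_
    rcases getD_mem_or S.2 i [] with h1 | h1
    · rcases getD_mem_or (S.2.getD i []) v 0 with h2 | h2
      · exact h.row_const _ h1 _ h2 k
      · rw [h2]; simp
    · rw [h1]; simp
  choose r hr using hlift
  have hinj : Function.Injective (Polynomial.map (constants σ).subtype) :=
    map_injective _ Subtype.val_injective
  rcases exists_combination_or_kernel (m := S.2.length) (s := S.1.length) (fun i v => r i v) ⟨u, hu⟩ with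
    ⟨w, P, hP, hw⟩ | ⟨z, hzu, hz⟩
  · refine ⟨(List.ofFn fun i => (w i).map (constants σ).subtype, P.map (constants σ).subtype), ⟨?_, ?_⟩, ?_⟩
    · rw [← Polynomial.map_zero (constants σ).subtype]
      exact fun h0 => hP (hinj h0)
    · intro k
      rw [coeff_map]
      exact (P.coeff k).2
    · intro v hv
      have h1 := congrArg (Polynomial.map (constants σ).subtype) (hw ⟨v, hv⟩)
      rw [Polynomial.map_sum] at h1
      rw [Finset.sum_range, Finset.sum_congr rfl fun i _ => by rw [getD_ofFn, ← hr, ← Polynomial.map_mul], h1]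
      simp only [Fin.mk.injEq]
      split_ifs
      · rfl
      · exact Polynomial.map_zero _
  · exfalso
    let z' : ℕ → ℕ → R := fun n v => if hv : v < S.1.length then ((z ⟨v, hv⟩).eval (n : constants σ) : constants σ) else 0
    have hz' : ∀ n v : ℕ, ∀ hv : v < S.1.length, z' n v = ((z ⟨v, hv⟩).map (constants σ).subtype).eval (n : R) := by
      intro n v hv
      simp only [z']
      rw [dif_pos hv, eval_natCast_map]
      rfl
    have hconst : ∀ n, IsConst σ (z' n) := by
      intro n v
      simp only [z']
      split_ifs
      · exact (eval (n : constants σ) (z ⟨v, _⟩)).2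
      · exact map_zero σ
    have hrows : ∀ n, RowsHold S.2 n (z' n) := by
      intro n row hrow
      obtain ⟨i, hi, rfl⟩ := List.getElem_of_mem hrow
      have h1 := congrArg (fun q => (Polynomial.map (constants σ).subtype q).eval (n : R)) (hz ⟨i, hi⟩)
      simp only [Polynomial.map_sum, Polynomial.map_mul, eval_finsetSum, eval_mul, Polynomial.map_zero, eval_zero,
        hr] at h1
      rw [Finset.sum_subset (Finset.range_mono (h.row_length _ hrow)), Finset.sum_range, ← h1]
      · refine Finset.sum_congr rfl fun v _ => ?_
        rw [hz' n v v.2, List.getD_eq_getElem _ _ hi]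
      · intro v _ hv
        rw [Finset.mem_range, not_lt] at hv
        rw [List.getD_eq_default _ _ hv, eval_zero, zero_mul]
    have hroots : {n : ℕ | ((z ⟨u, hu⟩).map (constants σ).subtype).eval (n : R) = 0}.Finite := by
      classical
      have h0 : (z ⟨u, hu⟩).map (constants σ).subtype ≠ 0 := by
        rw [← Polynomial.map_zero (constants σ).subtype]
        exact fun h0 => hzu (hinj h0)
      refine (((z ⟨u, hu⟩).map (constants σ).subtype).roots.toFinset.finite_toSet.preimage
        (f := fun n : ℕ => (n : R)) Nat.cast_injective.injOn).subset fun n hn => ?_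
      simpa [h0] using hn
    -- Every natural number would be defective, a root of the entry at u, or smaller than the number
    -- of levels: three finite sets covering ℕ.
    refine Set.infinite_univ (((hfin.union hroots).union (Set.finite_lt_nat a.length)).subset fun n _ => ?_)
    by_cases hn : n < a.length
    · exact Or.inr hn
    by_cases hn0 : ((z ⟨u, hu⟩).map (constants σ).subtype).eval (n : R) = 0
    · exact Or.inl (Or.inr hn0)
    refine Or.inl (Or.inl ?_)
    rw [not_lt] at hn
    -- The levels number the coefficients from the top, so level 0 supplies the coefficient of X^n.
    -- Generators exist only for levels below `a.length`.
    let g : R[X] := ∑ i ∈ Finset.range (n + 1), monomial (n - i) (genVal S.1 (z' n) i)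
    have hg0 : genVal S.1 (z' n) 0 ≠ 0 := fun h0 => hn0 (by
      rw [← hz' n u hu]; exact h.indep _ (hconst n) h0 u hu hlev)
    have hgn : g.coeff n = genVal S.1 (z' n) 0 := by
      simp only [g, finsetSum_coeff, coeff_monomial]
      rw [Finset.sum_eq_single 0]
      · simp
      · intro i hi hne
        rw [Finset.mem_range] at hi
        rw [if_neg (by omega)]
      · simp
    have hgle : g.natDegree ≤ n := natDegree_sum_le_of_forall_le _ _ fun i _ =>
      (natDegree_monomial_le _).trans (Nat.sub_le n i)
    refine ⟨g, fun h0 => hg0 (by rw [← hgn, h0, coeff_zero]), le_antisymm hgle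
      (le_natDegree_of_ne_zero (by rwa [hgn])), fun i hi => ?_⟩
    rcases lt_or_ge (n + p) i with hi' | hi'
    · exact coeff_diffOp_eq_zero σ β ha hgle hi'
    · obtain ⟨l, rfl⟩ : ∃ l, i = n + p - l := ⟨n + p - i, by omega⟩
      by_cases hl : l < a.length
      · rw [coeff_diffOp_sum_monomial σ β ha (by omega)]
        exact h.sound n hn _ (hconst n) (hrows n) l hl
      · omega

end Certificates

/-! ### The algorithm for the degree bound -/

section BoundAlgorithm

variable {R : Type*} [CommRing R] {σ : R ≃+* R} {C : Type*} [Primcodable C] {ν : C → R}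
  {Ω : Type*} [Primcodable Ω]

/-- The natural number roots of nonzero polynomials with constant coefficients can be bounded. -/
def RootBound (σ : R ≃+* R) (ν : C → R) : Prop :=
  ∃ N : List C → ℕ, Computable N ∧ ∀ l : List C, (∀ x ∈ l, σ (ν x) = ν x) → polyOf ν l ≠ 0 →
    ∀ n : ℕ, (polyOf ν l).eval (n : R) = 0 → n ≤ N l

theorem RC.computable {φ : Ω → ℕ} (h : RC (id : ℕ → ℕ) φ) : Computable φ := by
  obtain ⟨F, hF, h⟩ := h
  exact hF.of_eq h

/-- Codes of tagged generators. -/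
abbrev genOf (ν : C → R) : ℕ × C → ℕ × R := Prod.map id ν

/-- Codes of states of the level algorithm. -/
noncomputable abbrev stateOf (ν : C → R) :
    List (ℕ × C) × List (List (List C)) → List (ℕ × R) × List (List R[X]) :=
  Prod.map (List.map (genOf ν)) (List.map (List.map (polyOf ν)))

namespace Coded

variable (hc : Coded σ ν)
include hc

theorem rc_poly_getD {φ : Ω → List R[X]} (h : RC (List.map (polyOf ν)) φ) {n : Ω → ℕ} (hn : Computable n) :
    RC (polyOf ν) fun x => (φ x).getD (n x) 0 := h.getD hn (polyOf_surjective hc.surj 0)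

theorem rc_gen_getD {G : Ω → List (ℕ × R)} (h : RC (List.map (genOf ν)) G) {n : Ω → ℕ} (hn : Computable n) :
    RC (genOf ν) fun x => (G x).getD (n x) (0, 0) :=
  h.getD hn (by obtain ⟨c, h⟩ := hc.surj 0; exact ⟨(0, c), by rw [genOf, Prod.map_apply, h, id]⟩)

theorem rc_iterShift {s : Ω → ℕ} (hs : Computable s) (β : R) : RC ν fun x => iterShift σ β (s x) :=
  hc.rc_sum hs (hc.rc_iterate Computable.snd (hc.rc_const β))

theorem rc_levelTerm (β : R) {a : Ω → List R[X]} (ha : RC (List.map (polyOf ν)) a) {p j q : Ω → ℕ}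
    (hp : Computable p) (hj : Computable j) (hq : Computable q) {b : Ω → R} (hb : RC ν b) :
    RC ν fun x => levelTerm σ β (a x) (p x) (j x) (q x) (b x) := by
  have hpq := computable_add hp hq
  refine hc.rc_sum ha.length (hc.rc_mul (hc.rc_mul (hc.rc_pow (hq.comp Computable.fst)
    (hc.rc_iterShift Computable.snd β)) (hc.rc_iterate Computable.snd (hb.precomp Computable.fst))) ?_)
  exact RC.ite (computablePred_nat_le (hj.comp Computable.fst) (hpq.comp Computable.fst))
    (hc.rc_coeff (hc.rc_poly_getD (ha.precomp Computable.fst) Computable.snd)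
      ((computable_sub hpq hj).comp Computable.fst)) (hc.rc_const 0)

theorem rc_levelRhs (β : R) {a : Ω → List R[X]} (ha : RC (List.map (polyOf ν)) a) {p l : Ω → ℕ}
    (hp : Computable p) (hl : Computable l) {G : Ω → List (ℕ × R)} (hG : RC (List.map (genOf ν)) G) :
    RC (List.map ν) fun x => levelRhs σ β (a x) (p x) (l x) (G x) := by
  have hl1 : Computable fun x => l x + 1 := computable_add hl (Computable.const 1)
  have hu : Computable fun r : Ω × ℕ => r.2 / (l r.1 + 1) :=
    computable_div Computable.snd (hl1.comp Computable.fst)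
  have hg := hc.rc_gen_getD (hG.precomp Computable.fst) hu
  exact RC.tabulate (computable_mul hG.length hl1) (hc.rc_levelTerm β (ha.precomp Computable.fst)
    (hp.comp Computable.fst) (computable_sub (hl.comp Computable.fst) hg.fst.computable)
    (computable_mod Computable.snd (hl1.comp Computable.fst)) hg.snd)

theorem rc_descPoly {i q : Ω → ℕ} (hi : Computable i) (hq : Computable q) :
    RC (polyOf ν) fun x => descPoly R (i x) (q x) := by
  have hc' := hc.polynomial 0
  exact hc'.rc_prod hq (hc'.rc_sub (hc'.rc_const X)
    (hc.rc_C (hc.rc_natCast (computable_add (hi.comp Computable.fst) Computable.snd))))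

theorem rc_levelRow {l r : Ω → ℕ} (hl : Computable l) (hr : Computable r) {G : Ω → List (ℕ × R)}
    (hG : RC (List.map (genOf ν)) G) {B : Ω → List (List R × R)} (hB : RC (basOf ν ν) B) :
    RC (List.map (polyOf ν)) fun x => levelRow (l x) (G x) (B x) (r x) := by
  have hl1 : Computable fun x => l x + 1 := computable_add hl (Computable.const 1)
  have hu : Computable fun x => r x / (l x + 1) := computable_div hr hl1
  have hq : Computable fun x => r x % (l x + 1) := computable_mod hr hl1
  have hg := hc.rc_gen_getD hG hu
  have hlen := hG.length
  have hb : RC (Prod.map (List.map ν) ν) fun p : Ω × ℕ => (B p.1).getD (p.2 - (G p.1).length) ([], 0) :=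
    RC.getD (hB.precomp Computable.fst) (computable_sub Computable.snd (hlen.comp Computable.fst))
      (exists_code_nil_zero (hc.surj 0))
  have hfact : Computable fun x => (r x % (l x + 1)).factorial := by
    refine (Computable.nat_rec (hq) (Computable.const 1)
      (h := fun x (p : ℕ × ℕ) => (p.1 + 1) * p.2) ?_).of_eq fun x => ?_
    · exact computable_mul (computable_add (Computable.fst.comp Computable.snd) (Computable.const 1))
        (Computable.snd.comp Computable.snd)
    · induction r x % (l x + 1) with
      | zero => rfl
      | succ n ih => rw [Nat.factorial_succ, ← ih]
  refine RC.tabulate (computable_add hlen hB.length) ?_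
  refine RC.ite (computablePred_nat_lt Computable.snd (hlen.comp Computable.fst)) ?_ ?_
  · exact RC.ite (computablePred_nat_eq Computable.snd (hu.comp Computable.fst))
      ((hc.rc_descPoly hg.fst.computable hq).precomp Computable.fst) ((hc.polynomial 0).rc_const 0)
  · exact hc.rc_C (hc.rc_mul (hc.rc_natCast (hfact.comp Computable.fst))
      (hc.rc_getD hb.fst (hr.comp Computable.fst)))

theorem rc_levelStep {l : Ω → ℕ} (hl : Computable l) {S : Ω → List (ℕ × R) × List (List R[X])}
    (hS : RC (stateOf ν) S) {B : Ω → List (List R × R)} (hB : RC (basOf ν ν) B) :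
    RC (stateOf ν) fun x => levelStep (l x) (S x) (B x) := by
  have hG : RC (List.map (genOf ν)) fun x => (S x).1 := hS.fst
  have hT : RC (List.map (List.map (polyOf ν))) fun x => (S x).2 := hS.snd
  refine RC.prod (RC.append hG ?_) (RC.append hT ?_)
  · refine RC.list_map (ν := Prod.map (List.map ν) ν) hB (RC.prod ?_ (RC.snd (ν := List.map ν) ?_))
    · exact ⟨_, hl.comp Computable.fst, fun _ => rfl⟩
    · exact RC.code Computable.snd
  · exact RC.tabulate (computable_mul hG.length (computable_add hl (Computable.const 1)))
      (hc.rc_levelRow (hl.comp Computable.fst) Computable.snd (hG.precomp Computable.fst)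
        (hB.precomp Computable.fst))

end Coded

/-- The number of levels equals the number of coefficients of the operator: this is exactly how many
top coefficients must vanish for a degree to count as defective in `finite_defective_natDegrees`. -/
theorem exists_levelInv [IsDomain R] [CharZero R] (hc : Coded σ ν) (hs : Solver σ ν) (β : R)
    {a : Ω → List R[X]} (ha : RC (List.map (polyOf ν)) a) {p : Ω → ℕ} (hp : Computable p) :
    ∃ S : Ω → List (ℕ × R) × List (List R[X]), RC (stateOf ν) S ∧
      ∀ x, (∀ y ∈ a x, y.natDegree ≤ p x) → (∃ y ∈ a x, y.coeff (p x) ≠ 0) →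
        LevelInv σ β (a x) (p x) (a x).length (S x) := by
  suffices ∃ F : Ω → List (ℕ × C) × List (List (List C)), Computable F ∧ ∀ x,
      ((∀ y ∈ a x, y.natDegree ≤ p x) → (∃ y ∈ a x, y.coeff (p x) ≠ 0) →
        LevelInv σ β (a x) (p x) (a x).length (stateOf ν (F x))) by
    obtain ⟨F, hF, h⟩ := this
    exact ⟨fun x => stateOf ν (F x), RC.code hF, h⟩
  refine exists_computable_rec (Inv := fun x n (y : List (ℕ × C) × List (List (List C))) =>
    (∀ y ∈ a x, y.natDegree ≤ p x) → (∃ y ∈ a x, y.coeff (p x) ≠ 0) →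
      LevelInv σ β (a x) (p x) n (stateOf ν y)) ha.length ?_ ?_
  · exact ⟨fun _ => ([], []), Computable.const _, fun x _ _ => LevelInv.init σ β (a x) (p x)⟩
  · have hn : Computable fun x : Ω × ℕ × (List (ℕ × C) × List (List (List C))) => x.2.1 :=
      Computable.fst.comp Computable.snd
    have hS : RC (stateOf ν) fun x : Ω × ℕ × (List (ℕ × C) × List (List (List C))) => stateOf ν x.2.2 :=
      RC.code (Computable.snd.comp Computable.snd)
    have ha' : RC (List.map (polyOf ν)) fun x : Ω × ℕ × (List (ℕ × C) × List (List (List C))) => a x.1 :=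
      ha.precomp Computable.fst
    have hp' : Computable fun x : Ω × ℕ × (List (ℕ × C) × List (List (List C))) => p x.1 :=
      hp.comp Computable.fst
    have hα : RC (List.map ν) fun x : Ω × ℕ × (List (ℕ × C) × List (List (List C))) =>
        (a x.1).map fun y => y.coeff (p x.1) :=
      ha'.list_map (hc.rc_coeff (RC.code Computable.snd) (hp'.comp Computable.fst))
    obtain ⟨B, hB, hB'⟩ := hs.apply hα (hc.rc_levelRhs β ha' hp' hn hS.fst)
    obtain ⟨G, hG, hG'⟩ := hc.rc_levelStep hn hS hB
    refine ⟨G, hG, fun x n y _ h h1 h2 => ?_⟩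
    have h3 := hG' (x, n, y)
    beta_reduce at h3
    rw [h3]
    refine (h h1 h2).step h1 (hB' (x, n, y) ?_)
    obtain ⟨z, hz, hz0⟩ := h2
    exact ⟨_, List.mem_map_of_mem hz, hz0⟩

/-- A certificate is checked by finitely many equalities in R and R[X]. This is what allows
certificates to be searched for instead of constructed. -/
theorem computablePred_isCert (hc : Coded σ ν) {S : Ω → List (ℕ × R) × List (List R[X])} (hS : RC (stateOf ν) S)
    {u : Ω → ℕ} (hu : Computable u) {w : Ω → List (List C) × List C} (hw : Computable w) :
    ComputablePred fun x => IsCert σ (S x) (u x) ((w x).1.map (polyOf ν), polyOf ν (w x).2) := by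
  have hc' := hc.polynomial 0
  have hG : RC (List.map (genOf ν)) fun x => (S x).1 := hS.fst
  have hT : RC (List.map (List.map (polyOf ν))) fun x => (S x).2 := hS.snd
  have hw1 : RC (List.map (polyOf ν)) fun x => (w x).1.map (polyOf ν) := RC.code (Computable.fst.comp hw)
  have hw2 : Computable fun x => (w x).2 := Computable.snd.comp hw
  have hP : RC (polyOf ν) fun x => polyOf ν (w x).2 := RC.code hw2
  have hk : RC ν fun x : Ω × ℕ => (polyOf ν (w x.1).2).coeff x.2 :=
    hc.rc_coeff (hP.precomp Computable.fst) Computable.snd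
  have h1 : ComputablePred fun x => ∀ k < (w x).2.length,
      σ ((polyOf ν (w x).2).coeff k) = (polyOf ν (w x).2).coeff k :=
    ComputablePred.forall_lt' (Computable.list_length.comp hw2) (hc.eq' (hc.rc_aut hk) hk)
  have hrow : RC (polyOf ν) fun y : (Ω × ℕ) × ℕ => ((S y.1.1).2.getD y.2 []).getD y.1.2 0 :=
    hc.rc_poly_getD (RC.getD (hT.precomp (Computable.fst.comp Computable.fst)) Computable.snd ⟨[], rfl⟩)
      (Computable.snd.comp Computable.fst)
  have hsum := hc'.rc_sum (hT.length.comp (Computable.fst (α := Ω) (β := ℕ)))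
    (φ := fun x i => ((w x.1).1.map (polyOf ν)).getD i 0 * ((S x.1).2.getD i []).getD x.2 0)
    (hc'.rc_mul (hc.rc_poly_getD (hw1.precomp (Computable.fst.comp Computable.fst)) Computable.snd) hrow)
  have h2 : ComputablePred fun x => ∀ v < (S x).1.length, ∑ i ∈ Finset.range (S x).2.length,
      ((w x).1.map (polyOf ν)).getD i 0 * ((S x).2.getD i []).getD v 0 = if v = u x then polyOf ν (w x).2 else 0 :=
    ComputablePred.forall_lt' hG.length (hc'.eq' hsum (RC.ite (computablePred_nat_eq Computable.snd
      (hu.comp Computable.fst)) (hP.precomp Computable.fst) (hc'.rc_const 0)))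
  refine (ComputablePred.and' (ComputablePred.and' (hc'.eq_zero' hP).not h1) h2).of_eq fun x => ?_
  refine and_congr_left fun _ => and_congr_right fun _ => ⟨fun h k => ?_, fun h k _ => h k⟩
  by_cases hk : k < (w x).2.length
  · exact h k hk
  · rw [coeff_polyOf_eq_zero ν _ (not_lt.1 hk), map_zero]

/-- A bound for the degrees of the polynomial solutions can be computed. -/
theorem exists_degree_bound [IsDomain R] [CharZero R] (hc : Coded σ ν) (hs : Solver σ ν) (hr : RootBound σ ν)
    {β : R} (hβ : ∀ p q : R, q ≠ 0 → σ p * q - p * σ q ≠ β * q * σ q) :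
    ∃ N : List (List C) × List (List C) → ℕ, Computable N ∧ ∀ a f : List (List C),
      (∃ x ∈ a, polyOf ν x ≠ 0) → ∀ c, IsConst σ c → ∀ g,
        PolyEq σ β (a.map (polyOf ν)) (f.map (polyOf ν)) c g → ∀ i, N (a, f) ≤ i → g.coeff i = 0 := by
  let Ω := List (List C) × List (List C)
  have ha : RC (List.map (polyOf ν)) fun x : Ω => x.1.map (polyOf ν) := RC.code Computable.fst
  obtain ⟨p, hp, hp'⟩ := exists_max_degree hc ha
  obtain ⟨S, hS, hS'⟩ := exists_levelInv hc hs β ha hp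
  obtain ⟨N, hN, hN'⟩ := hr
  have hG : RC (List.map (genOf ν)) fun x => (S x).1 := hS.fst
  have hcert : ∃ F : Ω × ℕ → List (List C) × List C, Computable F ∧ ∀ x : Ω × ℕ,
      ((∃ i < x.1.1.length, (x.1.1.map (polyOf ν)).getD i 0 ≠ 0) ∧ x.2 < (S x.1).1.length ∧
        ((S x.1).1.getD x.2 (0, 0)).1 = 0) →
      IsCert σ (S x.1) x.2 ((F x).1.map (polyOf ν), polyOf ν (F x).2) := by
    -- Finiteness of the defective degrees enters only here, to guarantee that the search for a
    -- certificate terminates; no bound has to be extracted from its proof.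
    refine exists_computable_search (D := fun (x : Ω × ℕ) (y : List (List C) × List C) =>
      IsCert σ (S x.1) x.2 (y.1.map (polyOf ν), polyOf ν y.2)) (computablePred_isCert hc (hS.precomp (Computable.fst.comp Computable.fst))
      (Computable.snd.comp Computable.fst) Computable.snd) ?_ ?_
    · refine ComputablePred.and' ?_ (ComputablePred.and' ?_ ?_)
      · exact ComputablePred.exists_lt' (Computable.list_length.comp (Computable.fst.comp Computable.fst))
          ((hc.polynomial 0).eq_zero' (hc.rc_poly_getD
            (ha.precomp (Computable.fst.comp Computable.fst)) Computable.snd)).not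
      · exact computablePred_nat_lt Computable.snd (hG.length.comp Computable.fst)
      · exact computablePred_nat_eq (hc.rc_gen_getD (hG.precomp Computable.fst) Computable.snd).fst.computable
          (Computable.const 0)
    · rintro ⟨x, u⟩ ⟨⟨i, hi, hi0⟩, hu, hlev⟩
      have hx : ∃ y ∈ x.1.map (polyOf ν), y ≠ 0 :=
        (getD_mem_or _ i 0).elim (fun h => ⟨_, h, hi0⟩) fun h => (hi0 h).elim
      obtain ⟨h1, h2⟩ := hp' x hx
      obtain ⟨w, hw⟩ := (hS' x h1 h2).exists_cert h1 (finite_defective_natDegrees hβ h1 h2) hu hlev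
      obtain ⟨w1, hw1⟩ := List.map_surjective_iff.2 (polyOf_surjective hc.surj) w.1
      obtain ⟨w2, hw2⟩ := polyOf_surjective hc.surj w.2
      exact ⟨(w1, w2), by simpa only [hw1, hw2] using hw⟩
  obtain ⟨F, hF, hF'⟩ := hcert
  -- The first summand makes all levels lie at or above degree 0. Together with the second it pushes
  -- the examined coefficients beyond the right-hand sides. The third, with its +1, exceeds every
  -- natural root of every certificate polynomial.
  let bound : Ω → ℕ := fun x => x.1.length + (x.2.map List.length).sum +
    ((List.range (S x).1.length).map fun u => N (F (x, u)).2 + 1).sum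
  refine ⟨bound, ?_, ?_⟩
  · refine computable_add (computable_add (Computable.list_length.comp Computable.fst) ?_) ?_
    · exact computable_list_sum (computable_list_map Computable.snd (Computable.list_length.comp Computable.snd))
    · exact computable_list_sum (computable_tabulate hG.length (computable_add (hN.comp
        (Computable.snd.comp (hF.comp (Computable.fst.pair Computable.snd)))) (Computable.const 1)))
  · intro a f ⟨y, hy, hy0⟩ c hcc g hg i hi
    by_contra hgi
    have hx : ∃ y ∈ a.map (polyOf ν), y ≠ 0 := ⟨_, List.mem_map_of_mem hy, hy0⟩
    obtain ⟨h1, h2⟩ := hp' (a, f) hx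
    have hinv := hS' (a, f) h1 h2
    rw [List.length_map] at hinv
    set n := g.natDegree with hn
    have hg0 : g ≠ 0 := fun h => hgi (by rw [h, coeff_zero])
    have hin : bound (a, f) ≤ n := hi.trans (le_natDegree_of_ne_zero hgi)
    have hbound : bound (a, f) = a.length + (f.map List.length).sum +
      ((List.range (S (a, f)).1.length).map fun u => N (F ((a, f), u)).2 + 1).sum := rfl
    rw [hbound] at hin
    -- Above the degrees of the right-hand sides the top coefficient equations are homogeneous.
    have hlev : ∀ l < a.length, levelEq σ β (a.map (polyOf ν)) (p (a, f)) n l (fun i => g.coeff (n - i)) = 0 := by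
      intro l hl
      rw [← coeff_diffOp_sum_monomial σ β h1 (by omega), sum_monomial_coeff_sub hn.ge]
      rw [show diffOp (polyAut σ β) (a.map (polyOf ν)) g = _ from hg, finsetSum_coeff]
      refine Finset.sum_eq_zero fun j hj => ?_
      rw [coeff_C_mul]
      rcases getD_mem_or (f.map (polyOf ν)) j 0 with h | h
      · rw [List.mem_map] at h
        obtain ⟨r, hr, hrj⟩ := h
        have := List.le_sum_of_mem (List.mem_map_of_mem (f := List.length) hr)
        rw [← hrj, coeff_polyOf_eq_zero ν r (by omega), mul_zero]
      · rw [h, coeff_zero, mul_zero]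
    obtain ⟨z, hz, hT, hgz⟩ := hinv.complete n (show a.length ≤ n by omega) _ hlev
    have hlen : 0 < a.length := List.length_pos_of_mem hy
    have h0 := hgz 0 hlen
    rw [Nat.sub_zero] at h0
    -- The leading coefficient is a combination of the generators of level 0. Each of their
    -- coordinates is killed by its certificate, as n exceeds all roots of the certificate
    -- polynomial; generators of other levels do not contribute.
    refine leadingCoeff_ne_zero.2 hg0 (h0.trans (Finset.sum_eq_zero fun u hu => ?_))
    rw [Finset.mem_range] at hu
    split_ifs with hu0
    · have hcert := hF' ((a, f), u) ⟨?_, hu, hu0⟩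
      · have hmul := hcert.eq_zero hinv.row_length hu hT
        rcases mul_eq_zero.1 hmul with h | h
        · exfalso
          have hle := hN' _ (fun x hx => ?_) hcert.1.1 n h
          · have := List.le_sum_of_mem (List.mem_map_of_mem (f := fun u => N (F ((a, f), u)).2 + 1)
              (List.mem_range.2 hu))
            omega
          · obtain ⟨k, hk, rfl⟩ := List.getElem_of_mem hx
            have := hcert.1.2 k
            rwa [coeff_polyOf, List.getD_eq_getElem _ _ (by simpa using hk), List.getElem_map] at this
        · rw [h, zero_mul]
      · obtain ⟨k, hk, rfl⟩ := List.getElem_of_mem hy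
        refine ⟨k, hk, ?_⟩
        rwa [List.getD_eq_getElem _ _ (by simpa using hk), List.getElem_map]
    · rw [mul_zero]

end BoundAlgorithm

/-! ### First-order equations in the field of fractions: polynomial extensions -/

section Good

variable {R : Type*} [CommRing R] {σ : R ≃+* R}

/-- Solutions `h` in the field of fractions of equations `u σ(h) - h = b`, where `u` is a unit and `b` lies in
the ring, lie in the ring. -/
def Good (σ : R ≃+* R) : Prop :=
  ∀ u p q b : R, IsUnit u → q ≠ 0 → u * σ p * q - p * σ q = b * q * σ q → q ∣ p

theorem Good.of_equiv {S : Type*} [CommRing S] {τ : S ≃+* S} (h : Good σ) (e : R ≃+* S)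
    (he : ∀ x, e (σ x) = τ (e x)) : Good τ := by
  intro u p q b hu hq heq
  obtain ⟨u, rfl⟩ := e.surjective u
  obtain ⟨p, rfl⟩ := e.surjective p
  obtain ⟨q, rfl⟩ := e.surjective q
  obtain ⟨b, rfl⟩ := e.surjective b
  refine map_dvd e (h u p q b ((MulEquiv.isUnit_map e).1 hu) (fun h0 => hq (by rw [h0, map_zero])) (e.injective ?_))
  simpa only [map_sub, map_mul, he] using heq

theorem Good.of_isField (h : IsField R) (σ : R ≃+* R) : Good σ := fun _ p q _ _ hq _ =>
  let ⟨r, hr⟩ := h.mul_inv_cancel hq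
  ⟨r * p, by rw [← mul_assoc, hr, one_mul]⟩

theorem Good.mem_range [IsDomain R] (h : Good σ) {u b : R} (hu : IsUnit u) {x : FractionRing R}
    (hx : algebraMap R (FractionRing R) u * fracAut σ x - x = algebraMap R _ b) :
    ∃ r, algebraMap R (FractionRing R) r = x := by
  obtain ⟨p, q, hq, rfl⟩ := IsFractionRing.div_surjective (A := R) x
  have hq0 := nonZeroDivisors.ne_zero hq
  have hinj := IsFractionRing.injective R (FractionRing R)
  have h1 : algebraMap R (FractionRing R) q ≠ 0 := (map_ne_zero_iff _ hinj).2 hq0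
  have h2 : algebraMap R (FractionRing R) (σ q) ≠ 0 := (map_ne_zero_iff _ hinj).2
    ((map_ne_zero_iff σ σ.injective).2 hq0)
  obtain ⟨r, rfl⟩ := h u p q b hu hq0 (hinj (by
    rw [map_div₀, fracAut_algebraMap, fracAut_algebraMap] at hx
    field_simp at hx
    simp only [map_sub, map_mul]
    linear_combination hx))
  exact ⟨r, by rw [map_mul, mul_div_cancel_left₀ _ h1]⟩

/-- There is no solution of the telescoping equation in the field of fractions, if there is no new constant. -/
theorem Good.telescoping_ne [IsDomain R] (h : Good σ) {β : R}
    (hK : ∀ x : R[X], polyAut σ β x = x → ∃ r, σ r = r ∧ x = Polynomial.C r) (p q : R) (hq : q ≠ 0) :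
    σ p * q - p * σ q ≠ β * q * σ q := by
  intro heq
  obtain ⟨r, rfl⟩ := h 1 p q β isUnit_one hq (by rw [one_mul, heq])
  have h1 : σ r - r = β := by
    have h2 : (σ r - r - β) * (q * σ q) = 0 := by
      rw [map_mul] at heq
      linear_combination heq
    rcases mul_eq_zero.1 h2 with h2 | h2
    · exact sub_eq_zero.1 h2
    · exact (mul_ne_zero hq ((map_ne_zero_iff σ σ.injective).2 hq) h2).elim
  -- A solution r in the ring makes X - r a constant of degree 1, which is excluded.
  obtain ⟨s, -, hs⟩ := hK (X - Polynomial.C r) (by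
    rw [map_sub, polyAut_X, polyAut_C, ← h1, map_sub]
    ring)
  have := congrArg (fun f => f.coeff 1) hs
  simp at this

/-- Over a field without solution of the telescoping equation, a polynomial that divides its image is constant. -/
theorem isUnit_of_dvd_polyAut {Q : Type*} [Field Q] [CharZero Q] {σ : Q ≃+* Q} {β : Q}
    (hβ : ∀ h : Q, σ h - h ≠ β) {q : Q[X]} (hq : q ≠ 0) (hdvd : q ∣ polyAut σ β q) : IsUnit q := by
  have hlc := leadingCoeff_ne_zero.2 hq
  let f := Polynomial.C q.leadingCoeff⁻¹ * q
  have hf : f.Monic := monic_C_mul_of_mul_leadingCoeff_eq_one (inv_mul_cancel₀ hlc)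
  have hu : ∀ c : Q, c ≠ 0 → IsUnit (Polynomial.C c) := fun c hc => isUnit_C.2 hc.isUnit
  have hfq : Associated f q := (associated_unit_mul_left q _ (hu _ (inv_ne_zero hlc)))
  have hff : f ∣ polyAut σ β f := by
    refine hfq.dvd.trans (hdvd.trans ?_)
    rw [map_mul, polyAut_C]
    exact Dvd.intro_left _ rfl
  -- The monic f and its image have the same degree, so divisibility forces equality. Comparing
  -- second coefficients then gives -(second coefficient)/deg as a forbidden solution, unless the
  -- degree is 0.
  have heq : polyAut σ β f = f := by
    refine eq_of_monic_of_dvd_of_natDegree_le hf ?_ hff (natDegree_polyAut σ β f).le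
    rw [Monic, leadingCoeff_polyAut, hf, map_one]
  refine (hfq.isUnit_iff).1 ?_
  rw [hf.isUnit_iff, ← hf.natDegree_eq_zero]
  by_contra hN
  have h1 := nextCoeff_polyAut σ β hf
  rw [heq] at h1
  have hN' : (f.natDegree : Q) ≠ 0 := Nat.cast_ne_zero.2 hN
  refine hβ (-f.nextCoeff / f.natDegree) ?_
  rw [map_div₀, map_natCast, map_neg, ← sub_div, div_eq_iff hN']
  linear_combination h1

theorem exists_coprime_parts {Q : Type*} [Field Q] (p : Q[X]) {q : Q[X]} (hq : q ≠ 0) :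
    ∃ d p' q' : Q[X], d ≠ 0 ∧ p = d * p' ∧ q = d * q' ∧ IsCoprime p' q' := by
  classical
  obtain ⟨p', hp'⟩ := EuclideanDomain.gcd_dvd_left p q
  obtain ⟨q', hq'⟩ := EuclideanDomain.gcd_dvd_right p q
  have hd : EuclideanDomain.gcd p q ≠ 0 := fun h => hq (by rw [hq', h, zero_mul])
  refine ⟨_, p', q', hd, hp', hq', ?_⟩
  refine ⟨EuclideanDomain.gcdA p q, EuclideanDomain.gcdB p q, mul_left_cancel₀ hd ?_⟩
  have h := EuclideanDomain.gcd_eq_gcd_ab p q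
  calc _ = (EuclideanDomain.gcd p q * p') * EuclideanDomain.gcdA p q +
        (EuclideanDomain.gcd p q * q') * EuclideanDomain.gcdB p q := by ring
    _ = EuclideanDomain.gcd p q * 1 := by rw [← hp', ← hq', ← h, mul_one]

/-- Descent on the degree: the leading coefficient of x satisfies a first-order equation over R with
the same unit u, hence lies in R. Subtracting its monomial leaves an equation of the same shape in
lower degree. -/
theorem Good.mem_lifts_of_polyAut [IsDomain R] (h : Good σ) {β u : R} (hu : IsUnit u) (n : ℕ) :
    ∀ (x : (FractionRing R)[X]) (b : R[X]), (∀ i, n ≤ i → x.coeff i = 0) →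
      Polynomial.C (algebraMap R _ u) * polyAut (fracAut σ) (algebraMap R _ β) x - x = b.map (algebraMap R _) →
      ∃ y : R[X], y.map (algebraMap R _) = x := by
  induction n with
  | zero =>
    intro x b hx _
    exact ⟨0, by rw [Polynomial.map_zero]; exact (Polynomial.ext fun i => hx i (Nat.zero_le i)).symm⟩
  | succ n ih =>
    intro x b hx heq
    have hdeg : x.natDegree ≤ n := natDegree_le_iff_coeff_eq_zero.2 fun i hi => hx i hi
    obtain ⟨r, hr⟩ := h.mem_range (u := u) (b := b.coeff n) (x := x.coeff n) hu (by
      rw [← coeff_map, ← heq, coeff_sub, coeff_C_mul]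
      congr 2
      exact (coeff_iterate_polyAut_top _ _ 1 hdeg).symm)
    obtain ⟨y, hy⟩ := ih (x - (monomial n r).map (algebraMap R _))
      (b - (Polynomial.C u * polyAut σ β (monomial n r) - monomial n r)) (fun i hi => by
        rw [coeff_sub, map_monomial, coeff_monomial, hr]
        split_ifs with hni
        · rw [hni, sub_self]
        · rw [hx i (by omega), sub_zero]) (by
        rw [Polynomial.map_sub, ← heq, Polynomial.map_sub, Polynomial.map_mul, map_C, map_polyAut_algebraMap, map_sub]
        ring)
    exact ⟨y + monomial n r, by rw [Polynomial.map_add, hy, sub_add_cancel]⟩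

/-- In lowest terms over the field of fractions of R, the equation shows that the denominator
divides its own image, so it is a unit by `isUnit_of_dvd_polyAut`. The fraction is thus a
polynomial, and `Good.mem_lifts_of_polyAut` puts its coefficients into R. Units of R[X] are units of
R, as R is a domain. -/
theorem Good.polynomial [IsDomain R] [CharZero R] (h : Good σ) {β : R}
    (hβ : ∀ p q : R, q ≠ 0 → σ p * q - p * σ q ≠ β * q * σ q) : Good (polyAut σ β) := by
  have : CharZero (FractionRing R) := IsFractionRing.charZero_of_isFractionRing R
  have hβQ := fracAut_sub_ne hβ
  have hinj : Function.Injective (Polynomial.map (algebraMap R (FractionRing R))) :=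
    map_injective _ (IsFractionRing.injective R _)
  set φ := polyAut (fracAut σ) (algebraMap R (FractionRing R) β) with hφ
  intro u p q b hu hq heq
  obtain ⟨u, hu', rfl⟩ := Polynomial.isUnit_iff.1 hu
  have hq0 : q.map (algebraMap R (FractionRing R)) ≠ 0 := fun h0 => hq (hinj (by rw [h0, Polynomial.map_zero]))
  obtain ⟨d, p', q', hd, hp', hq', hcop⟩ := exists_coprime_parts (p.map (algebraMap R (FractionRing R))) hq0
  have hφd : φ d ≠ 0 := (map_ne_zero_iff φ φ.injective).2 hd
  have hφC : ∀ r, φ (Polynomial.C r) = Polynomial.C (fracAut σ r) := polyAut_C _ _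
  have heq' := congrArg (Polynomial.map (algebraMap R (FractionRing R))) heq
  simp only [Polynomial.map_sub, Polynomial.map_mul, map_C, map_polyAut_algebraMap, ← hφ, hp', hq', map_mul] at heq'
  have h1 : Polynomial.C (algebraMap R (FractionRing R) u) * φ p' * q' - p' * φ q' =
      b.map (algebraMap R _) * q' * φ q' := by
    refine mul_left_cancel₀ (mul_ne_zero hd hφd) ?_
    linear_combination heq'
  have h2 : q' ∣ φ q' := by
    refine hcop.symm.dvd_of_dvd_mul_left ⟨Polynomial.C (algebraMap R (FractionRing R) u) * φ p' -
      b.map (algebraMap R _) * φ q', ?_⟩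
    linear_combination -h1
  have hq'0 : q' ≠ 0 := fun h0 => hq0 (by rw [hq', h0, mul_zero])
  obtain ⟨c, hc, rfl⟩ := Polynomial.isUnit_iff.1 (isUnit_of_dvd_polyAut hβQ hq'0 h2)
  have hc0 := hc.ne_zero
  have hcc : Polynomial.C c * Polynomial.C c⁻¹ = 1 := by rw [← map_mul, mul_inv_cancel₀ hc0, map_one]
  have hσc : Polynomial.C (fracAut σ c) * Polynomial.C (fracAut σ c)⁻¹ = 1 := by
    rw [← map_mul, mul_inv_cancel₀ ((map_ne_zero_iff _ (RingEquiv.injective _)).2 hc0), map_one]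
  obtain ⟨y, hy⟩ := h.mem_lifts_of_polyAut (β := β) hu' ((Polynomial.C c⁻¹ * p').natDegree + 1)
    (Polynomial.C c⁻¹ * p') b (fun i hi => coeff_eq_zero_of_natDegree_lt hi) (by
      rw [← hφ, map_mul, hφC, map_inv₀]
      rw [hφC] at h1
      linear_combination (Polynomial.C c⁻¹ * Polynomial.C (fracAut σ c)⁻¹) * h1 -
        (Polynomial.C (algebraMap R (FractionRing R) u) * φ p' * Polynomial.C (fracAut σ c)⁻¹) * hcc +
        (p' * Polynomial.C c⁻¹ + b.map (algebraMap R _) * Polynomial.C c * Polynomial.C c⁻¹) * hσc +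
        b.map (algebraMap R _) * hcc)
  refine ⟨y, hinj ?_⟩
  rw [Polynomial.map_mul, hp', hq', hy]
  linear_combination -(d * p') * hcc

end Good

/-! ### First-order equations in the field of fractions: Laurent extensions -/

section LaurentExtension

variable {R : Type*} [CommRing R]

/-- The endomorphism of the polynomial ring that extends `σ` and maps `X` to `α X`. -/
noncomputable def scaleHom (σ : R ≃+* R) (α : R) : R[X] →+* R[X] :=
  (compRingHom (Polynomial.C α * X)).comp (mapRingHom (σ : R →+* R))

theorem coeff_scaleHom (σ : R ≃+* R) (α : R) (f : R[X]) (n : ℕ) :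
    (scaleHom σ α f).coeff n = σ (f.coeff n) * α ^ n := by
  simp [scaleHom, comp_C_mul_X_coeff]

theorem scaleHom_C (σ : R ≃+* R) (α r : R) : scaleHom σ α (Polynomial.C r) = Polynomial.C (σ r) := by
  simp [scaleHom]

theorem scaleHom_X (σ : R ≃+* R) (α : R) : scaleHom σ α X = Polynomial.C α * X := by
  simp [scaleHom]

theorem natDegree_scaleHom [IsDomain R] (σ : R ≃+* R) {α : R} (hα : α ≠ 0) (f : R[X]) :
    (scaleHom σ α f).natDegree = f.natDegree := by
  refine le_antisymm (natDegree_le_iff_coeff_eq_zero.2 fun n hn => ?_) ?_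
  · rw [coeff_scaleHom, coeff_eq_zero_of_natDegree_lt hn, map_zero, zero_mul]
  · by_cases hf : f = 0
    · simp [hf]
    · refine le_natDegree_of_ne_zero ?_
      rw [coeff_scaleHom]
      exact mul_ne_zero ((map_ne_zero_iff σ σ.injective).2 (leadingCoeff_ne_zero.2 hf)) (pow_ne_zero _ hα)

theorem scaleHom_ne_zero [IsDomain R] (σ : R ≃+* R) {α : R} (hα : α ≠ 0) {f : R[X]} (hf : f ≠ 0) :
    scaleHom σ α f ≠ 0 := by
  intro h
  have h1 := coeff_scaleHom σ α f f.natDegree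
  rw [h, coeff_zero] at h1
  exact mul_ne_zero ((map_ne_zero_iff σ σ.injective).2 (leadingCoeff_ne_zero.2 hf)) (pow_ne_zero _ hα) h1.symm

theorem map_scaleHom_algebraMap [IsDomain R] (σ : R ≃+* R) (α : R) (f : R[X]) :
    (scaleHom σ α f).map (algebraMap R (FractionRing R)) =
      scaleHom (fracAut σ) (algebraMap R _ α) (f.map (algebraMap R (FractionRing R))) := by
  ext n
  rw [coeff_map, coeff_scaleHom, coeff_scaleHom, coeff_map, fracAut_algebraMap, map_mul, map_pow]

/-- After removal of the power of X, the remaining factor f is coprime to X and divides its image,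
and by degrees the quotient is a scalar. Comparing lowest and highest coefficients, their ratio w
satisfies σ(w) = α^N w with N = deg f, which is excluded unless N = 0. -/
theorem eq_C_mul_X_pow_of_dvd_scaleHom {Q : Type*} [Field Q] {σ : Q ≃+* Q} {α : Q} (hα : α ≠ 0)
    (hw : ∀ N, 0 < N → ∀ w : Q, w ≠ 0 → σ w ≠ α ^ N * w) {q : Q[X]} (hq : q ≠ 0) {m : ℕ}
    (hdvd : q ∣ X ^ m * scaleHom σ α q) : ∃ (c : Q) (j : ℕ), c ≠ 0 ∧ q = Polynomial.C c * X ^ j := by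
  obtain ⟨f, hf, hX⟩ := exists_eq_pow_rootMultiplicity_mul_and_not_dvd q hq 0
  set j := rootMultiplicity 0 q
  rw [map_zero, sub_zero] at hf hX
  have hf0 : f ≠ 0 := fun h => hX (by rw [h]; exact dvd_zero _)
  have hcop : IsCoprime f (X ^ (m + j)) :=
    ((irreducible_X.coprime_iff_not_dvd).2 hX).symm.pow_right
  have hff : f ∣ scaleHom σ α f := by
    have h1 : f ∣ X ^ (m + j) * (Polynomial.C (α ^ j) * scaleHom σ α f) := by
      refine (Dvd.intro_left _ hf.symm).trans (hdvd.trans (dvd_of_eq ?_))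
      conv_lhs => rw [hf, map_mul, map_pow, scaleHom_X, mul_pow, ← map_pow]
      ring
    have h2 := hcop.dvd_of_dvd_mul_left h1
    exact ((isUnit_C.2 (pow_ne_zero j hα).isUnit).dvd_mul_left).1 h2
  obtain ⟨s, hs⟩ := hff
  have hs0 : s ≠ 0 := fun h => scaleHom_ne_zero σ hα hf0 (by rw [hs, h, mul_zero])
  have hdeg := natDegree_scaleHom σ hα f
  rw [hs, natDegree_mul hf0 hs0] at hdeg
  obtain ⟨s, rfl⟩ := natDegree_eq_zero.1 (by omega : s.natDegree = 0)
  have h0 := coeff_scaleHom σ α f 0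
  have h1 := coeff_scaleHom σ α f f.natDegree
  rw [hs, coeff_mul_C] at h0 h1
  have hf00 : f.coeff 0 ≠ 0 := fun h => hX (X_dvd_iff.2 h)
  have hlc : f.coeff f.natDegree ≠ 0 := leadingCoeff_ne_zero.2 hf0
  have hN : f.natDegree = 0 := by
    by_contra hN
    have hσlc : σ (f.coeff f.natDegree) ≠ 0 := (map_ne_zero_iff σ σ.injective).2 hlc
    refine hw f.natDegree (Nat.pos_of_ne_zero hN) (f.coeff 0 / f.coeff f.natDegree) (div_ne_zero hf00 hlc) ?_
    rw [map_div₀, ← mul_div_assoc, div_eq_div_iff hσlc hlc]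
    rw [pow_zero, mul_one] at h0
    rw [← h0]
    linear_combination (f.coeff 0) * h1
  rw [eq_C_of_natDegree_eq_zero hN] at hf
  exact ⟨_, j, hf00, by rw [hf, mul_comm]⟩

/-- Strong induction on the index of the coefficient. If the two shifts differ, the smaller one
isolates x_n or σ(x_n) in terms of earlier coefficients, and only units have to be inverted. If they
agree, x_n satisfies a first-order equation with a unit and `Good` applies. -/
theorem Good.mem_lifts_of_scaleHom [IsDomain R] {σ : R ≃+* R} (h : Good σ) {v w α : R} (hv : IsUnit v)
    (hw : IsUnit w) (hα : IsUnit α) {i a : ℕ} {x : (FractionRing R)[X]} {b : R[X]}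
    (heq : Polynomial.C (algebraMap R _ v) * (scaleHom (fracAut σ) (algebraMap R _ α) x * X ^ i) -
      Polynomial.C (algebraMap R _ w) * (x * X ^ a) = b.map (algebraMap R _)) :
    ∃ y : R[X], y.map (algebraMap R _) = x := by
  have hcoeff : ∀ m, algebraMap R (FractionRing R) v *
        (if i ≤ m then fracAut σ (x.coeff (m - i)) * algebraMap R _ α ^ (m - i) else 0) -
      algebraMap R (FractionRing R) w * (if a ≤ m then x.coeff (m - a) else 0) = algebraMap R _ (b.coeff m) := by
    intro m
    rw [← coeff_map, ← heq, coeff_sub, coeff_C_mul, coeff_C_mul, coeff_mul_X_pow', coeff_mul_X_pow', coeff_scaleHom]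
  obtain ⟨v', hv'⟩ := hv.exists_right_inv
  obtain ⟨w', hw'⟩ := hw.exists_right_inv
  have hvQ : algebraMap R (FractionRing R) v * algebraMap R _ v' = 1 := by rw [← map_mul, hv', map_one]
  have hwQ : algebraMap R (FractionRing R) w * algebraMap R _ w' = 1 := by rw [← map_mul, hw', map_one]
  suffices ∀ n, ∃ r, algebraMap R (FractionRing R) r = x.coeff n by
    have h1 : x ∈ Polynomial.lifts (algebraMap R (FractionRing R)) := by
      rw [Polynomial.lifts_iff_coeff_lifts]
      exact fun n => this n
    simpa [Polynomial.mem_lifts] using h1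
  intro n
  induction n using Nat.strong_induction_on with
  | _ n ih =>
    rcases lt_trichotomy i a with hia | rfl | hia
    · have h1 := hcoeff (n + i)
      rw [if_pos (by omega), Nat.add_sub_cancel] at h1
      obtain ⟨α', hα'⟩ := (hα.pow n).exists_right_inv
      have hαQ : algebraMap R (FractionRing R) α ^ n * algebraMap R _ α' = 1 := by
        rw [← map_pow, ← map_mul, hα', map_one]
      obtain ⟨r, hr⟩ : ∃ r, algebraMap R (FractionRing R) r = if a ≤ n + i then x.coeff (n + i - a) else 0 := by
        split_ifs
        · exact ih _ (by omega)
        · exact ⟨0, map_zero _⟩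
      rw [← hr] at h1
      refine ⟨σ.symm (v' * α' * (b.coeff (n + i) + w * r)), (fracAut σ).injective ?_⟩
      rw [fracAut_algebraMap, RingEquiv.apply_symm_apply]
      simp only [map_mul, map_add, ← h1]
      linear_combination (fracAut σ (x.coeff n) * algebraMap R (FractionRing R) α ^ n * algebraMap R _ α') * hvQ +
        fracAut σ (x.coeff n) * hαQ
    · have h1 := hcoeff (n + i)
      rw [if_pos (by omega), if_pos (by omega), Nat.add_sub_cancel] at h1
      refine h.mem_range (u := w' * v * α ^ n) (b := w' * b.coeff (n + i))
        (((IsUnit.of_mul_eq_one w (by rw [mul_comm, hw'])).mul hv).mul (hα.pow n)) ?_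
      simp only [map_mul, map_pow, ← h1]
      linear_combination x.coeff n * hwQ
    · have h1 := hcoeff (n + a)
      rw [if_pos (by omega : a ≤ n + a), Nat.add_sub_cancel] at h1
      obtain ⟨r, hr⟩ : ∃ r, algebraMap R (FractionRing R) r =
          if i ≤ n + a then fracAut σ (x.coeff (n + a - i)) * algebraMap R _ α ^ (n + a - i) else 0 := by
        split_ifs
        · obtain ⟨r, hr⟩ := ih (n + a - i) (by omega)
          exact ⟨σ r * α ^ (n + a - i), by rw [map_mul, map_pow, ← hr, fracAut_algebraMap]⟩
        · exact ⟨0, map_zero _⟩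
      rw [← hr] at h1
      refine ⟨w' * (v * r - b.coeff (n + a)), ?_⟩
      simp only [map_mul, map_sub, ← h1]
      linear_combination x.coeff n * hwQ

/-- The property is inherited by Laurent polynomial extensions without new constants. -/
theorem Good.laurent [IsDomain R] {σ : R ≃+* R} (h : Good σ) {S : Type*} [CommRing S] [IsDomain S] {τ : S ≃+* S}
    (ι : R[X] →+* S) (hι : Function.Injective ι) (ht : IsUnit (ι X)) (hS : ∀ s, ∃ k f, s * ι X ^ k = ι f)
    (hC : ∀ r, τ (ι (Polynomial.C r)) = ι (Polynomial.C (σ r))) {α : R} (hα : IsUnit α)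
    (hX : τ (ι X) = ι (Polynomial.C α) * ι X) (hK : ∀ x, τ x = x → ∃ r, x = ι (Polynomial.C r)) : Good τ := by
  have hinjQ := IsFractionRing.injective R (FractionRing R)
  have hinj : Function.Injective (Polynomial.map (algebraMap R (FractionRing R))) := map_injective _ hinjQ
  have hτ : ∀ f, τ (ι f) = ι (scaleHom σ α f) := by
    intro f
    have : (τ : S →+* S).comp ι = ι.comp (scaleHom σ α) := by
      apply Polynomial.ringHom_ext
      · intro r
        simp [hC, scaleHom_C]
      · simp [hX, scaleHom_X]
    exact RingHom.congr_fun this f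
  have hα0 : algebraMap R (FractionRing R) α ≠ 0 := (map_ne_zero_iff _ hinjQ).2 hα.ne_zero
  -- If σ(w) = α^N w, then w⁻¹ solves a homogeneous first-order equation, hence is some r in R by
  -- `Good`, and r t^N would be a new constant of the extension.
  have hw : ∀ N, 0 < N → ∀ w : FractionRing R, w ≠ 0 → fracAut σ w ≠ algebraMap R _ α ^ N * w := by
    intro N hN w hw0 hw
    obtain ⟨r, hr⟩ := h.mem_range (u := α ^ N) (b := 0) (x := w⁻¹) (hα.pow N) (by
      rw [map_inv₀, hw, map_pow, map_zero, mul_inv, mul_inv_cancel_left₀ (pow_ne_zero N hα0), sub_self])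
    have hr' : σ r * α ^ N = r := by
      refine hinjQ ?_
      rw [map_mul, ← fracAut_algebraMap, hr, map_inv₀, hw, map_pow, mul_inv, mul_comm,
        mul_inv_cancel_left₀ (pow_ne_zero N hα0)]
    obtain ⟨s, hs⟩ := hK (ι (monomial N r)) (by
      rw [hτ]
      congr 1
      ext n
      rw [coeff_scaleHom, coeff_monomial]
      split_ifs with hn
      · rw [← hn, hr']
      · simp)
    have h1 := congrArg (fun f => f.coeff N) (hι hs)
    simp only [coeff_monomial, if_true, coeff_C, hN.ne', if_false] at h1
    rw [h1, map_zero] at hr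
    exact inv_ne_zero hw0 hr.symm
  intro u p q b hu hq heq
  obtain ⟨k₁, P, hP⟩ := hS p
  obtain ⟨k₂, Q, hQ⟩ := hS q
  obtain ⟨k₃, B, hB⟩ := hS b
  obtain ⟨a, U, hU⟩ := hS u
  obtain ⟨u', huu⟩ := hu.exists_right_inv
  obtain ⟨a', U', hU'⟩ := hS u'
  -- After multiplication by powers of t, u and its inverse become polynomials whose product is a
  -- power of X. The prime X then forces u = v t^(i-a) with v a unit of R.
  obtain ⟨v, i, hv, rfl⟩ : ∃ v i, IsUnit v ∧ U = Polynomial.C v * X ^ i := by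
    have h1 : U * U' = X ^ (a + a') := hι (by
      rw [map_mul, ← hU, ← hU', map_pow, pow_add]
      linear_combination (ι X ^ a * ι X ^ a') * huu)
    obtain ⟨i, -, e, he⟩ := (dvd_prime_pow prime_X _).1 (Dvd.intro _ h1)
    obtain ⟨v, hv, hve⟩ := Polynomial.isUnit_iff.1 (e⁻¹).isUnit
    exact ⟨v, i, hv, by rw [hve, ← he, mul_comm U, Units.inv_mul_cancel_left]⟩
  obtain ⟨k, P, Q, B, hP, hQ, hB⟩ : ∃ k P Q B, p * ι X ^ k = ι P ∧ q * ι X ^ k = ι Q ∧ b * ι X ^ k = ι B := by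
    refine ⟨k₁ + k₂ + k₃, P * X ^ (k₂ + k₃), Q * X ^ (k₁ + k₃), B * X ^ (k₁ + k₂), ?_, ?_, ?_⟩
    · rw [map_mul, ← hP, map_pow]; ring
    · rw [map_mul, ← hQ, map_pow]; ring
    · rw [map_mul, ← hB, map_pow]; ring
  have ht0 := ht.ne_zero
  have hQ0 : Q ≠ 0 := fun h0 => mul_ne_zero hq (pow_ne_zero k ht0) (by rw [hQ, h0, map_zero])
  set φ := scaleHom (fracAut σ) (algebraMap R (FractionRing R) α) with hφ
  have hmain : X ^ k * (Polynomial.C v * X ^ i * scaleHom σ α P * Q - X ^ a * P * scaleHom σ α Q) =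
      X ^ a * B * Q * scaleHom σ α Q := by
    apply hι
    have h1 : τ p * τ (ι X ^ k) = ι (scaleHom σ α P) := by rw [← map_mul, hP, hτ]
    have h2 : τ q * τ (ι X ^ k) = ι (scaleHom σ α Q) := by rw [← map_mul, hQ, hτ]
    rw [map_mul, map_pow] at hU
    rw [map_pow] at h1 h2
    simp only [map_mul, map_sub, map_pow]
    rw [← h1, ← h2, ← hP, ← hQ, ← hB]
    linear_combination (ι X ^ k * ι X ^ k * ι X ^ a * τ (ι X) ^ k) * heq -
      (ι X ^ k * ι X ^ k * τ p * τ (ι X) ^ k * q) * hU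
  have hQQ : Q.map (algebraMap R (FractionRing R)) ≠ 0 := fun h0 => hQ0 (hinj (by rw [h0, Polynomial.map_zero]))
  obtain ⟨d, P', Q', hd, hP', hQ', hcop⟩ := exists_coprime_parts (P.map (algebraMap R (FractionRing R))) hQQ
  have hφd : φ d ≠ 0 := scaleHom_ne_zero _ hα0 hd
  have hQ'0 : Q' ≠ 0 := fun h0 => hQQ (by rw [hQ', h0, mul_zero])
  have hmain' := congrArg (Polynomial.map (algebraMap R (FractionRing R))) hmain
  simp only [Polynomial.map_sub, Polynomial.map_mul, Polynomial.map_pow, map_X, map_C, map_scaleHom_algebraMap,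
    ← hφ, hP', hQ', map_mul] at hmain'
  have h1 : X ^ k * (Polynomial.C (algebraMap R _ v) * X ^ i * φ P' * Q' - X ^ a * P' * φ Q') =
      X ^ a * B.map (algebraMap R (FractionRing R)) * Q' * φ Q' := by
    refine mul_left_cancel₀ (mul_ne_zero hd hφd) ?_
    linear_combination hmain'
  -- Multiplying by powers of t has made everything polynomial, at the price of a power of X. The
  -- numerator is coprime to `Q'` and cancels from the divisibility.
  have h2 : Q' ∣ X ^ (k + a) * φ Q' := by
    refine hcop.symm.dvd_of_dvd_mul_left ⟨X ^ k * Polynomial.C (algebraMap R _ v) * X ^ i * φ P' -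
      X ^ a * B.map (algebraMap R (FractionRing R)) * φ Q', ?_⟩
    rw [pow_add]
    linear_combination -h1
  obtain ⟨c, j, hc0, rfl⟩ := eq_C_mul_X_pow_of_dvd_scaleHom hα0 hw hQ'0 h2
  have hcc : Polynomial.C c * Polynomial.C c⁻¹ = 1 := by rw [← map_mul, mul_inv_cancel₀ hc0, map_one]
  have hσc0 : fracAut σ c ≠ 0 := (map_ne_zero_iff _ (RingEquiv.injective _)).2 hc0
  obtain ⟨x, rfl⟩ : ∃ x, P' = Polynomial.C c * x := ⟨Polynomial.C c⁻¹ * P', by rw [← mul_assoc, hcc, one_mul]⟩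
  have hφC : ∀ r, φ (Polynomial.C r) = Polynomial.C (fracAut σ r) := scaleHom_C _ _
  have hφX : φ X = Polynomial.C (algebraMap R (FractionRing R) α) * X := scaleHom_X _ _
  obtain ⟨y, rfl⟩ := h.mem_lifts_of_scaleHom (i := k + i) (a := k + a) (α := α) hv (hα.pow j) hα (x := x)
    (b := Polynomial.C α ^ j * X ^ (a + j) * B) (by
      rw [← hφ, map_pow, Polynomial.map_mul, Polynomial.map_mul, Polynomial.map_pow, Polynomial.map_pow, map_C, map_X]
      rw [map_mul, map_mul, map_pow, hφC, hφX] at h1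
      refine mul_left_cancel₀ (mul_ne_zero (mul_ne_zero (C_ne_zero.2 hc0) (C_ne_zero.2 hσc0)) (pow_ne_zero j X_ne_zero)) ?_
      rw [map_pow]
      linear_combination h1)
  -- The reduced denominator was a scalar times X^j. Since X becomes a unit in the Laurent
  -- extension, this already gives the divisibility there.
  have h3 : X ^ j * P = Q * y := by
    apply hinj
    rw [Polynomial.map_mul, Polynomial.map_mul, Polynomial.map_pow, map_X, hP', hQ']
    ring
  obtain ⟨t', ht'⟩ := ht.exists_right_inv
  refine ⟨ι y * t' ^ j, mul_right_cancel₀ (pow_ne_zero k ht0) ?_⟩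
  have h4 := congrArg ι h3
  rw [map_mul, map_mul, map_pow, ← hP, ← hQ] at h4
  have h5 : ι X ^ j * t' ^ j = 1 := by rw [← mul_pow, ht', one_pow]
  linear_combination t' ^ j * h4 - (p * ι X ^ k) * h5

end LaurentExtension

/-! ### Induction along a ΠΣ-tower -/

section Tower

variable {A : Type*} [CommRing A] {σ : A ≃+* A}

theorem exists_restrict {B : Subring A} (h : ∀ x ∈ B, σ x ∈ B) (h' : ∀ x ∈ B, σ.symm x ∈ B) :
    ∃ σ' : B ≃+* B, ∀ x, (σ' x : A) = σ x :=
  ⟨RingEquiv.ofRingHom (((σ : A →+* A).comp B.subtype).codRestrict B fun x => h x x.2)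
    (((σ.symm : A →+* A).comp B.subtype).codRestrict B fun x => h' x x.2)
    (by ext x; exact σ.apply_symm_apply x) (by ext x; exact σ.symm_apply_apply x), fun _ => rfl⟩

theorem eval₂RingHom_subtype_injective {B : Subring A} {t : A} (ht : Transcendental B t) :
    Function.Injective (eval₂RingHom B.subtype t) := fun _ _ h =>
  (transcendental_iff_injective.1 ht) h

/-- The property holds in every step of a tower without new constants. -/
theorem PiSigmaTower.good [IsDomain A] [CharZero A] {F B : Subring A} (h : PiSigmaTower σ F B)
    (hF : IsField F) (hmap : F.map (σ : A →+* A) = F) (hK : constants σ ≤ F) :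
    F ≤ B ∧ ∃ σ' : B ≃+* B, (∀ x, (σ' x : A) = σ x) ∧ Good σ' := by
  induction h with
  | base =>
    obtain ⟨σ', hσ'⟩ := exists_restrict (σ := σ) (B := F)
      (fun x hx => by rw [← hmap]; exact ⟨x, hx, rfl⟩)
      (fun x hx => by
        rw [← hmap] at hx
        obtain ⟨y, hy, rfl⟩ := hx
        rwa [show (σ : A →+* A) y = σ y from rfl, RingEquiv.symm_apply_apply])
    exact ⟨le_rfl, σ', hσ', Good.of_isField hF σ'⟩
  | @sigma B t _ transc shift ih =>
    obtain ⟨hFB, σ', hσ', hgood⟩ := ih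
    let ι := eval₂RingHom B.subtype t
    have hι := eval₂RingHom_subtype_injective transc
    have hιC : ∀ r : B, ι (Polynomial.C r) = r := fun r => by simp [ι]
    have hιX : ι X = t := by simp [ι]
    have hrange : ι.range = Subring.closure (insert t (B : Set A)) := by
      refine le_antisymm ?_ (Subring.closure_le.2 ?_)
      · rintro _ ⟨f, rfl⟩
        refine Polynomial.induction_on f (fun r => ?_) (fun f g hf hg => ?_) (fun n r hr => ?_)
        · show ι _ ∈ _
          rw [hιC]
          exact Subring.subset_closure (Or.inr r.2)
        · rw [map_add]
          exact add_mem hf hg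
        · rw [pow_succ, ← mul_assoc, map_mul]
          exact mul_mem hr (by rw [hιX]; exact Subring.subset_closure (Or.inl rfl))
      · rintro x (rfl | hx)
        · exact ⟨X, hιX⟩
        · exact ⟨Polynomial.C ⟨x, hx⟩, hιC _⟩
    rw [← hrange]
    let e : B[X] ≃+* ι.range := RingEquiv.ofBijective ι.rangeRestrict
      ⟨fun x y h => hι (congrArg Subtype.val h), ι.rangeRestrict_surjective⟩
    have he : ∀ f, (e f : A) = ι f := fun f => rfl
    let β : B := ⟨σ t - t, shift⟩
    have hcomm : ∀ f, ι (polyAut σ' β f) = σ (ι f) := by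
      intro f
      have : ι.comp (polyAut σ' β : B[X] →+* B[X]) = (σ : A →+* A).comp ι := by
        apply Polynomial.ringHom_ext
        · intro r
          simp [polyAut_C, hιC, hσ']
        · simp only [RingHom.comp_apply, RingHom.coe_coe, polyAut_X, map_add, hιX, hιC, β]
          ring
      exact RingHom.congr_fun this f
    refine ⟨hFB.trans fun x hx => ⟨Polynomial.C ⟨x, hx⟩, hιC _⟩, (e.symm.trans (polyAut σ' β)).trans e, ?_, ?_⟩
    · intro x
      obtain ⟨f, rfl⟩ := e.surjective x
      simp only [RingEquiv.trans_apply, RingEquiv.symm_apply_apply, he, hcomm]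
    -- All constants of the big ring lie in F and hence in B, so adjoining t creates no new
    -- constant. This is what excludes the telescoping equation over B.
    · refine Good.of_equiv (σ := polyAut σ' β) (hgood.polynomial (hgood.telescoping_ne fun x hx => ?_)) e fun x => ?_
      · have h1 : ι x ∈ constants σ := by rw [mem_constants, ← hcomm, hx]
        refine ⟨⟨ι x, hFB (hK h1)⟩, Subtype.ext ?_, hι ?_⟩
        · rw [hσ']
          exact h1
        · exact (hιC ⟨ι x, hFB (hK h1)⟩).symm
      · simp only [RingEquiv.trans_apply, RingEquiv.symm_apply_apply]
  | @pi B t _ transc shift ih =>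
    obtain ⟨hFB, σ', hσ', hgood⟩ := ih
    obtain ⟨u, hu⟩ := shift
    set B' := Subring.closure (insert (t : A) (insert ((t⁻¹ : Aˣ) : A) (B : Set A))) with hB'
    have hBB : B ≤ B' := fun x hx => Subring.subset_closure (Or.inr (Or.inr hx))
    have htB : (t : A) ∈ B' := Subring.subset_closure (Or.inl rfl)
    have htB' : ((t⁻¹ : Aˣ) : A) ∈ B' := Subring.subset_closure (Or.inr (Or.inl rfl))
    have hus : ∀ u : Bˣ, ((u : B) : A) * ((u⁻¹ : Bˣ) : B) = 1 := fun u => by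
      rw [← Subring.coe_mul, Units.mul_inv, Subring.coe_one]
    have hσB : ∀ x ∈ B, σ.symm x ∈ B := fun x hx => by
      have : σ (σ'.symm ⟨x, hx⟩ : B) = x := by rw [← hσ', RingEquiv.apply_symm_apply]
      rw [← this, RingEquiv.symm_apply_apply]
      exact (σ'.symm ⟨x, hx⟩).2
    -- Stated for an arbitrary automorphism because it is needed for σ and for its inverse, to show
    -- that both preserve the Laurent extension.
    have hinv : ∀ (τ : A ≃+* A) (x y : A), τ (t : A) = x * t → x * y = 1 →
        τ ((t⁻¹ : Aˣ) : A) = y * ((t⁻¹ : Aˣ) : A) := by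
      intro τ x y h1 h2
      have h3 : τ (t : A) * τ ((t⁻¹ : Aˣ) : A) = 1 := by rw [← map_mul, Units.mul_inv, map_one]
      rw [h1] at h3
      have h4 : (t : A) * ((t⁻¹ : Aˣ) : A) = 1 := Units.mul_inv t
      linear_combination (y * ((t⁻¹ : Aˣ) : A)) * h3 - τ ((t⁻¹ : Aˣ) : A) * h2 -
        (x * y * τ ((t⁻¹ : Aˣ) : A)) * h4
    have hsymm : σ.symm (t : A) = σ.symm ((u⁻¹ : Bˣ) : B) * t := by
      rw [RingEquiv.symm_apply_eq, map_mul, RingEquiv.apply_symm_apply, hu, ← mul_assoc, mul_comm _ ((u : B) : A), hus,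
        one_mul]
    have hclos : ∀ τ : A ≃+* A, (∀ x ∈ B, τ x ∈ B) → (∃ x y : A, x ∈ B ∧ y ∈ B ∧ τ (t : A) = x * t ∧ x * y = 1) →
        ∀ x ∈ B', τ x ∈ B' := by
      rintro τ hτ ⟨a, b, ha, hb, h1, h2⟩
      suffices B' ≤ B'.comap (τ : A →+* A) from fun x hx => this hx
      refine Subring.closure_le.2 ?_
      rintro x (rfl | rfl | hx)
      · show τ (t : A) ∈ B'
        rw [h1]
        exact mul_mem (hBB ha) htB
      · show τ ((t⁻¹ : Aˣ) : A) ∈ B'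
        rw [hinv τ a b h1 h2]
        exact mul_mem (hBB hb) htB'
      · exact hBB (hτ x hx)
    obtain ⟨τ, hτ⟩ := exists_restrict (σ := σ) (B := B')
      (hclos σ (fun x hx => by rw [← hσ' ⟨x, hx⟩]; exact Subtype.prop _)
        ⟨_, _, (u : B).2, ((u⁻¹ : Bˣ) : B).2, hu, hus u⟩)
      (hclos σ.symm hσB ⟨_, _, hσB _ ((u⁻¹ : Bˣ) : B).2, hσB _ (u : B).2, hsymm, by
        rw [← map_mul, mul_comm, hus, map_one]⟩)
    refine ⟨hFB.trans hBB, τ, hτ, ?_⟩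
    let ι : B[X] →+* B' := eval₂RingHom (Subring.inclusion hBB) ⟨t, htB⟩
    have hιval : ∀ f, (ι f : A) = eval₂RingHom B.subtype (t : A) f := fun f => by
      have : B'.subtype.comp ι = eval₂RingHom B.subtype (t : A) := by
        apply Polynomial.ringHom_ext
        · intro r
          simp [ι]
        · simp [ι]
      exact RingHom.congr_fun this f
    have hιC : ∀ r : B, (ι (Polynomial.C r) : A) = r := fun r => by rw [hιval]; simp
    have hιX : (ι X : A) = t := by rw [hιval]; simp
    have hι : Function.Injective ι := fun x y h => eval₂RingHom_subtype_injective transc (by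
      rw [← hιval, ← hιval, h])
    refine hgood.laurent ι hι ?_ ?_ ?_ (α := (u : B)) u.isUnit ?_ ?_
    · exact IsUnit.of_mul_eq_one ⟨_, htB'⟩ (Subtype.ext (by
        rw [Subring.coe_mul, hιX]; exact Units.mul_inv t))
    · rintro ⟨s, hs⟩
      suffices ∃ k f, s * (t : A) ^ k = ι f by
        obtain ⟨k, f, h⟩ := this
        exact ⟨k, f, Subtype.ext (by rw [Subring.coe_mul, Subring.coe_pow, hιX, h])⟩
      induction hs using Subring.closure_induction with
      | mem x hx =>
        rcases hx with rfl | rfl | hx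
        · exact ⟨0, X, by rw [pow_zero, mul_one, hιX]⟩
        · exact ⟨1, 1, by rw [pow_one, Units.inv_mul, map_one, Subring.coe_one]⟩
        · exact ⟨0, Polynomial.C ⟨x, hx⟩, by rw [pow_zero, mul_one, hιC]⟩
      | zero => exact ⟨0, 0, by simp⟩
      | one => exact ⟨0, 1, by simp⟩
      | add x y _ _ hx hy =>
        obtain ⟨k, f, hf⟩ := hx
        obtain ⟨l, g, hg⟩ := hy
        refine ⟨k + l, f * X ^ l + g * X ^ k, ?_⟩
        rw [map_add, map_mul, map_mul, map_pow, map_pow, Subring.coe_add, Subring.coe_mul, Subring.coe_mul,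
          Subring.coe_pow, Subring.coe_pow, hιX, ← hf, ← hg]
        ring
      | neg x _ hx =>
        obtain ⟨k, f, hf⟩ := hx
        exact ⟨k, -f, by rw [map_neg, Subring.coe_neg, ← hf, neg_mul]⟩
      | mul x y _ _ hx hy =>
        obtain ⟨k, f, hf⟩ := hx
        obtain ⟨l, g, hg⟩ := hy
        refine ⟨k + l, f * g, ?_⟩
        rw [map_mul, Subring.coe_mul, ← hf, ← hg]
        ring
    · intro r
      refine Subtype.ext ?_
      rw [hτ, hιC, hιC, hσ']
    · refine Subtype.ext ?_
      rw [hτ, Subring.coe_mul, hιX, hιC, hu]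
    · intro x hx
      have h1 : (x : A) ∈ constants σ := by rw [mem_constants, ← hτ, hx]
      exact ⟨⟨x, hFB (hK h1)⟩, Subtype.ext (hιC ⟨x, hFB (hK h1)⟩).symm⟩

theorem IsPiSigmaRingExtension.good [IsDomain A] [CharZero A] {F : Subring A} (h : IsPiSigmaRingExtension σ F) :
    Good σ := by
  obtain ⟨-, σ', hσ', hgood⟩ := PiSigmaTower.good h.tower h.isField h.map_eq h.const
  exact hgood.of_equiv Subring.topEquiv hσ'

end Tower

/-! ### Transport of solvability along computable isomorphisms -/

section Transfer

variable {R : Type*} [CommRing R] {σ : R ≃+* R}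

theorem combC_equiv {S : Type*} [CommRing S] (e : R ≃+* S) (L : List (List R × R)) (z : ℕ → R) (j : ℕ) :
    combC (L.map (Prod.map (List.map e) e)) (fun k => e (z k)) j = e (combC L z j) := by
  rw [combC_map, combC, map_sum]
  refine Finset.sum_congr rfl fun k _ => ?_
  rw [map_mul, Prod.map_fst, ← map_zero e, List.getD_map]

theorem combG_equiv {S : Type*} [CommRing S] (e : R ≃+* S) (L : List (List R × R)) (z : ℕ → R) :
    combG (L.map (Prod.map (List.map e) e)) (fun k => e (z k)) = e (combG L z) := by
  rw [combG_map, combG, map_sum]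
  exact Finset.sum_congr rfl fun k _ => by rw [smul_eq_mul, smul_eq_mul, map_mul, Prod.map_snd]

theorem pLDE_equiv {S : Type*} [CommRing S] {τ : S ≃+* S} (e : R ≃+* S) (he : ∀ x, e (σ x) = τ (e x))
    (a f : List R) (c : ℕ → R) (g : R) :
    PLDE τ (a.map e) (f.map e) (fun j => e (c j)) (e g) ↔ PLDE σ a f c g := by
  have hit : ∀ k x, e ((⇑σ)^[k] x) = (⇑τ)^[k] (e x) := fun k x => by
    induction k with
    | zero => rfl
    | succ k ih => rw [Function.iterate_succ_apply', Function.iterate_succ_apply', he, ih]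
  rw [PLDE, PLDE, ← e.injective.eq_iff, map_sum, map_sum, List.length_map, List.length_map]
  simp only [map_mul, hit]
  have h : ∀ (l : List R) i, (l.map e).getD i 0 = e (l.getD i 0) := fun l i => by
    rw [← map_zero e, List.getD_map]
  simp only [h]

theorem IsBas.of_equiv {S : Type*} [CommRing S] {τ : S ≃+* S} (e : R ≃+* S) (he : ∀ x, e (σ x) = τ (e x))
    {d : ℕ} {a f : List R} {L : List (List R × R)} (h : IsBas σ d (PLDE σ a f) L) :
    IsBas τ d (PLDE τ (a.map e) (f.map e)) (L.map (Prod.map (List.map e) e)) := by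
  have hconst : ∀ {c : ℕ → S}, IsConst τ c → ∃ c', IsConst σ c' ∧ c = fun j => e (c' j) := by
    intro c hc
    refine ⟨fun j => e.symm (c j), fun j => e.injective ?_, funext fun j => (e.apply_symm_apply _).symm⟩
    rw [he, e.apply_symm_apply, hc j]
  refine ⟨?_, ?_, ?_, ?_, ?_⟩
  · intro r hr
    obtain ⟨r, hr', rfl⟩ := List.mem_map.1 hr
    rw [Prod.map_fst, List.length_map, h.length_eq r hr']
  · intro r hr x hx
    obtain ⟨r, hr', rfl⟩ := List.mem_map.1 hr
    obtain ⟨x, hx', rfl⟩ := List.mem_map.1 hx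
    rw [← he, h.const r hr' x hx']
  · intro r hr
    obtain ⟨r, hr', rfl⟩ := List.mem_map.1 hr
    have h1 := (pLDE_equiv e he a f _ _).2 (h.mem r hr')
    convert h1 using 2 with j
    · rw [Prod.map_fst, ← map_zero e, List.getD_map]
    · rfl
  · intro c hc g hg
    obtain ⟨c, hc', rfl⟩ := hconst hc
    obtain ⟨g, rfl⟩ := e.surjective g
    obtain ⟨z, hz, h1, h2⟩ := h.span c hc' g ((pLDE_equiv e he a f c g).1 hg)
    refine ⟨fun k => e (z k), fun k => by rw [← he, hz k], fun j hj => ?_, ?_⟩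
    · rw [combC_equiv, ← h1 j hj]
    · rw [combG_equiv, ← h2]
  · intro z hz h1 h2 k hk
    obtain ⟨z, hz', rfl⟩ := hconst hz
    simp only [combC_equiv, combG_equiv, EmbeddingLike.map_eq_zero_iff] at h1 h2 ⊢
    exact h.indep z hz' h1 h2 k (by simpa using hk)

variable {C : Type*} [Primcodable C] {ν : C → R}

/-- Solvability is preserved under isomorphisms that are computable on codes in both directions. -/
theorem Solver.of_equiv (hs : Solver σ ν) {S : Type*} [CommRing S] {τ : S ≃+* S} (e : R ≃+* S)
    (he : ∀ x, e (σ x) = τ (e x)) {C' : Type*} [Primcodable C'] {μ : C' → S}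
    (hG : RC ν fun c => e.symm (μ c)) (hH : RC μ fun c => e (ν c)) : Solver τ μ := by
  obtain ⟨F, hF, hF'⟩ := hs
  obtain ⟨G, hG, hG'⟩ := hG
  obtain ⟨H, hH, hH'⟩ := hH
  have hmapG : ∀ l : List C', ((l.map G).map ν).map e = l.map μ := fun l => by
    rw [List.map_map, List.map_map]
    exact List.map_congr_left fun c _ => by simp [hG']
  refine ⟨fun x => (F (x.1.map G, x.2.map G)).map (Prod.map (List.map H) H), ?_, fun a f ha => ?_⟩
  · have hG2 : Computable₂ fun (_ : List C' × List C') (c : C') => G c := hG.comp Computable.snd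
    have hH1 : Computable₂ fun (_ : (List C' × List C') × (List C × C)) (c : C) => H c := hH.comp Computable.snd
    exact computable_list_map (g := fun _ r => Prod.map (List.map H) H r)
      (hF.comp ((computable_list_map Computable.fst hG2).pair (computable_list_map Computable.snd hG2)))
      (Computable.pair (computable_list_map (Computable.fst.comp Computable.snd) hH1)
        (hH.comp (Computable.snd.comp Computable.snd)))
  · obtain ⟨x, hx, hx0⟩ := ha
    have h1 := (hF' (a.map G) (f.map G) ⟨G x, List.mem_map_of_mem hx, fun h0 => hx0 (by
      rw [hG', EmbeddingLike.map_eq_zero_iff] at h0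
      exact h0)⟩).of_equiv e he
    rw [hmapG, hmapG, List.length_map] at h1
    convert h1 using 1
    rw [List.map_map, List.map_map]
    refine List.map_congr_left ?_
    rintro ⟨r₁, r₂⟩ -
    simp only [Function.comp_apply, Prod.map_apply, List.map_map, Prod.mk.injEq]
    exact ⟨List.map_congr_left fun c _ => hH' c, hH' r₂⟩

end Transfer

/-! ### The step from R to R[X] -/

section Ready

/-- The data with which the algorithms work, and the properties under which they are correct. -/
structure Ready {R : Type*} [CommRing R] {C : Type*} [Primcodable C] (σ : R ≃+* R) (ν : C → R) : Prop where
  coded : Coded σ ν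
  solver : Solver σ ν
  roots : RootBound σ ν
  good : Good σ

variable {R : Type*} [CommRing R] {σ : R ≃+* R} {C : Type*} [Primcodable C] {ν : C → R}

/-- Constants of R[X] are constants of R, so a polynomial with such coefficients is replaced by the
one formed by their zeroth coefficients. -/
theorem RootBound.polynomial (hc : Coded σ ν) (h : RootBound σ ν) {β : R}
    (hK : ∀ x : R[X], polyAut σ β x = x → ∃ r, σ r = r ∧ x = Polynomial.C r) :
    RootBound (polyAut σ β) (polyOf ν) := by
  obtain ⟨N, hN, hN'⟩ := h
  obtain ⟨c₀, hc₀⟩ := hc.surj 0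
  refine ⟨fun l => N (l.map fun x => x.getD 0 c₀), hN.comp (computable_list_map (f := fun l : List (List C) => l)
    (g := fun _ x => x.getD 0 c₀) Computable.id (computable_list_getD c₀ Computable.snd (Computable.const 0))), fun l hl hl0 n hn => ?_⟩
  have hcoeff : ∀ x : List C, (polyOf ν x).coeff 0 = ν (x.getD 0 c₀) := fun x => by
    rw [coeff_polyOf, ← hc₀, List.getD_map]
  have hconst : ∀ x ∈ l, σ (ν (x.getD 0 c₀)) = ν (x.getD 0 c₀) ∧
      polyOf ν x = Polynomial.C (ν (x.getD 0 c₀)) := by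
    intro x hx
    obtain ⟨r, hr, hxr⟩ := hK _ (hl x hx)
    rw [← hcoeff, hxr, coeff_C_zero]
    exact ⟨hr, rfl⟩
  have hpoly : polyOf (polyOf ν) l = (polyOf ν (l.map fun x => x.getD 0 c₀)).map Polynomial.C := by
    ext1 i
    rw [coeff_map, coeff_polyOf, coeff_polyOf, List.map_map]
    by_cases hi : i < l.length
    · rw [List.getD_eq_getElem _ _ (by simpa using hi), List.getD_eq_getElem _ _ (by simpa using hi),
        List.getElem_map, List.getElem_map, Function.comp_apply, (hconst _ (List.getElem_mem hi)).2]
    · rw [List.getD_eq_default _ _ (by simpa using hi), List.getD_eq_default _ _ (by simpa using hi), map_zero]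
  refine hN' _ ?_ ?_ n ?_
  · intro c hc
    obtain ⟨x, hx, rfl⟩ := List.mem_map.1 hc
    exact (hconst x hx).1
  · rintro h0
    rw [hpoly, h0, Polynomial.map_zero] at hl0
    exact hl0 rfl
  · rw [hpoly, eval_natCast_map] at hn
    exact C_eq_zero.1 hn

/-- The whole induction step. `Good` together with the absence of new constants rules out fractional
solutions of σ(h) - h = β; that yields both the degree bound, and with it the solver, and `Good` for
R[X]. -/
theorem Ready.polynomial [IsDomain R] [CharZero R] (h : Ready σ ν) {β : R}
    (hK : ∀ x : R[X], polyAut σ β x = x → ∃ r, σ r = r ∧ x = Polynomial.C r) :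
    Ready (polyAut σ β) (polyOf ν) :=
  have hβ := h.good.telescoping_ne hK
  { coded := h.coded.polynomial β
    solver := h.solver.polynomial_of_bound h.coded hK (exists_degree_bound h.coded h.solver h.roots hβ)
    roots := h.roots.polynomial h.coded hK
    good := h.good.polynomial hβ }

theorem IsComputable.coded [Primcodable R] (h : IsComputable σ) : Coded σ (fun x : R => x) where
  surj x := ⟨x, rfl⟩
  add := ⟨_, h.add, fun _ => rfl⟩
  mul := ⟨_, h.mul, fun _ => rfl⟩
  neg := ⟨_, h.neg, fun _ => rfl⟩
  aut := ⟨_, h.aut, fun _ => rfl⟩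
  eq_zero := by
    classical
    exact ⟨inferInstance, (Primrec.eq.comp Primrec.id (Primrec.const 0)).decide.to_comp⟩

theorem NatRootsComputable.rootBound [Primcodable R] (h : NatRootsComputable σ) : RootBound σ (fun x : R => x) := by
  obtain ⟨N, hN, hN'⟩ := h
  -- The sum of the list of roots is at least each of its members.
  refine ⟨fun l => (N l).sum, computable_list_sum hN, fun l hl hl0 n hn => ?_⟩
  refine List.le_sum_of_mem ((hN' l hl ?_ n).2 ?_)
  · by_contra hcon
    push Not at hcon
    refine hl0 (Polynomial.ext fun i => ?_)
    rw [coeff_polyOf, coeff_zero, List.map_id']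
    exact (getD_mem_or l i 0).elim (hcon _) id
  · rw [← hn, polyOf, eval_finsetSum, Finset.sum_range]
    refine Finset.sum_congr rfl fun i _ => ?_
    rw [eval_monomial, getD_map_eq_get]

end Ready

/-! ### Iterated Σ-extensions and codes by lists of terms -/

section Towers

variable {R : Type*} [CommRing R] {σ : R ≃+* R} {C : Type*} [Primcodable C] {ν : C → R}
  {E : Type*} [CommRing E] [Algebra R E] {e : ℕ}

/-- The sum of terms `c t₁^{m₁} ⋯ t_e^{m_e}`, where the coefficients are given by codes. -/
def termsOf (ν : C → R) (t : Fin e → E) (l : List (C × (Fin e → ℕ))) : E :=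
  (l.map fun p => algebraMap R E (ν p.1) * ∏ i, t i ^ p.2 i).sum

theorem sum_eq_sum_range_getD (l : List R) : l.sum = ∑ i ∈ Finset.range l.length, l.getD i 0 := by
  rw [Finset.sum_range, ← Fin.sum_univ_getElem]
  exact Finset.sum_congr rfl fun i _ => (List.getD_eq_getElem _ _ i.2).symm

theorem Coded.rc_list_sum (hc : Coded σ ν) {Ω : Type*} [Primcodable Ω] {φ : Ω → List R}
    (h : RC (List.map ν) φ) : RC ν fun x => (φ x).sum :=
  (hc.rc_sum h.length (hc.rc_getD (h.precomp Computable.fst) Computable.snd)).of_eq fun x =>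
    (sum_eq_sum_range_getD (φ x)).symm

theorem IsSigmaExtension.solver_zero (hc : Coded σ ν) (hs : Solver σ ν) {τ : E ≃+* E} {t : Fin 0 → E}
    (h : IsSigmaExtension σ τ t) : Solver τ (termsOf ν t) := by
  have hbij : Function.Bijective (algebraMap R E) := by
    refine ⟨h.algebraicIndependent.algebraMap_injective, fun x => ?_⟩
    have hx : x ∈ Algebra.adjoin R (Set.range t) := by rw [h.adjoin_eq_top]; trivial
    rwa [Set.range_eq_empty, Algebra.adjoin_empty, Algebra.mem_bot] at hx
  let f := RingEquiv.ofBijective (algebraMap R E) hbij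
  have hf : ∀ l, termsOf ν t l = f ((l.map fun p => ν p.1).sum) := fun l => by
    rw [map_list_sum, List.map_map, termsOf]
    congr 1
    exact List.map_congr_left fun p _ => by rw [Finset.univ_eq_empty, Finset.prod_empty, mul_one]; rfl
  refine hs.of_equiv f (fun x => (h.extends_aut x).symm) ?_ ?_
  · refine (hc.rc_list_sum (φ := fun l : List (C × (Fin 0 → ℕ)) => l.map fun p => ν p.1) ?_).of_eq fun l => ?_
    · exact ⟨fun l => l.map Prod.fst, computable_list_map (f := fun l : List (C × (Fin 0 → ℕ)) => l) (g := fun _ p => p.1)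
        Computable.id (Computable.fst.comp Computable.snd), fun l => by rw [List.map_map]; rfl⟩
    · rw [hf, f.symm_apply_apply]
  · refine ⟨fun c => [(c, fun _ => 0)], ?_, fun c => ?_⟩
    · exact Computable.list_cons.comp (Computable.id.pair (Computable.const _)) (Computable.const [])
    · rw [hf]; simp

theorem computable_fin_tail : Computable fun m : Fin (e + 1) → ℕ => fun i : Fin e => m i.succ := by
  refine (Primrec.fin_curry.2 ?_).to_comp
  exact Primrec.fin_app.comp Primrec.fst ((Primrec.dom_finite Fin.succ).comp Primrec.snd)

theorem computable_vecCons {Ω : Type*} [Primcodable Ω] {n : Ω → ℕ} {m : Ω → Fin e → ℕ} (hn : Computable n)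
    (hm : Computable m) : Computable fun x => Matrix.vecCons (n x) (m x) := by
  have h : Primrec₂ fun (i : Fin (e + 1)) (x : ℕ × (Fin e → ℕ)) => Matrix.vecCons x.1 x.2 i := by
    refine Primrec.fin_curry₁.2 fun i => ?_
    refine Fin.cases ?_ (fun k => ?_) i
    · exact Primrec.fst
    · exact (Primrec.fin_app.comp Primrec.snd (Primrec.const k) : Primrec fun x : ℕ × (Fin e → ℕ) => x.2 k)
  have h' : Primrec fun x : ℕ × (Fin e → ℕ) => Matrix.vecCons x.1 x.2 :=
    Primrec.fin_curry.2 (h.comp Primrec.snd Primrec.fst)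
  exact h'.to_comp.comp (hn.pair hm)

variable [Algebra R[X] E]

/-- The lowest generator is absorbed into the base: E is viewed over R[X] with X acting as `t 0`,
and the other generators form a tower of height e. Algebraic independence is transferred by
regrouping polynomials in e + 1 variables as polynomials in e variables over R[X]. -/
theorem IsSigmaExtension.succ {τ : E ≃+* E} {t : Fin (e + 1) → E} (h : IsSigmaExtension σ τ t)
    (halg : ∀ p, algebraMap R[X] E p = aeval (t 0) p) {β : R} (hβ : τ (t 0) - t 0 = algebraMap R E β) :
    IsSigmaExtension (polyAut σ β) τ fun i : Fin e => t i.succ where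
  algebraicIndependent := by
    have h1 : Function.Injective fun p : MvPolynomial (Option (Fin e)) R =>
        MvPolynomial.aeval (fun i : Fin e => t i.succ) (MvPolynomial.optionEquivRight R (Fin e) p) := by
      have h2 : Function.Injective (MvPolynomial.aeval (R := R) (t ∘ (_root_.finSuccEquiv e).symm)) :=
        (algebraicIndependent_equiv (_root_.finSuccEquiv e).symm).2 h.algebraicIndependent
      convert h2 using 1
      ext p
      have h3 : ((MvPolynomial.aeval fun i : Fin e => t i.succ : MvPolynomial (Fin e) R[X] →ₐ[R[X]] E) :
            MvPolynomial (Fin e) R[X] →+* E).comp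
          (MvPolynomial.optionEquivRight R (Fin e) : MvPolynomial (Option (Fin e)) R →+* MvPolynomial (Fin e) R[X]) =
          ((MvPolynomial.aeval (t ∘ (_root_.finSuccEquiv e).symm) : MvPolynomial (Option (Fin e)) R →ₐ[R] E) :
            MvPolynomial (Option (Fin e)) R →+* E) := by
        apply MvPolynomial.ringHom_ext
        · intro r
          simp [halg]
        · rintro (_ | i)
          · simp [halg]
          · simp
      exact RingHom.congr_fun h3 p
    intro p q hpq
    obtain ⟨p, rfl⟩ := (MvPolynomial.optionEquivRight R (Fin e)).surjective p
    obtain ⟨q, rfl⟩ := (MvPolynomial.optionEquivRight R (Fin e)).surjective q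
    rw [h1 hpq]
  adjoin_eq_top := by
    refine eq_top_iff.2 fun x _ => ?_
    have hx : x ∈ Algebra.adjoin R (Set.range t) := by rw [h.adjoin_eq_top]; trivial
    induction hx using Algebra.adjoin_induction with
    | mem x hx =>
      obtain ⟨i, rfl⟩ := hx
      refine Fin.cases ?_ (fun k => Algebra.subset_adjoin ⟨k, rfl⟩) i
      have := (Algebra.adjoin R[X] (Set.range fun i : Fin e => t i.succ)).algebraMap_mem X
      rwa [halg, aeval_X] at this
    | algebraMap r =>
      have := (Algebra.adjoin R[X] (Set.range fun i : Fin e => t i.succ)).algebraMap_mem (Polynomial.C r)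
      rwa [halg, aeval_C] at this
    | add x y _ _ hx hy => exact add_mem (hx trivial) (hy trivial)
    | mul x y _ _ hx hy => exact mul_mem (hx trivial) (hy trivial)
  extends_aut p := by
    have h1 : (τ : E →+* E).comp (algebraMap R[X] E) = (algebraMap R[X] E).comp (polyAut σ β : R[X] →+* R[X]) := by
      apply Polynomial.ringHom_ext
      · intro r
        simp [halg, polyAut_C, h.extends_aut]
      · simp only [RingHom.comp_apply, RingHom.coe_coe, polyAut_X, halg, map_add, aeval_X, aeval_C, ← hβ]
        ring
    exact RingHom.congr_fun h1 p
  shift i := by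
    suffices ∀ x ∈ Algebra.adjoin R (t '' {j | j < i.succ}),
        x ∈ Algebra.adjoin R[X] ((fun i : Fin e => t i.succ) '' {j | j < i}) from this _ (h.shift i.succ)
    intro x hx
    induction hx using Algebra.adjoin_induction with
    | mem x hx =>
      obtain ⟨j, hj, rfl⟩ := hx
      revert hj
      refine Fin.cases (fun _ => ?_) (fun k hk => Algebra.subset_adjoin ⟨k, Fin.succ_lt_succ_iff.1 hk, rfl⟩) j
      have := (Algebra.adjoin R[X] ((fun i : Fin e => t i.succ) '' {j | j < i})).algebraMap_mem X
      rwa [halg, aeval_X] at this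
    | algebraMap r =>
      have := (Algebra.adjoin R[X] ((fun i : Fin e => t i.succ) '' {j | j < i})).algebraMap_mem (Polynomial.C r)
      rwa [halg, aeval_C] at this
    | add x y _ _ hx hy => exact add_mem hx hy
    | mul x y _ _ hx hy => exact mul_mem hx hy
  const x hx := by
    obtain ⟨c, hc, rfl⟩ := h.const x hx
    refine ⟨Polynomial.C c, ?_, by rw [halg, aeval_C]⟩
    rw [mem_constants, polyAut_C, (mem_constants σ c).1 hc]

-- A term with a polynomial coefficient is split into one term for each entry of its coefficient
-- list; the position in the list becomes the exponent of the lowest generator.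
omit [Primcodable C] in
theorem termsOf_polyOf {t : Fin (e + 1) → E} (halg : ∀ p, algebraMap R[X] E p = aeval (t 0) p)
    (l : List (List C × (Fin e → ℕ))) (c₀ : C) : termsOf (polyOf ν) (fun i : Fin e => t i.succ) l =
      termsOf ν t (l.map fun p => (List.range p.1.length).map fun i =>
        (p.1.getD i c₀, Matrix.vecCons i p.2)).flatten := by
  induction l with
  | nil => rfl
  | cons p l ih =>
    rw [termsOf] at ih ⊢
    rw [List.map_cons, List.map_cons, List.sum_cons, List.flatten_cons, termsOf, List.map_append, List.sum_append,
      ih, termsOf]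
    congr 1
    rw [List.map_map, sum_eq_sum_range_getD, List.length_map, List.length_range, halg, polyOf, map_sum,
      Finset.sum_mul]
    refine Finset.sum_congr rfl fun i hi => ?_
    rw [Finset.mem_range] at hi
    rw [getD_tabulate, if_pos hi, aeval_monomial, Function.comp_apply, Fin.prod_univ_succ,
      List.getD_eq_getElem _ _ (by simpa using hi), List.getElem_map, mul_assoc]
    simp only [Matrix.cons_val_zero, Matrix.cons_val_succ, List.getD_eq_getElem _ _ hi]

theorem IsSigmaExtension.solver_succ (hc : Coded σ ν) {τ : E ≃+* E} {t : Fin (e + 1) → E}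
    (halg : ∀ p, algebraMap R[X] E p = aeval (t 0) p)
    (hs : Solver τ (termsOf (polyOf ν) fun i : Fin e => t i.succ)) : Solver τ (termsOf ν t) := by
  refine hs.of_equiv (RingEquiv.refl E) (fun _ => rfl) ?_ ?_
  · obtain ⟨F, hF, hF'⟩ := hc.rc_monomial (Ω := C × (Fin (e + 1) → ℕ)) (n := fun p => p.2 0)
      (Computable.fin_app.comp Computable.snd (Computable.const 0)) (RC.code Computable.fst)
    refine ⟨fun l => l.map fun p => (F p, fun i => p.2 i.succ), ?_, fun l => ?_⟩
    · exact computable_list_map (f := fun l : List (C × (Fin (e + 1) → ℕ)) => l)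
        (g := fun _ p => (F p, fun i : Fin e => p.2 i.succ)) Computable.id
        ((hF.comp Computable.snd).pair (computable_fin_tail.comp (Computable.snd.comp Computable.snd)))
    · change _ = termsOf ν t l
      rw [termsOf, termsOf, List.map_map]
      congr 1
      refine List.map_congr_left fun p _ => ?_
      rw [Function.comp_apply, hF', halg, aeval_monomial, Fin.prod_univ_succ, mul_assoc]
  · obtain ⟨c₀, -⟩ := hc.surj 0
    refine ⟨_, ?_, fun l => (termsOf_polyOf halg l c₀).symm⟩
    refine computable_list_flatten (computable_list_map (f := fun l : List (List C × (Fin e → ℕ)) => l)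
      (g := fun _ p => (List.range p.1.length).map fun i => (p.1.getD i c₀, Matrix.vecCons i p.2)) Computable.id ?_)
    have h1 : Computable fun y : (List (List C × (Fin e → ℕ)) × (List C × (Fin e → ℕ))) × ℕ => y.1.2.1.getD y.2 c₀ :=
      computable_list_getD c₀ (Computable.fst.comp (Computable.snd.comp Computable.fst)) Computable.snd
    have h2 : Computable fun y : (List (List C × (Fin e → ℕ)) × (List C × (Fin e → ℕ))) × ℕ =>
        Matrix.vecCons y.2 y.1.2.2 :=
      computable_vecCons Computable.snd (Computable.snd.comp (Computable.snd.comp Computable.fst))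
    exact computable_tabulate (X := List (List C × (Fin e → ℕ)) × (List C × (Fin e → ℕ)))
      (F := fun x i => (x.2.1.getD i c₀, Matrix.vecCons i x.2.2))
      (Computable.list_length.comp (Computable.fst.comp Computable.snd)) (h1.pair h2)

end Towers

/-- Induction on the number of generators, with the base ring and its coding generalized: R is
replaced by R[X] while E and τ stay fixed. A constant of R[X] maps to a constant of E, which comes
from R, and `t 0` is transcendental over R, so R[X] has no new constants. -/
theorem IsSigmaExtension.solver {E : Type*} [CommRing E] {τ : E ≃+* E} {e : ℕ} :
    ∀ {R : Type*} [CommRing R] [IsDomain R] [CharZero R] [Algebra R E] {σ : R ≃+* R} {C : Type*} [Primcodable C]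
      {ν : C → R} {t : Fin e → E}, Ready σ ν → IsSigmaExtension σ τ t → Solver τ (termsOf ν t) := by
  induction e with
  | zero => exact fun hR h => h.solver_zero hR.coded hR.solver
  | succ e ih =>
    intro R _ _ _ _ σ C _ ν t hR h
    obtain ⟨β, hβ⟩ : ∃ β, algebraMap R E β = τ (t 0) - t 0 := by
      have := h.shift 0
      rwa [show t '' {j | j < 0} = ∅ by simp, Algebra.adjoin_empty, Algebra.mem_bot] at this
    let _ : Algebra R[X] E := (aeval (t 0)).toAlgebra
    have halg : ∀ p, algebraMap R[X] E p = aeval (t 0) p := fun p => rfl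
    have hsucc := h.succ halg hβ.symm
    refine IsSigmaExtension.solver_succ hR.coded halg (ih (hR.polynomial fun x hx => ?_) hsucc)
    obtain ⟨c, hc, hcx⟩ := h.const (aeval (t 0) x) (by
      rw [mem_constants, ← halg, hsucc.extends_aut, hx])
    refine ⟨c, hc, ?_⟩
    refine (transcendental_iff_injective.1 (h.algebraicIndependent.transcendental 0)) ?_
    rw [aeval_C, hcx]

end DiffRing

theorem mainTheorem10 {A E : Type*} [CommRing A] [IsDomain A] [CharZero A] [Primcodable A]
    [CommRing E] [Algebra A E] (σ : A ≃+* A) (τ : E ≃+* E) (F : Subring A)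
    (hA : DiffRing.IsPiSigmaRingExtension σ F)
    (hcomp : DiffRing.IsComputable σ)
    (hroots : DiffRing.NatRootsComputable σ)
    (hsolve : DiffRing.PLDESolvable σ (fun x : A => x))
    {e : ℕ} (t : Fin e → E) (hE : DiffRing.IsSigmaExtension σ τ t) :
    DiffRing.PLDESolvable τ (DiffRing.evalTerms (A := A) t) :=
  DiffRing.pldeSolvable_iff_solver.2 (hE.solver
    { coded := hcomp.coded
      solver := DiffRing.pldeSolvable_iff_solver.1 hsolve
      roots := hroots.rootBound
      good := hA.good })
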